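/- Let $\Sigma$ be a finite alphabet and let $s:\mathbb N\to\mathbb N$ be any function with $s(n)=O(\log n)$ (a machine with space bound $s$ may use at most $\max(1,s(n))$ cells on each work tape, in every computation on every input of length $n$). A *private alternating Turing machine* (PATM) has a two-way read-only input tape with end-markers and finitely many work tapes. Its memory (finite control, work tapes, input head) is divided into a public part and a part that is private to the universal player. Its states are existential, universal, deterministic, accepting or rejecting. In an existential state the existential player chooses one of finitely many moves; such moves neither read nor change the private part. In a universal state the universal player chooses one of finitely many moves, and in a deterministic state there is exactly one move; these moves may read and change the entire memory. A *strategy* for the existential player on input $x$ determines each choice of this player from the history of that player's own earlier choices and of all changes of the public part made by the other moves; moves that change only the private part, and their number, are not seen. A string $x$ is accepted if and only if the existential player has a strategy on $x$ such that every play following it reaches an accepting state after finitely many moves. A *blind alternating Turing machine* (BATM) is a PATM in which universal and deterministic moves change only the private part. A machine makes a *constant number of universal moves* if there is an $r$ such that no computation on any input contains more than $r$ moves made from universal states (deterministic moves are not counted). Then the class of languages over $\Sigma$ recognized by $s(n)$-space PATMs that make a constant number of universal moves equals $\mathsf{NL}$, and the class of languages over $\Sigma$ recognized by $s(n)$-space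 BATMs that make a constant number of universal moves also equals $\mathsf{NL}$, where $\mathsf{NL}$ is the class of languages recognized by nondeterministic Turing machines using $O(\log n)$ work space. -/

import Mathlib

namespace PrivAlt

/-- Head movements. -/
inductive Dir
  | left
  | stay
  | right

/-- Symbols on the read-only input tape: the input alphabet and the two end-markers. -/
inductive InSym (α : Type) : Type
  | leftEnd
  | sym (a : α)
  | rightEnd

/-- The input tape for `x` has cells `0, …, |x| + 1`; cell `0` is the left end-marker,
cell `|x| + 1` the right one. -/
def inputSym {α : Type} (x : List α) : ℕ → InSym α
  | 0 => .leftEnd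
  | i + 1 => match x[i]? with
    | some a => .sym a
    | none => .rightEnd

/-- The input head never leaves the cells `0, …, n + 1`. -/
def Dir.moveInput (n : ℕ) : Dir → ℕ → ℕ
  | .left, p => p - 1
  | .stay, p => p
  | .right, p => min (p + 1) (n + 1)

/-- Work tapes are infinite to the right only; a left move on cell `0` has no effect. -/
def Dir.moveWork : Dir → ℕ → ℕ
  | .left, p => p - 1
  | .stay, p => p
  | .right, p => p + 1

structure WorkTape (A : Type) where
  cells : ℕ → A
  head : ℕ

namespace WorkTape

variable {A : Type}

def empty (blank : A) : WorkTape A := ⟨fun _ => blank, 0⟩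

def read (t : WorkTape A) : A := t.cells t.head

/-- Write a symbol on the scanned cell, then move the head. -/
def act (t : WorkTape A) (w : A × Dir) : WorkTape A :=
  ⟨Function.update t.cells t.head w.1, w.2.moveWork t.head⟩

/-- The head is within the first `max 1 s` cells (a head always scans at least one cell, so
a space bound `0` is read as `1`). -/
def Within (t : WorkTape A) (s : ℕ) : Prop := t.head < max 1 s

end WorkTape

/-- Logarithmic growth of a space bound. -/
def IsLogBound (s : ℕ → ℕ) : Prop :=
  (fun n => (s n : ℝ)) =O[Filter.atTop] fun n : ℕ => Real.log n

/-! ### Nondeterministic machines and NL -/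

/-- A nondeterministic Turing machine with a two-way read-only input tape and finitely many
work tapes, indexed by `Tape`. -/
structure NTM (α : Type) where
  State : Type
  Sym : Type
  Tape : Type
  [finState : Finite State]
  [finSym : Finite Sym]
  [finTape : Finite Tape]
  blank : Sym
  start : State
  accept : State
  next : State → InSym α → (Tape → Sym) → Set (State × Dir × (Tape → Sym × Dir))

namespace NTM

variable {α : Type} (M : NTM α)

structure Cfg where
  state : M.State
  inHead : ℕ
  tapes : M.Tape → WorkTape M.Sym

def startCfg : M.Cfg := ⟨M.start, 0, fun _ => WorkTape.empty M.blank⟩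

def Step (x : List α) (c c' : M.Cfg) : Prop :=
  ∃ a ∈ M.next c.state (inputSym x c.inHead) (fun t => (c.tapes t).read),
    c' = ⟨a.1, a.2.1.moveInput x.length c.inHead, fun t => (c.tapes t).act (a.2.2 t)⟩

def Reachable (x : List α) (c : M.Cfg) : Prop :=
  Relation.ReflTransGen (M.Step x) M.startCfg c

def Accepts (x : List α) : Prop := ∃ c, M.Reachable x c ∧ c.state = M.accept

/-- On every input, every computation stays within the space bound on each work tape. -/
def SpaceBounded (s : ℕ → ℕ) : Prop :=
  ∀ x c, M.Reachable x c → ∀ t, (c.tapes t).Within (s x.length)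

end NTM

/-- Nondeterministic space `s`. -/
def NSPACE (α : Type) (s : ℕ → ℕ) : Set (Language α) :=
  {L | ∃ M : NTM α, M.SpaceBounded s ∧ ∀ x, x ∈ L ↔ M.Accepts x}

/-- Nondeterministic logarithmic space. -/
def NL (α : Type) : Set (Language α) :=
  {L | ∃ s, IsLogBound s ∧ L ∈ NSPACE α s}

/-! ### Private alternation -/

/-- The five kinds of control states. Deterministic states have a single successor and belong
to neither player's choices. -/
inductive Kind
  | existential
  | universal
  | deterministic
  | accept
  | reject

/-- A private alternating Turing machine. The memory is split into a public part (control
component `Pub`, work tapes `PubTape`, and the input head if `headPrivate = false`) and a part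
that is private to the universal player (control component `Priv`, work tapes `PrivTape`, and
the input head if `headPrivate = true`).

A move in an existential state is determined by the public part and by the choice of the
existential player in `EChoice`; it acts on the public part only. Moves in universal states
(with a choice in `UChoice`) and in deterministic states read and write everything. -/
structure PATM (α : Type) where
  Pub : Type
  Priv : Type
  Sym : Type
  PubTape : Type
  PrivTape : Type
  EChoice : Type
  UChoice : Type
  [finPub : Finite Pub]
  [finPriv : Finite Priv]
  [finSym : Finite Sym]
  [finPubTape : Finite PubTape]
  [finPrivTape : Finite PrivTape]
  [finEChoice : Finite EChoice]
  [finUChoice : Finite UChoice]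
  [neEChoice : Nonempty EChoice]
  [neUChoice : Nonempty UChoice]
  headPrivate : Bool
  blank : Sym
  startPub : Pub
  startPriv : Priv
  kind : Pub → Priv → Kind
  /-- The input symbol is available (as `some`) only if the input head is public. -/
  nextE : Pub → Option (InSym α) → (PubTape → Sym) → EChoice →
    Pub × Dir × (PubTape → Sym × Dir)
  nextU : Pub → Priv → InSym α → (PubTape → Sym) → (PrivTape → Sym) → UChoice →
    Pub × Priv × Dir × (PubTape → Sym × Dir) × (PrivTape → Sym × Dir)
  nextD : Pub → Priv → InSym α → (PubTape → Sym) → (PrivTape → Sym) →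
    Pub × Priv × Dir × (PubTape → Sym × Dir) × (PrivTape → Sym × Dir)

namespace PATM

variable {α : Type} (M : PATM α)

structure Cfg where
  pub : M.Pub
  priv : M.Priv
  inHead : ℕ
  pubTapes : M.PubTape → WorkTape M.Sym
  privTapes : M.PrivTape → WorkTape M.Sym

/-- What the existential player can see of a configuration. -/
structure View where
  pub : M.Pub
  inHead : Option ℕ
  pubTapes : M.PubTape → WorkTape M.Sym

def startCfg : M.Cfg :=
  ⟨M.startPub, M.startPriv, 0, fun _ => WorkTape.empty M.blank,
    fun _ => WorkTape.empty M.blank⟩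

variable {M}

def Cfg.kind (c : M.Cfg) : Kind := M.kind c.pub c.priv

def Cfg.view (c : M.Cfg) : M.View :=
  ⟨c.pub, if M.headPrivate then none else some c.inHead, c.pubTapes⟩

/-- The effect of the existential choice `e`; a private input head is neither read nor moved. -/
def Cfg.stepE (x : List α) (c : M.Cfg) (e : M.EChoice) : M.Cfg :=
  let a := M.nextE c.pub (if M.headPrivate then none else some (inputSym x c.inHead))
    (fun t => (c.pubTapes t).read) e
  ⟨a.1, c.priv, if M.headPrivate then c.inHead else a.2.1.moveInput x.length c.inHead,
    fun t => (c.pubTapes t).act (a.2.2 t), c.privTapes⟩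

/-- The effect of an action on the whole memory. -/
def Cfg.act (x : List α) (c : M.Cfg)
    (a : M.Pub × M.Priv × Dir × (M.PubTape → M.Sym × Dir) × (M.PrivTape → M.Sym × Dir)) :
    M.Cfg :=
  ⟨a.1, a.2.1, a.2.2.1.moveInput x.length c.inHead,
    fun t => (c.pubTapes t).act (a.2.2.2.1 t), fun t => (c.privTapes t).act (a.2.2.2.2 t)⟩

def Cfg.stepU (x : List α) (c : M.Cfg) (u : M.UChoice) : M.Cfg :=
  c.act x (M.nextU c.pub c.priv (inputSym x c.inHead) (fun t => (c.pubTapes t).read)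
    (fun t => (c.privTapes t).read) u)

def Cfg.stepD (x : List α) (c : M.Cfg) : M.Cfg :=
  c.act x (M.nextD c.pub c.priv (inputSym x c.inHead) (fun t => (c.pubTapes t).read)
    (fun t => (c.privTapes t).read))

variable (M)

/-- `M.ReachesWith x k c`: some computation on `x`, with arbitrary choices of both players, leads
to the configuration `c` after exactly `k` universal moves. -/
inductive ReachesWith (x : List α) : ℕ → M.Cfg → Prop
  | start : ReachesWith x 0 M.startCfg
  | existential {k : ℕ} {c : M.Cfg} (e : M.EChoice) :
      ReachesWith x k c → c.kind = .existential → ReachesWith x k (c.stepE x e)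
  | universal {k : ℕ} {c : M.Cfg} (u : M.UChoice) :
      ReachesWith x k c → c.kind = .universal → ReachesWith x (k + 1) (c.stepU x u)
  | deterministic {k : ℕ} {c : M.Cfg} :
      ReachesWith x k c → c.kind = .deterministic → ReachesWith x k (c.stepD x)

/-- An event noticed by the existential player: a choice made by that player, or a change of the
public part by another move (with the new public part). Moves that change only the private part
go unnoticed, and so does their number. -/
abbrev Event : Type := M.EChoice ⊕ M.View

/-- A strategy of the existential player: the choice to be made after a history of events. -/
abbrev Strategy : Type := List M.Event → M.EChoice

variable {M}

open Classical in
/-- The history after a universal or deterministic move from `c` to `c'`. -/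
noncomputable def observe (h : List M.Event) (c c' : M.Cfg) : List M.Event :=
  if c'.view = c.view then h else h ++ [Sum.inr c'.view]

/-- `Wins x σ h c`: from the configuration `c` with history `h`, every play in which the
existential player follows `σ` reaches an accepting state after finitely many moves. -/
inductive Wins (x : List α) (σ : M.Strategy) : List M.Event → M.Cfg → Prop
  | accept {h : List M.Event} {c : M.Cfg} : c.kind = .accept → Wins x σ h c
  | existential {h : List M.Event} {c : M.Cfg} : c.kind = .existential →
      Wins x σ (h ++ [Sum.inl (σ h)]) (c.stepE x (σ h)) → Wins x σ h c
  | universal {h : List M.Event} {c : M.Cfg} : c.kind = .universal →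
      (∀ u, Wins x σ (observe h c (c.stepU x u)) (c.stepU x u)) → Wins x σ h c
  | deterministic {h : List M.Event} {c : M.Cfg} : c.kind = .deterministic →
      Wins x σ (observe h c (c.stepD x)) (c.stepD x) → Wins x σ h c

variable (M)

/-- The existential player has a winning strategy in the game on input `x`. -/
def Accepts (x : List α) : Prop := ∃ σ : M.Strategy, Wins x σ [] M.startCfg

/-- On every input, every computation stays within the space bound on each work tape. -/
def SpaceBounded (s : ℕ → ℕ) : Prop :=
  ∀ x k c, M.ReachesWith x k c →
    (∀ t, (c.pubTapes t).Within (s x.length)) ∧ ∀ t, (c.privTapes t).Within (s x.length)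

/-- No computation, on any input, contains more than `r` universal moves. -/
def UniversalMovesAtMost (r : ℕ) : Prop := ∀ x k c, M.ReachesWith x k c → k ≤ r

/-- Blind machines: only existential moves change the public part. -/
def IsBlind : Prop :=
  ∀ (x : List α) (c : M.Cfg),
    (c.kind = .universal → ∀ u, (c.stepU x u).view = c.view) ∧
    (c.kind = .deterministic → (c.stepD x).view = c.view)

def Recognizes (L : Language α) : Prop := ∀ x, x ∈ L ↔ M.Accepts x

end PATM

/-- Languages of `s`-space private alternating machines with constantly many universal moves. -/
def PASPACEConst (α : Type) (s : ℕ → ℕ) : Set (Language α) :=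
  {L | ∃ M : PATM α, M.SpaceBounded s ∧ (∃ r, M.UniversalMovesAtMost r) ∧ M.Recognizes L}

/-- Languages of `s`-space blind alternating machines with constantly many universal moves. -/
def BASPACEConst (α : Type) (s : ℕ → ℕ) : Set (Language α) :=
  {L | ∃ M : PATM α, M.IsBlind ∧ M.SpaceBounded s ∧ (∃ r, M.UniversalMovesAtMost r) ∧
    M.Recognizes L}

end PrivAlt

namespace PrivAlt

open Relation

/-!
Both inclusions pass through nondeterministic programs on finitely many counters that range over
the positions of the input tape. Such a program is as powerful as a logarithmic-space machine: a
work tape of logarithmic length is a pair of numbers of polynomial size, and such numbers are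
tuples of digits in base `n + 2`.

A blind machine runs such a program with one universal move and no work tape. The universal player
privately selects one counter, which is then followed by the input head, while the existential
player publishes a computation. Since the selection stays hidden, the computation has to be correct
for every counter.

Conversely, if a machine makes at most `r` universal moves, then a strategy is winning if and only
if it wins against each of the finitely many sequences of `r + 1` universal choices. A
nondeterministic machine follows the plays against all these sequences at once, and makes the
choices of the existential player as they are needed. For the choices to come from a single
strategy, plays with the same visible history have to receive the same choice. Histories are too
long to be stored, but their equality is a finite relation, and it can be updated if the plays wait
for each other at every visible event.
-/

/-! ### Relations defined by finite programs -/

section Programs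

variable {X P Q I S T : Type}

/-- A finite program over the primitive operations `P`: a finite graph whose edges carry a
primitive operation or, for `none`, no operation at all. -/
structure Program (P : Type) where
  Node : Type
  [finNode : Finite Node]
  entry : Node
  exit : Node
  edge : Node → Option P → Node → Prop

attribute [instance] Program.finNode

/-- The semantics of optional operations: `none` leaves the store alone. -/
def idleOr (R : I → T → T → Prop) : Option I → T → T → Prop
  | none, t, t₁ => t₁ = t
  | some i, t, t₁ => R i t t₁

/-- A step in a graph whose edges are labelled by relations on stores. -/
def GraphStep (E : Q → I → Q → Prop) (R : I → T → T → Prop) (c d : Q × T) : Prop :=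
  ∃ i, E c.1 i d.1 ∧ R i c.2 d.2

/-- The input-output relation of a program. -/
def Program.Runs (p : Program P) (sem : P → T → T → Prop) (t t₁ : T) : Prop :=
  ReflTransGen (GraphStep p.edge (idleOr sem)) (p.entry, t) (p.exit, t₁)

/-- A family of relations on stores, indexed by the inputs, is definable if a single program over
the primitive operations computes all of its members. -/
def Definable (sem : P → X → T → T → Prop) (R : X → T → T → Prop) : Prop :=
  ∃ p : Program P, ∀ x t t', R x t t' ↔ p.Runs (sem · x) t t'

theorem graphPath_induction {E : Q → I → Q → Prop} {R : I → T → T → Prop} {q q' : Q} {t t' : T}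
    (h : ReflTransGen (GraphStep E R) (q, t) (q', t')) {motive : Q → T → Prop}
    (refl : motive q t)
    (step : ∀ {q₁ t₁ i q₂ t₂}, E q₁ i q₂ → R i t₁ t₂ → motive q₁ t₁ → motive q₂ t₂) :
    motive q' t' := by
  suffices ∀ c, ReflTransGen (GraphStep E R) (q, t) c → motive c.1 c.2 from this _ h
  intro c hc
  induction hc with
  | refl => exact refl
  | tail _ hstep ih =>
    obtain ⟨i, hE, hR⟩ := hstep
    exact step hE hR ih

/-- The edges of the graph obtained by replacing every edge labelled `i` by a copy of `p i`. -/
inductive SubstEdge (E : Q → I → Q → Prop) (p : I → Program P) :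
    Q ⊕ (Σ i, (Q × Q) × (p i).Node) → Option P → Q ⊕ (Σ i, (Q × Q) × (p i).Node) → Prop
  | enter {q i q'} : E q i q' →
      SubstEdge E p (.inl q) none (.inr ⟨i, (q, q'), (p i).entry⟩)
  | inside {q i q' g o g'} : (p i).edge g o g' →
      SubstEdge E p (.inr ⟨i, (q, q'), g⟩) o (.inr ⟨i, (q, q'), g'⟩)
  | leave {q i q'} : E q i q' →
      SubstEdge E p (.inr ⟨i, (q, q'), (p i).exit⟩) none (.inl q')

theorem substEdge_path_of_path {E : Q → I → Q → Prop} (p : I → Program P)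
    {sem : P → T → T → Prop} {q q' : Q} {t t' : T}
    (h : ReflTransGen (GraphStep E fun i => (p i).Runs sem) (q, t) (q', t')) :
    ReflTransGen (GraphStep (SubstEdge E p) (idleOr sem)) (.inl q, t) (.inl q', t') := by
  refine graphPath_induction h (motive := fun q₁ t₁ =>
    ReflTransGen (GraphStep (SubstEdge E p) (idleOr sem)) (.inl q, t) (.inl q₁, t₁)) .refl
    fun {q₁ t₁ i q₂ t₂} hE hR ih => ih.trans ?_
  let inCopy (g : (p i).Node) : Q ⊕ (Σ i, (Q × Q) × (p i).Node) := .inr ⟨i, (q₁, q₂), g⟩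
  have inside : ReflTransGen (GraphStep (SubstEdge E p) (idleOr sem))
      (inCopy (p i).entry, t₁) (inCopy (p i).exit, t₂) :=
    ReflTransGen.lift (Prod.map inCopy id) (fun _ _ ⟨o, ho, ht⟩ => ⟨o, .inside ho, ht⟩) _ _ hR
  have leave : ReflTransGen (GraphStep (SubstEdge E p) (idleOr sem))
      (inCopy (p i).entry, t₁) (.inl q₂, t₂) := inside.tail ⟨none, .leave hE, rfl⟩
  exact .head (b := (inCopy (p i).entry, t₁)) ⟨none, .enter hE, rfl⟩ leave

theorem path_of_substEdge_path {E : Q → I → Q → Prop} (p : I → Program P)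
    {sem : P → T → T → Prop} {q q' : Q} {t t' : T}
    (h : ReflTransGen (GraphStep (SubstEdge E p) (idleOr sem)) (.inl q, t) (.inl q', t')) :
    ReflTransGen (GraphStep E fun i => (p i).Runs sem) (q, t) (q', t') := by
  let Reached : Q → T → Prop := fun q₁ t₁ =>
    ReflTransGen (GraphStep E fun i => (p i).Runs sem) (q, t) (q₁, t₁)
  refine graphPath_induction h (motive := fun n u => match n with
    | .inl q₁ => Reached q₁ u
    | .inr ⟨i, (q₁, _), g⟩ => ∃ t₁, Reached q₁ t₁ ∧
        ReflTransGen (GraphStep (p i).edge (idleOr sem)) ((p i).entry, t₁) (g, u)) .refl ?_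
  intro n u o n' u' hedge hsem ih
  cases hedge with
  | enter hE =>
    cases hsem
    exact ⟨u, ih, .refl⟩
  | inside ho =>
    obtain ⟨t₁, hreached, hrun⟩ := ih
    exact ⟨t₁, hreached, hrun.tail ⟨o, ho, hsem⟩⟩
  | leave hE =>
    cases hsem
    obtain ⟨t₁, hreached, hrun⟩ := ih
    exact hreached.tail ⟨_, hE, hrun⟩

namespace Definable

variable {sem : P → X → T → T → Prop} {R R' : X → T → T → Prop}

theorem congr (h : Definable sem R) (hR : ∀ x t t', R' x t t' ↔ R x t t') : Definable sem R' := by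
  obtain ⟨p, hp⟩ := h
  exact ⟨p, fun x t t' => (hR x t t').trans (hp x t t')⟩

theorem graph [Finite Q] [Finite I] (E : Q → I → Q → Prop) {R : I → X → T → T → Prop}
    (hR : ∀ i, Definable sem (R i)) (q q' : Q) :
    Definable sem fun x t t' => ReflTransGen (GraphStep E (R · x)) (q, t) (q', t') := by
  choose p hp using hR
  refine ⟨⟨_, .inl q, .inl q', SubstEdge E p⟩, fun x t t' => ?_⟩
  have hRp : (R · x) = fun i => (p i).Runs (sem · x) := by
    ext i t t'
    exact hp i x t t'
  simp only [hRp]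
  exact ⟨substEdge_path_of_path p, path_of_substEdge_path p⟩

theorem prim (o : P) : Definable sem (sem o) := by
  refine ⟨⟨Bool, false, true, fun q i q' => q = false ∧ i = some o ∧ q' = true⟩,
    fun x t t' => ⟨fun h => .single ⟨some o, ⟨rfl, rfl, rfl⟩, h⟩, fun h => ?_⟩⟩
  refine graphPath_induction h (motive := fun q u => if q then sem o x t u else u = t) rfl ?_
  rintro _ u _ _ u' ⟨rfl, rfl, rfl⟩ hsem ih
  obtain rfl : u = t := by simpa using ih
  exact hsem

theorem id : Definable sem fun _ t t' => t' = t := by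
  refine ⟨⟨Unit, (), (), fun _ _ _ => False⟩, fun x t t' => ⟨?_, fun h => ?_⟩⟩
  · rintro rfl
    exact .refl
  · exact graphPath_induction h (motive := fun _ u => u = t) rfl fun hE => hE.elim

theorem iUnion [Finite I] {R : I → X → T → T → Prop} (h : ∀ i, Definable sem (R i)) :
    Definable sem fun x t t' => ∃ i, R i x t t' := by
  refine (graph (fun q _ q' => q = false ∧ q' = true) h false true).congr
    fun x t t' => ⟨fun ⟨i, hi⟩ => .single ⟨i, ⟨rfl, rfl⟩, hi⟩, fun h => ?_⟩
  refine graphPath_induction h (motive := fun q u => if q then ∃ i, R i x t u else u = t) rfl ?_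
  rintro _ u i _ u' ⟨rfl, rfl⟩ hR ih
  obtain rfl : u = t := by simpa using ih
  exact ⟨i, hR⟩

theorem empty : Definable sem fun _ _ _ => False :=
  (iUnion (I := Empty) (R := fun i => i.elim) fun i => i.elim).congr (by simp)

theorem union (h : Definable sem R) (h' : Definable sem R') :
    Definable sem fun x t t' => R x t t' ∨ R' x t t' :=
  (iUnion (I := Bool) (R := fun b => cond b R R')
    (Bool.forall_bool.2 ⟨h', h⟩)).congr (by simp [or_comm])

theorem comp (h : Definable sem R) (h' : Definable sem R') :
    Definable sem fun x t t' => ∃ u, R x t u ∧ R' x u t' := by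
  refine (graph (I := Bool)
    (fun (q : Fin 3) i q' => q = 0 ∧ i = true ∧ q' = 1 ∨ q = 1 ∧ i = false ∧ q' = 2)
    (R := fun b => cond b R R') (Bool.forall_bool.2 ⟨h', h⟩) 0 2).congr
    fun x t t' => ⟨?_, fun h => ?_⟩
  · rintro ⟨u, hR, hR'⟩
    exact .head (b := (1, u)) ⟨true, by simp, hR⟩ (.single ⟨false, by simp, hR'⟩)
  · refine graphPath_induction h (motive := fun q u => match q with
      | 0 => u = t
      | 1 => R x t u
      | 2 => ∃ v, R x t v ∧ R' x v u) rfl ?_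
    rintro _ u _ _ u' (⟨rfl, rfl, rfl⟩ | ⟨rfl, rfl, rfl⟩) hstep ih
    · cases ih
      exact hstep
    · exact ⟨u, ih, hstep⟩

theorem star (h : Definable sem R) : Definable sem fun x => ReflTransGen (R x) :=
  (graph (fun (_ _ _ : Unit) => True) (fun _ => h) () ()).congr fun _ _ _ =>
    ⟨fun h => h.lift (((), ·)) fun _ _ hR => ⟨(), trivial, hR⟩,
      fun h => h.lift Prod.snd fun _ _ ⟨_, _, hR⟩ => hR⟩

theorem converse (inv : P → P) (hinv : ∀ o x t t', sem (inv o) x t t' ↔ sem o x t' t)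
    (h : Definable sem R) : Definable sem fun x t t' => R x t' t := by
  obtain ⟨p, hp⟩ := h
  refine ⟨⟨p.Node, p.exit, p.entry, fun q o q' => ∃ o', p.edge q' o' q ∧ o = o'.map inv⟩,
    fun x t t' => (hp x t' t).trans ?_⟩
  have idleOr_inv (o : Option P) (t t' : T) :
      idleOr (sem · x) (o.map inv) t t' ↔ idleOr (sem · x) o t' t := by
    cases o with
    | none => exact eq_comm
    | some o => exact hinv o x t t'
  rw [Program.Runs, ← reflTransGen_swap, Program.Runs]
  congr! 1
  ext c c'
  constructor
  · rintro ⟨o, hedge, hsem⟩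
    exact ⟨o.map inv, ⟨o, hedge, rfl⟩, (idleOr_inv o _ _).2 hsem⟩
  · rintro ⟨_, ⟨o, hedge, rfl⟩, hsem⟩
    exact ⟨o, hedge, (idleOr_inv o _ _).1 hsem⟩

end Definable

/-- Composition of relations along a list. -/
def seqRel (R : I → T → T → Prop) : List I → T → T → Prop
  | [], t, t' => t' = t
  | i :: l, t, t' => ∃ u, R i t u ∧ seqRel R l u t'

theorem Definable.seq {sem : P → X → T → T → Prop} {R : I → X → T → T → Prop}
    (h : ∀ i, Definable sem (R i)) :
    ∀ l : List I, Definable sem fun x => seqRel (R · x) l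
  | [] => .id
  | i :: l => (h i).comp (Definable.seq h l)

/-- Every `R`-step can be matched by an `R'`-step so that related stores remain related. -/
def Simulates (E : S → T → Prop) (R : S → S → Prop) (R' : T → T → Prop) : Prop :=
  ∀ ⦃s t s₁⦄, E s t → R s s₁ → ∃ t₁, R' t t₁ ∧ E s₁ t₁

/-- Simulation in both directions. -/
def Bisimulates (E : S → T → Prop) (R : S → S → Prop) (R' : T → T → Prop) : Prop :=
  Simulates E R R' ∧ Simulates (flip E) R' R

theorem Simulates.idleOr {E : S → T → Prop} {R : I → S → S → Prop} {R' : I → T → T → Prop}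
    (h : ∀ i, Simulates E (R i) (R' i)) (o : Option I) :
    Simulates E (idleOr R o) (idleOr R' o) := by
  intro s t s' hE hs
  cases o with
  | none =>
    cases hs
    exact ⟨t, rfl, hE⟩
  | some i => exact h i hE hs

theorem Simulates.graphPath {E : S → T → Prop} {R : I → S → S → Prop} {R' : I → T → T → Prop}
    (h : ∀ i, Simulates E (R i) (R' i)) (F : Q → I → Q → Prop) (q q' : Q) :
    Simulates E (fun s s' => ReflTransGen (GraphStep F R) (q, s) (q', s'))
      fun t t' => ReflTransGen (GraphStep F R') (q, t) (q', t') := by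
  intro s t s' hE hpath
  refine graphPath_induction hpath (motive := fun q₁ s₁ =>
    ∃ t₁, ReflTransGen (GraphStep F R') (q, t) (q₁, t₁) ∧ E s₁ t₁) ⟨t, .refl, hE⟩ ?_
  rintro q₁ s₁ i q₂ s₂ hF hR ⟨t₁, hpath, hE⟩
  obtain ⟨t₂, hR', hE'⟩ := h i hE hR
  exact ⟨t₂, hpath.tail ⟨i, hF, hR'⟩, hE'⟩

theorem Definable.transport {P' : Type} [Finite P'] {semS : P' → X → S → S → Prop}
    {sem : P → X → T → T → Prop} (E : X → S → T → Prop) {R : X → S → S → Prop}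
    (h : Definable semS R)
    (hprim : ∀ o, ∃ R', Definable sem R' ∧ ∀ x, Bisimulates (E x) (semS o x) (R' x)) :
    ∃ R', Definable sem R' ∧ ∀ x, Bisimulates (E x) (R x) (R' x) := by
  choose R' hR' hsim using hprim
  obtain ⟨p, hp⟩ := h
  refine ⟨_, graph p.edge (R := fun o x => idleOr (R' · x) o) ?_ p.entry p.exit, fun x => ?_⟩
  · rintro (_ | o)
    exacts [Definable.id, hR' o]
  · have hR : R x = p.Runs (semS · x) := by
      ext t t'
      exact hp x t t'
    rw [hR]
    exact ⟨.graphPath (.idleOr fun o => (hsim o x).1) _ _ _,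
      .graphPath (.idleOr fun o => (hsim o x).2) _ _ _⟩

end Programs

/-! ### Programs on bounded counters -/

instance (α : Type) [Finite α] : Finite (InSym α) :=
  Finite.of_injective (β := Option (Option α))
    (fun | .leftEnd => none | .rightEnd => some none | .sym a => some (some a))
    (by rintro (_ | _ | _) (_ | _ | _) <;> simp)

theorem inputSym_eq_leftEnd {α : Type} {x : List α} {p : ℕ} :
    inputSym x p = .leftEnd ↔ p = 0 := by
  cases p with
  | zero => simp [inputSym]
  | succ i => cases h : x[i]? <;> simp [inputSym, h]

theorem inputSym_eq_rightEnd {α : Type} {x : List α} {p : ℕ} :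
    inputSym x p = .rightEnd ↔ x.length + 1 ≤ p := by
  cases p with
  | zero => simp [inputSym]
  | succ i =>
    by_cases hi : i < x.length
    · simp [inputSym, hi]
    · simp [inputSym, hi, not_lt.1 hi]

/-- Assignment to a variable. Decidability of equality is classical, so that types of variables
need no instance. -/
noncomputable def assign {V : Type} (s : V → ℕ) (v : V) (m : ℕ) : V → ℕ :=
  open Classical in Function.update s v m

section Assign

variable {V : Type} (s : V → ℕ) {u v w : V} (k m : ℕ)

@[simp] theorem assign_self : assign s v m v = m := by simp [assign]

@[simp] theorem assign_of_ne (h : w ≠ v) : assign s v m w = s w := by simp [assign, h]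

@[simp] theorem assign_idem : assign (assign s v k) v m = assign s v m := by simp [assign]

@[simp] theorem assign_eq_self : assign s v (s v) = s := by simp [assign]

theorem assign_comm (h : u ≠ v) :
    assign (assign s u k) v m = assign (assign s v m) u k := by
  classical
  simpa [assign] using Function.update_comm h k m s

variable {s m} in
theorem forall_assign_iff {p : V → ℕ → Prop} :
    (∀ w, p w (assign s v m w)) ↔ p v m ∧ ∀ w ≠ v, p w (s w) := by
  classical
  exact Function.forall_update_iff s p

variable {s m} in
theorem assign_eq_self_of_eq (h : s v = m) : assign s v m = s := h ▸ assign_eq_self s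

end Assign

/-- Operations on variables: increment, decrement, and a test of the input symbol at the position
given by a variable. -/
inductive CounterOp (α V : Type) : Type
  | inc (v : V)
  | dec (v : V)
  | test (v : V) (A : Set (InSym α))

namespace CounterOp

variable {α V : Type}

instance [Finite α] [Finite V] : Finite (CounterOp α V) :=
  Finite.of_injective (β := V ⊕ V ⊕ V × Set (InSym α))
    (fun | .inc v => .inl v | .dec v => .inr (.inl v) | .test v A => .inr (.inr (v, A)))
    (by rintro (_ | _ | _) (_ | _ | _) <;> simp)

/-- The variable `v` takes values below `b n v` on inputs of length `n`. Variables outside `H` may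
only be tested for zero, that is, for standing on the left end-marker. -/
def sem (b : ℕ → V → ℕ) (H : Set V) : CounterOp α V → List α → (V → ℕ) → (V → ℕ) → Prop
  | inc v, x, s, s' => s v + 1 < b x.length v ∧ s' = assign s v (s v + 1)
  | dec v, x, s, s' => s' v + 1 < b x.length v ∧ s = assign s' v (s' v + 1)
  | test v A, x, s, s' => (v ∈ H ∨ A = {.leftEnd}) ∧ inputSym x (s v) ∈ A ∧ s' = s

def inverse : CounterOp α V → CounterOp α V
  | inc v => dec v
  | dec v => inc v
  | test v A => test v A

theorem sem_inverse (b : ℕ → V → ℕ) (H : Set V) (o : CounterOp α V) (x : List α)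
    (s s' : V → ℕ) : sem b H o.inverse x s s' ↔ sem b H o x s' s := by
  cases o with
  | inc v => rfl
  | dec v => rfl
  | test v A =>
    constructor <;>
    · rintro ⟨hmem, hA, rfl⟩
      exact ⟨hmem, hA, rfl⟩

theorem sem_dec_iff {b : ℕ → V → ℕ} {H : Set V} {v : V} {x : List α} {s s' : V → ℕ} :
    sem b H (.dec v) x s s' ↔
      ∃ k, s v = k + 1 ∧ k + 1 < b x.length v ∧ s' = assign s v k := by
  constructor
  · rintro ⟨hlt, rfl⟩
    exact ⟨s' v, by simp, hlt, by simp⟩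
  · rintro ⟨k, hk, hlt, rfl⟩
    exact ⟨by simpa using hlt, by simp [← hk]⟩

end CounterOp

/-- Definability by counter operations. -/
abbrev CounterDefinable {α V : Type} (b : ℕ → V → ℕ) (H : Set V)
    (R : List α → (V → ℕ) → (V → ℕ) → Prop) : Prop :=
  Definable (CounterOp.sem (α := α) b H) R

/-- One round of moving the contents of `v`, multiplied by `c`, to `u`. -/
def DrainStep {V : Type} (bound : V → ℕ) (u v : V) (c : ℕ) (s s' : V → ℕ) : Prop :=
  ∃ k, s v = k + 1 ∧ k + 1 < bound v ∧ s u + c < bound u ∧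
    s' = assign (assign s v k) u (s u + c)

theorem drainStep_path_iff {V : Type} {bound : V → ℕ} {u v : V} (huv : u ≠ v) {c : ℕ}
    {s s' : V → ℕ} :
    ReflTransGen (DrainStep bound u v c) s s' ∧ s' v = 0 ↔
      (s v = 0 ∨ s v < bound v ∧ s u + c * s v < bound u) ∧
        s' = assign (assign s v 0) u (s u + c * s v) := by
  have assign_twice (s : V → ℕ) (k m m' : ℕ) :
      assign (assign (assign (assign s v k) u m) v 0) u m' = assign (assign s v 0) u m' := by
    rw [assign_comm _ _ _ huv, assign_idem, assign_idem]
  constructor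
  · rintro ⟨hpath, hzero⟩
    induction hpath using ReflTransGen.head_induction_on with
    | refl => simp [hzero, assign_eq_self_of_eq]
    | head hstep _ ih =>
      obtain ⟨k, hk, hkv, hku, rfl⟩ := hstep
      obtain ⟨hbound, rfl⟩ := ih
      simp only [assign_self, assign_of_ne _ _ huv.symm] at hbound ⊢
      refine ⟨.inr ?_, ?_⟩
      · rcases hbound with rfl | hbound
        · simpa [hk] using And.intro hkv hku
        · rw [hk, mul_add_one]
          exact ⟨hkv, by lia⟩
      · rw [assign_twice, hk]
        ring_nf
  · rintro ⟨hbound, rfl⟩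
    refine ⟨?_, by simp [huv.symm]⟩
    induction hk : s v generalizing s with
    | zero =>
      rw [assign_eq_self_of_eq hk, mul_zero, add_zero, assign_eq_self]
    | succ k ih =>
      obtain ⟨hv, hu⟩ := hbound.resolve_left (by lia)
      rw [hk, mul_add_one] at hu
      refine .head ⟨k, hk, hk ▸ hv, by lia, rfl⟩ ?_
      convert ih (s := assign (assign s v k) u (s u + c)) ?_ (by simp [huv.symm]) using 1
      · rw [assign_twice, assign_self]
        ring_nf
      · simp only [assign_self, assign_of_ne _ _ huv.symm]
        exact .inr ⟨by lia, by lia⟩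

/-- Push the digit `d` in base `G` onto the variable `v`, where `u` must be empty. -/
def PushDigit {V : Type} (bound : V → ℕ) (u : V) (G : ℕ) (v : V) (d : ℕ) (s s' : V → ℕ) : Prop :=
  s u = 0 ∧ G * s v + d < bound v ∧ s' = assign s v (G * s v + d)

namespace CounterDefinable

variable {α V : Type} {b : ℕ → V → ℕ} {H : Set V}

theorem converse {R : List α → (V → ℕ) → (V → ℕ) → Prop} (h : CounterDefinable b H R) :
    CounterDefinable b H fun x s s' => R x s' s :=
  Definable.converse CounterOp.inverse (CounterOp.sem_inverse b H) h

theorem isZero (v : V) : CounterDefinable (α := α) b H fun _ s s' => s v = 0 ∧ s' = s :=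
  (Definable.prim (.test v {.leftEnd})).congr fun x s s' => by
    simp [CounterOp.sem, inputSym_eq_leftEnd]

theorem add (v : V) (m : ℕ) : CounterDefinable (α := α) b H fun x s s' =>
    (m = 0 ∨ s v + m < b x.length v) ∧ s' = assign s v (s v + m) := by
  induction m with
  | zero => exact Definable.id.congr fun x s s' => by simp
  | succ m ih =>
    refine (ih.comp (.prim (.inc v))).congr fun x s s' => ⟨?_, ?_⟩
    · rintro ⟨hlt, rfl⟩
      have hlt : s v + m + 1 < b x.length v := by lia
      exact ⟨_, ⟨.inr (by lia), rfl⟩, by simpa using hlt, by simp [add_assoc]⟩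
    · rintro ⟨_, ⟨_, rfl⟩, hlt, rfl⟩
      exact ⟨.inr (by simpa [add_assoc] using hlt), by simp [add_assoc]⟩

theorem drainStep {u v : V} (huv : u ≠ v) {c : ℕ} (hc : c ≠ 0) :
    CounterDefinable (α := α) b H fun x => DrainStep (b x.length) u v c := by
  refine ((Definable.prim (.dec v)).comp (add u c)).congr fun x s s' => ?_
  simp only [CounterOp.sem_dec_iff, hc, false_or, DrainStep]
  constructor
  · rintro ⟨k, hk, hv, hu, rfl⟩
    exact ⟨_, ⟨k, hk, hv, rfl⟩, by simpa [huv] using hu, by simp [huv]⟩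
  · rintro ⟨_, ⟨k, hk, hv, rfl⟩, hu, rfl⟩
    exact ⟨k, hk, hv, by simpa [huv] using hu, by simp [huv]⟩

theorem drain {u v : V} (huv : u ≠ v) {c : ℕ} (hc : c ≠ 0) :
    CounterDefinable (α := α) b H fun x s s' =>
      (s v = 0 ∨ s v < b x.length v ∧ s u + c * s v < b x.length u) ∧
        s' = assign (assign s v 0) u (s u + c * s v) :=
  ((drainStep huv hc).star.comp (isZero v)).congr fun x s s' => by
    rw [← drainStep_path_iff huv]
    constructor
    · rintro ⟨hpath, hzero⟩
      exact ⟨s', hpath, hzero, rfl⟩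
    · rintro ⟨_, hpath, hzero, rfl⟩
      exact ⟨hpath, hzero⟩

theorem pushDigit {u v : V} (huv : u ≠ v) {G : ℕ} (hG : G ≠ 0) (d : ℕ)
    (hb : ∀ n, b n u = b n v) (hpos : ∀ n, 0 < b n v) :
    CounterDefinable (α := α) b H fun x => PushDigit (b x.length) u G v d := by
  refine ((isZero u).comp ((drain huv one_ne_zero).comp
    ((drain huv.symm hG).comp (add v d)))).congr fun x s s' => ?_
  have hpos := hpos x.length
  have restore (hu : s u = 0) (m : ℕ) :
      assign (assign (assign s v 0) u 0) v m = assign s v m := by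
    rw [assign_comm _ _ _ huv.symm, assign_eq_self_of_eq hu, assign_idem]
  constructor
  · rintro ⟨hu, hlt, rfl⟩
    have : s v ≤ G * s v := Nat.le_mul_of_pos_left _ (Nat.pos_of_ne_zero hG)
    refine ⟨s, ⟨hu, rfl⟩, _, ⟨?_, rfl⟩, _, ⟨?_, rfl⟩, ?_, ?_⟩
    · exact .inr ⟨by lia, by rw [hb]; lia⟩
    · simp only [assign_self, assign_of_ne _ _ huv.symm, hu]
      exact .inr ⟨by rw [hb]; lia, by lia⟩
    · simp only [assign_self, assign_of_ne _ _ huv.symm, hu]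
      lia
    · simp [huv.symm, hu, restore hu]
  · rintro ⟨_, ⟨hu, rfl⟩, _, ⟨_, rfl⟩, _, ⟨hback, rfl⟩, hadd, rfl⟩
    simp only [assign_self, assign_of_ne _ _ huv.symm, hu, zero_add, one_mul] at hback hadd ⊢
    refine ⟨hu, ?_, by simp [restore hu]⟩
    rcases hadd with rfl | hadd
    · rcases hback with hzero | hback
      · simpa [hzero] using hpos
      · simpa using hback.2
    · exact hadd

end CounterDefinable

/-! ### Counters of polynomial size as tuples of digits -/

/-- The bound on variables that range over the positions of the input tape. -/
abbrev posBound {V : Type} (n : ℕ) (_ : V) : ℕ := n + 2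

section Digits

variable {α V : Type} {B : ℕ} {l : List V} {t t' : V → ℕ}

/-- The number with the digits stored in the listed variables, least significant first. -/
def digitVal (B : ℕ) : List V → (V → ℕ) → ℕ
  | [], _ => 0
  | v :: l, t => t v + B * digitVal B l t

theorem digitVal_congr (h : ∀ v ∈ l, t v = t' v) : digitVal B l t = digitVal B l t' := by
  induction l with
  | nil => rfl
  | cons v l ih => rw [digitVal, digitVal, h v (by simp), ih fun w hw => h w (by simp [hw])]

theorem digitVal_assign_of_notMem {v : V} (hv : v ∉ l) (m : ℕ) :
    digitVal B l (assign t v m) = digitVal B l t :=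
  digitVal_congr fun _ hw => assign_of_ne _ _ (ne_of_mem_of_not_mem hw hv)

theorem digitVal_lt (h : ∀ v ∈ l, t v < B) : digitVal B l t < B ^ l.length := by
  induction l with
  | nil => simp [digitVal]
  | cons v l ih =>
    have hv : t v < B := h v (by simp)
    have hl : digitVal B l t + 1 ≤ B ^ l.length := ih fun w hw => h w (by simp [hw])
    calc t v + B * digitVal B l t < B * (digitVal B l t + 1) := by rw [mul_add_one]; lia
      _ ≤ B * B ^ l.length := Nat.mul_le_mul_left B hl
      _ = B ^ (v :: l).length := by rw [List.length_cons, pow_succ']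

theorem digitVal_eq_zero (hB : B ≠ 0) : digitVal B l t = 0 ↔ ∀ v ∈ l, t v = 0 := by
  induction l with
  | nil => simp [digitVal]
  | cons v l ih => simp [digitVal, ih, hB]

/-- Increment with carry, `B - 1` being the largest digit. There is no step from the largest
number. -/
inductive IncDigits (B : ℕ) : List V → (V → ℕ) → (V → ℕ) → Prop
  | step {v : V} {l : List V} {t : V → ℕ} :
      t v + 1 < B → IncDigits B (v :: l) t (assign t v (t v + 1))
  | carry {v : V} {l : List V} {t t' : V → ℕ} :
      t v + 1 = B → IncDigits B l (assign t v 0) t' → IncDigits B (v :: l) t t'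

namespace IncDigits

theorem eq_of_notMem (h : IncDigits B l t t') {v : V} (hv : v ∉ l) : t' v = t v := by
  induction h with
  | step _ => simp [List.ne_of_not_mem_cons hv]
  | carry _ _ ih =>
    rw [ih (List.not_mem_of_not_mem_cons hv), assign_of_ne _ _ (List.ne_of_not_mem_cons hv)]

theorem digitVal_eq (h : IncDigits B l t t') (hl : l.Nodup) :
    digitVal B l t' = digitVal B l t + 1 := by
  induction h with
  | step _ =>
    simp only [digitVal, assign_self, digitVal_assign_of_notMem (List.nodup_cons.1 hl).1]
    ring
  | @carry v l t t' hv hinc ih =>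
    obtain ⟨hvl, hl⟩ := List.nodup_cons.1 hl
    rw [digitVal, digitVal, ih hl, digitVal_assign_of_notMem hvl, hinc.eq_of_notMem hvl,
      assign_self, mul_add_one]
    lia

theorem forall_lt_iff (h : IncDigits B l t t') : (∀ v, t' v < B) ↔ ∀ v, t v < B := by
  induction h with
  | step hv =>
    rw [forall_assign_iff (p := fun _ m => m < B)]
    grind
  | carry hv _ ih =>
    rw [ih, forall_assign_iff (p := fun _ m => m < B)]
    grind

theorem exists_of_lt (ht : ∀ v, t v < B) (hl : l.Nodup)
    (hlt : digitVal B l t + 1 < B ^ l.length) : ∃ t', IncDigits B l t t' := by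
  induction l generalizing t with
  | nil => simp [digitVal] at hlt
  | cons v l ih =>
    obtain ⟨hvl, hl⟩ := List.nodup_cons.1 hl
    rcases lt_or_eq_of_le (Nat.succ_le_of_lt (ht v)) with hv | hv
    · exact ⟨_, .step hv⟩
    · have hbound : ∀ w, assign t v 0 w < B :=
        (forall_assign_iff (p := fun _ m => m < B)).2 ⟨by lia, fun w _ => ht w⟩
      have htail : digitVal B l (assign t v 0) + 1 < B ^ l.length := by
        rw [digitVal_assign_of_notMem hvl]
        refine Nat.lt_of_mul_lt_mul_left (a := B) ?_
        rw [digitVal, List.length_cons, pow_succ'] at hlt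
        rw [mul_add_one]
        lia
      obtain ⟨t', ht'⟩ := ih hbound hl htail
      exact ⟨t', .carry hv ht'⟩

theorem exists_of_pos (ht : ∀ v, t v < B) (hpos : digitVal B l t ≠ 0) (hl : l.Nodup) :
    ∃ t', IncDigits B l t' t := by
  induction l with
  | nil => simp [digitVal] at hpos
  | cons v l ih =>
    obtain ⟨hvl, hl⟩ := List.nodup_cons.1 hl
    have hv := ht v
    by_cases hzero : t v = 0
    · obtain ⟨t', ht'⟩ := ih (by simp_all [digitVal]) hl
      refine ⟨assign t' v (B - 1), .carry (by rw [assign_self]; lia) ?_⟩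
      rwa [assign_idem, assign_eq_self_of_eq (by rw [← ht'.eq_of_notMem hvl, hzero])]
    · have hstep := step (B := B) (v := v) (l := l) (t := assign t v (t v - 1))
        (by rw [assign_self]; lia)
      rw [assign_self, assign_idem, Nat.sub_add_cancel (Nat.pos_of_ne_zero hzero),
        assign_eq_self] at hstep
      exact ⟨_, hstep⟩

end IncDigits

namespace CounterDefinable

theorem decToZero (v : V) : CounterDefinable (α := α) posBound Set.univ fun x t t' =>
    (t v = 0 ∨ t v < x.length + 2) ∧ t' = assign t v 0 := by
  refine ((Definable.prim (.dec v)).star.comp (isZero v)).congr fun x t t' => ⟨?_, ?_⟩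
  · rintro ⟨hlt, rfl⟩
    refine ⟨_, ?_, by simp, rfl⟩
    induction hk : t v generalizing t with
    | zero => rw [assign_eq_self_of_eq hk]
    | succ k ih =>
      refine .head (b := assign t v k) (CounterOp.sem_dec_iff.2 ⟨k, hk, by grind, rfl⟩) ?_
      simpa using ih (t := assign t v k) (by simp; lia) (by simp)
  · rintro ⟨u, hpath, hzero, rfl⟩
    induction hpath using ReflTransGen.head_induction_on with
    | refl => exact ⟨.inl hzero, (assign_eq_self_of_eq hzero).symm⟩
    | head hdec _ ih =>
      obtain ⟨k, hk, hlt, rfl⟩ := CounterOp.sem_dec_iff.1 hdec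
      exact ⟨.inr (hk ▸ hlt), by simpa using ih.2⟩

theorem wrapToZero (v : V) : CounterDefinable (α := α) posBound Set.univ fun x t t' =>
    t v + 1 = x.length + 2 ∧ t' = assign t v 0 := by
  refine ((Definable.prim (.test v {.rightEnd})).comp (decToZero v)).congr
    fun x t t' => ⟨?_, ?_⟩
  · rintro ⟨hv, rfl⟩
    exact ⟨t, ⟨.inl trivial, inputSym_eq_rightEnd.2 (by lia), rfl⟩, .inr (by lia), rfl⟩
  · rintro ⟨_, ⟨-, hend, rfl⟩, hv, rfl⟩
    have hend := inputSym_eq_rightEnd.1 hend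
    exact ⟨by lia, rfl⟩

theorem incDigits (l : List V) : CounterDefinable (α := α) posBound Set.univ fun x =>
    IncDigits (x.length + 2) l := by
  induction l with
  | nil => exact Definable.empty.congr fun x t t' => ⟨nofun, False.elim⟩
  | cons v l ih =>
    refine ((Definable.prim (.inc v)).union ((wrapToZero v).comp ih)).congr fun x t t' => ⟨?_, ?_⟩
    · rintro (hv | ⟨hv, h⟩)
      exacts [.inl ⟨hv, rfl⟩, .inr ⟨_, ⟨hv, rfl⟩, h⟩]
    · rintro (⟨hv, rfl⟩ | ⟨_, ⟨hv, rfl⟩, h⟩)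
      exacts [.step hv, .carry hv h]

theorem allZero {b : ℕ → V → ℕ} {H : Set V} : ∀ l : List V,
    CounterDefinable (α := α) b H fun _ t t' => (∀ v ∈ l, t v = 0) ∧ t' = t
  | [] => Definable.id.congr (by simp)
  | v :: l => ((isZero v).comp (allZero l)).congr fun _ t t' => by
      simp only [List.forall_mem_cons]
      constructor
      · rintro ⟨⟨hv, hl⟩, rfl⟩
        exact ⟨_, ⟨hv, rfl⟩, hl, rfl⟩
      · rintro ⟨_, ⟨hv, rfl⟩, hl, rfl⟩
        exact ⟨⟨hv, hl⟩, rfl⟩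

end CounterDefinable

end Digits

/-- Languages decided by counter programs whose variables range over the positions of the input
tape. -/
def CounterNL (α : Type) : Set (Language α) :=
  {L | ∃ (V : Type) (_ : Finite V) (R : List α → (V → ℕ) → (V → ℕ) → Prop),
    CounterDefinable posBound Set.univ R ∧ ∀ x, x ∈ L ↔ ∃ t, R x (fun _ => 0) t}

section Poly

variable {α H C : Type} {k : ℕ}

/-- The bounds on two kinds of variables: heads, which are positions of the input tape, and
counters, which are polynomially bounded. -/
def polyBound (H C : Type) (k : ℕ) (n : ℕ) : H ⊕ C → ℕ
  | .inl _ => n + 2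
  | .inr _ => (n + 2) ^ k

/-- The variables holding the digits of a counter. -/
def digitVars (H : Type) {C : Type} (k : ℕ) (c : C) : List (H ⊕ C × Fin k) :=
  (List.finRange k).map fun j => .inr (c, j)

theorem nodup_digitVars (c : C) : (digitVars H k c).Nodup :=
  (List.nodup_finRange k).map fun i j h => by simpa using h

theorem length_digitVars (c : C) : (digitVars H k c).length = k := by simp [digitVars]

theorem mem_digitVars {v : H ⊕ C × Fin k} {c : C} :
    v ∈ digitVars H k c ↔ ∃ j, .inr (c, j) = v := by
  simp [digitVars]

/-- Representation of a store by the digits of its counters in base `|x| + 2`. -/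
structure DigitEnc (k : ℕ) (x : List α) (s : H ⊕ C → ℕ) (t : H ⊕ C × Fin k → ℕ) : Prop where
  lt : ∀ v, t v < x.length + 2
  head_eq : ∀ h, s (.inl h) = t (.inl h)
  counter_eq : ∀ c, s (.inr c) = digitVal (x.length + 2) (digitVars H k c) t

namespace DigitEnc

variable {x : List α} {s : H ⊕ C → ℕ} {t t' : H ⊕ C × Fin k → ℕ}

theorem zero : DigitEnc (H := H) (C := C) k x (fun _ => 0) fun _ => 0 where
  lt := by simp
  head_eq _ := rfl
  counter_eq c := ((digitVal_eq_zero (by lia)).2 fun _ _ => rfl).symm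

theorem assign_head (hst : DigitEnc k x s t) (h : H) {m : ℕ} (hm : m < x.length + 2) :
    DigitEnc k x (assign s (.inl h) m) (assign t (.inl h) m) where
  lt := (forall_assign_iff (p := fun _ n => n < x.length + 2)).2 ⟨hm, fun v _ => hst.lt v⟩
  head_eq h' := by
    by_cases hh : h' = h
    · simp [hh]
    · simp [hh, hst.head_eq]
  counter_eq c := by
    rw [assign_of_ne _ _ (by simp), hst.counter_eq,
      digitVal_assign_of_notMem (by simp [mem_digitVars])]

theorem assign_counter (hst : DigitEnc k x s t) {c : C} (hlt : ∀ v, t' v < x.length + 2)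
    (heq : ∀ v ∉ digitVars H k c, t' v = t v) {m : ℕ}
    (hm : m = digitVal (x.length + 2) (digitVars H k c) t') :
    DigitEnc k x (assign s (.inr c) m) t' where
  lt := hlt
  head_eq h := by rw [assign_of_ne _ _ (by simp), hst.head_eq, heq _ (by simp [mem_digitVars])]
  counter_eq c' := by
    by_cases hc : c' = c
    · rw [hc, assign_self, hm]
    · rw [assign_of_ne _ _ (by simpa using hc), hst.counter_eq]
      refine digitVal_congr fun v hv => (heq v ?_).symm
      obtain ⟨j, rfl⟩ := mem_digitVars.1 hv
      simp [mem_digitVars, Ne.symm hc]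

theorem counter_lt (hst : DigitEnc k x s t) (c : C) : s (.inr c) < (x.length + 2) ^ k := by
  simpa [hst.counter_eq, length_digitVars] using
    digitVal_lt (l := digitVars H k c) fun v _ => hst.lt v

theorem counter_eq_zero_iff (hst : DigitEnc k x s t) (c : C) :
    s (.inr c) = 0 ↔ ∀ v ∈ digitVars H k c, t v = 0 := by
  rw [hst.counter_eq, digitVal_eq_zero (by lia)]

theorem of_incDigits (hst : DigitEnc k x s t) {c : C}
    (h : IncDigits (x.length + 2) (digitVars H k c) t t') :
    DigitEnc k x (assign s (.inr c) (s (.inr c) + 1)) t' :=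
  hst.assign_counter (h.forall_lt_iff.2 hst.lt) (fun _ hv => h.eq_of_notMem hv)
    (by rw [h.digitVal_eq (nodup_digitVars c), hst.counter_eq])

theorem exists_of_incDigits (hst : DigitEnc k x s t) {c : C}
    (h : IncDigits (x.length + 2) (digitVars H k c) t' t) :
    ∃ m, s (.inr c) = m + 1 ∧ DigitEnc k x (assign s (.inr c) m) t' :=
  ⟨_, by rw [hst.counter_eq, h.digitVal_eq (nodup_digitVars c)],
    hst.assign_counter (h.forall_lt_iff.1 hst.lt) (fun _ hv => (h.eq_of_notMem hv).symm) rfl⟩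

section Bisimulation

variable (x)

theorem bisimulates_inc_head (h : H) :
    Bisimulates (DigitEnc k x)
      (CounterOp.sem (polyBound H C k) (Set.range Sum.inl) (.inc (.inl h)) x)
      (CounterOp.sem posBound Set.univ (.inc (.inl h)) x) := by
  constructor
  · rintro s t _ hst ⟨hlt, rfl⟩
    rw [hst.head_eq] at hlt ⊢
    exact ⟨_, ⟨hlt, rfl⟩, hst.assign_head h hlt⟩
  · rintro t s _ hst ⟨hlt, rfl⟩
    rw [← DigitEnc.head_eq hst] at hlt ⊢
    exact ⟨_, ⟨hlt, rfl⟩, DigitEnc.assign_head hst h hlt⟩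

theorem bisimulates_dec_head (h : H) :
    Bisimulates (DigitEnc k x)
      (CounterOp.sem (polyBound H C k) (Set.range Sum.inl) (.dec (.inl h)) x)
      (CounterOp.sem posBound Set.univ (.dec (.inl h)) x) := by
  constructor
  · intro s t _ hst hdec
    obtain ⟨m, hm, hlt, rfl⟩ := CounterOp.sem_dec_iff.1 hdec
    exact ⟨_, CounterOp.sem_dec_iff.2 ⟨m, hst.head_eq h ▸ hm, hlt, rfl⟩,
      hst.assign_head h (Nat.lt_of_succ_lt hlt)⟩
  · intro t s _ hst hdec
    obtain ⟨m, hm, hlt, rfl⟩ := CounterOp.sem_dec_iff.1 hdec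
    exact ⟨_, CounterOp.sem_dec_iff.2 ⟨m, (DigitEnc.head_eq hst h).trans hm, hlt, rfl⟩,
      DigitEnc.assign_head hst h (Nat.lt_of_succ_lt hlt)⟩

theorem bisimulates_test_head (h : H) (A : Set (InSym α)) :
    Bisimulates (DigitEnc k x)
      (CounterOp.sem (polyBound H C k) (Set.range Sum.inl) (.test (.inl h) A) x)
      (CounterOp.sem posBound Set.univ (.test (.inl h) A) x) := by
  constructor
  · rintro s t _ hst ⟨-, hA, rfl⟩
    exact ⟨t, ⟨.inl trivial, hst.head_eq h ▸ hA, rfl⟩, hst⟩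
  · rintro t s _ hst ⟨-, hA, rfl⟩
    exact ⟨s, ⟨.inl ⟨h, rfl⟩, DigitEnc.head_eq hst h ▸ hA, rfl⟩, hst⟩

theorem bisimulates_inc_counter (c : C) :
    Bisimulates (DigitEnc k x)
      (CounterOp.sem (polyBound H C k) (Set.range Sum.inl) (.inc (.inr c)) x)
      (IncDigits (x.length + 2) (digitVars H k c)) := by
  constructor
  · rintro s t _ hst ⟨hlt, rfl⟩
    obtain ⟨t', ht'⟩ := IncDigits.exists_of_lt hst.lt (nodup_digitVars c)
      (by rwa [← hst.counter_eq, length_digitVars])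
    exact ⟨t', ht', hst.of_incDigits ht'⟩
  · intro t s t' hst ht'
    have hst' := DigitEnc.of_incDigits hst ht'
    have hlt := hst'.counter_lt c
    rw [assign_self] at hlt
    exact ⟨_, ⟨hlt, rfl⟩, hst'⟩

theorem bisimulates_dec_counter (c : C) :
    Bisimulates (DigitEnc k x)
      (CounterOp.sem (polyBound H C k) (Set.range Sum.inl) (.dec (.inr c)) x)
      (flip (IncDigits (x.length + 2) (digitVars H k c))) := by
  constructor
  · intro s t _ hst hdec
    obtain ⟨m, hm, -, rfl⟩ := CounterOp.sem_dec_iff.1 hdec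
    obtain ⟨t', ht'⟩ := IncDigits.exists_of_pos hst.lt (by rw [← hst.counter_eq, hm]; simp)
      (nodup_digitVars c)
    obtain ⟨m', hm', hst'⟩ := hst.exists_of_incDigits ht'
    obtain rfl : m = m' := by lia
    exact ⟨t', ht', hst'⟩
  · intro t s t' hst ht'
    obtain ⟨m, hm, hst'⟩ := DigitEnc.exists_of_incDigits hst ht'
    exact ⟨_, CounterOp.sem_dec_iff.2 ⟨m, hm, hm ▸ DigitEnc.counter_lt hst c, rfl⟩, hst'⟩

theorem bisimulates_test_counter (c : C) :
    Bisimulates (DigitEnc k x)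
      (CounterOp.sem (polyBound H C k) (Set.range Sum.inl) (.test (.inr c) {.leftEnd}) x)
      fun t t' => (∀ v ∈ digitVars H k c, t v = 0) ∧ t' = t := by
  constructor
  · rintro s t _ hst ⟨-, hzero, rfl⟩
    exact ⟨t, ⟨(hst.counter_eq_zero_iff c).1 (inputSym_eq_leftEnd.1 hzero), rfl⟩, hst⟩
  · rintro t s _ hst ⟨hzero, rfl⟩
    have hzero := (DigitEnc.counter_eq_zero_iff hst c).2 hzero
    exact ⟨s, ⟨.inr rfl, inputSym_eq_leftEnd.2 hzero, rfl⟩, hst⟩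

theorem exists_bisimulates (o : CounterOp α (H ⊕ C)) :
    ∃ R, CounterDefinable (posBound (V := H ⊕ C × Fin k)) Set.univ R ∧
      ∀ x, Bisimulates (DigitEnc k x)
        (CounterOp.sem (polyBound H C k) (Set.range Sum.inl) o x) (R x) := by
  rcases o with (h | c) | (h | c) | ⟨h | c, A⟩
  · exact ⟨_, .prim _, fun x => bisimulates_inc_head x h⟩
  · exact ⟨_, .incDigits _, fun x => bisimulates_inc_counter x c⟩
  · exact ⟨_, .prim _, fun x => bisimulates_dec_head x h⟩
  · exact ⟨_, (CounterDefinable.incDigits _).converse, fun x => bisimulates_dec_counter x c⟩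
  · exact ⟨_, .prim _, fun x => bisimulates_test_head x h A⟩
  · by_cases hA : A = {.leftEnd}
    · exact hA ▸ ⟨_, .allZero _, fun x => bisimulates_test_counter x c⟩
    · refine ⟨_, .empty, fun x => ⟨?_, fun _ _ _ _ h => h.elim⟩⟩
      rintro s t s' - ⟨hmem, -⟩
      simp [hA] at hmem

end Bisimulation

end DigitEnc

theorem mem_counterNL_of_polyBound [Finite α] [Finite H] [Finite C] {L : Language α}
    {R : List α → (H ⊕ C → ℕ) → (H ⊕ C → ℕ) → Prop}
    (hR : CounterDefinable (polyBound H C k) (Set.range Sum.inl) R)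
    (hL : ∀ x, x ∈ L ↔ ∃ s, R x (fun _ => 0) s) : L ∈ CounterNL α := by
  obtain ⟨R', hR', hsim⟩ := hR.transport (DigitEnc k) DigitEnc.exists_bisimulates
  refine ⟨_, inferInstance, R', hR', fun x => (hL x).trans ⟨?_, ?_⟩⟩
  · rintro ⟨s, hs⟩
    obtain ⟨t, ht, -⟩ := (hsim x).1 .zero hs
    exact ⟨t, ht⟩
  · rintro ⟨t, ht⟩
    obtain ⟨s, hs, -⟩ := (hsim x).2 DigitEnc.zero ht
    exact ⟨s, hs⟩

end Poly

/-! ### Work tapes as pairs of numbers -/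

section TapeCode

variable {A : Type} (G : ℕ) (code : A → ℕ)

/-- The cells to the left of position `h` as a number in base `G`, the nearest cell being the least
significant digit. All digits are positive, so that the number determines `h`. -/
def leftCode (cells : ℕ → A) : ℕ → ℕ
  | 0 => 0
  | h + 1 => G * leftCode cells h + (code (cells h) + 1)

/-- The base `G` digits of `r`, from the least significant one on, are the codes of the cells from
position `h` on. -/
def RightCode (cells : ℕ → A) (h r : ℕ) : Prop := ∀ i, r / G ^ i % G = code (cells (h + i))

/-- Representation of a tape by two numbers, one for the cells to the left of the head and one for
the other cells. -/
structure TapeEnc (T : WorkTape A) (l r : ℕ) : Prop where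
  left_eq : l = leftCode G code T.cells T.head
  right : RightCode G code T.cells T.head r

variable {G code} {cells : ℕ → A} {h l r m : ℕ} {a : A}

theorem leftCode_eq_zero : leftCode G code cells h = 0 ↔ h = 0 := by
  cases h <;> simp [leftCode]

theorem leftCode_congr {cells' : ℕ → A} (heq : ∀ i < h, cells i = cells' i) :
    leftCode G code cells h = leftCode G code cells' h := by
  induction h with
  | zero => rfl
  | succ h ih =>
    rw [leftCode, leftCode, ih fun i hi => heq i (by lia), heq h (by lia)]

theorem RightCode.congr {cells' : ℕ → A} (hr : RightCode G code cells h r)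
    (heq : ∀ i, h ≤ i → cells i = cells' i) : RightCode G code cells' h r := fun i => by
  rw [hr i, heq _ (by lia)]

theorem RightCode.exists_eq (hr : RightCode G code cells h r) :
    ∃ r', r = G * r' + code (cells h) :=
  ⟨r / G, by rw [← add_zero h, ← hr 0, pow_zero, Nat.div_one, Nat.div_add_mod]⟩

theorem TapeEnc.exists_right_eq {T : WorkTape A} (hT : TapeEnc G code T l r) :
    ∃ r', r = G * r' + code T.read :=
  hT.right.exists_eq

theorem leftCode_lt (hG : ∀ a, code a + 1 < G) (cells : ℕ → A) (h : ℕ) :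
    leftCode G code cells h < G ^ h := by
  induction h with
  | zero => simp [leftCode]
  | succ h ih =>
    have := hG (cells h)
    simp only [leftCode, pow_succ]
    nlinarith

theorem rightCode_mul_add_iff (hG : ∀ a, code a + 1 < G) :
    RightCode G code cells h (G * r + code a) ↔
      code a = code (cells h) ∧ RightCode G code cells (h + 1) r := by
  have ha := hG a
  have hdiv (i : ℕ) : (G * r + code a) / G ^ (i + 1) = r / G ^ i := by
    rw [pow_succ', ← Nat.div_div_eq_div_mul, Nat.mul_add_div (by lia : G > 0),
      Nat.div_eq_of_lt (by lia : code a < G), add_zero]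
  have hmod : (G * r + code a) % G = code a := by
    rw [Nat.mul_add_mod, Nat.mod_eq_of_lt (by lia)]
  have hshift (i : ℕ) : h + 1 + i = h + (i + 1) := by lia
  simp only [RightCode]
  rw [← Nat.and_forall_add_one]
  simp only [hdiv, hshift, pow_zero, Nat.div_one, hmod, Nat.add_zero]

theorem RightCode.lt (hG : ∀ a, code a + 1 < G) (hr : RightCode G code cells h r)
    (hblank : ∀ i, m ≤ i → code (cells i) = 0) : r < G ^ m := by
  have hG_one : 1 < G := by have := hG (cells 0); lia
  by_contra! hle
  have hpos : 0 < r := (Nat.pow_pos (by lia)).trans_le hle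
  have hm : m ≤ Nat.log G r := Nat.le_log_of_pow_le hG_one hle
  have hdigit := hr (Nat.log G r)
  rw [hblank _ (by lia), Nat.mod_eq_of_lt (Nat.div_lt_of_lt_mul
    (by rw [← pow_succ]; exact Nat.lt_pow_succ_log_self hG_one r))] at hdigit
  exact (Nat.div_pos (Nat.pow_log_le_self G hpos.ne') (Nat.pow_pos (by lia))).ne' hdigit

theorem TapeEnc.left_lt (hG : ∀ a, code a + 1 < G) {T : WorkTape A} (hT : TapeEnc G code T l r)
    (hm : T.head ≤ m) :
    l < G ^ m := by
  rw [hT.left_eq]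
  exact (leftCode_lt hG _ _).trans_le
    (Nat.pow_le_pow_right ((Nat.zero_le _).trans_lt (hG T.read)) hm)

theorem mul_add_code_inj (hG : ∀ a, code a + 1 < G) {r' : ℕ} {a' : A} :
    G * r + code a = G * r' + code a' ↔ r = r' ∧ code a = code a' := by
  constructor
  · intro heq
    have ha := hG a
    have ha' := hG a'
    have hmod := congrArg (· % G) heq
    have hdiv := congrArg (· / G) heq
    simp only [Nat.mul_add_mod, Nat.mod_eq_of_lt (show code a < G by lia),
      Nat.mod_eq_of_lt (show code a' < G by lia)] at hmod
    simp only [Nat.mul_add_div (show G > 0 by lia), Nat.div_eq_of_lt (show code a < G by lia),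
      Nat.div_eq_of_lt (show code a' < G by lia), add_zero] at hdiv
    exact ⟨hdiv, hmod⟩
  · rintro ⟨rfl, heq⟩
    rw [heq]

theorem TapeEnc.code_read (hG : ∀ a, code a + 1 < G) {T : WorkTape A}
    (hT : TapeEnc G code T l (G * r + code a)) :
    code a = code T.read :=
  ((rightCode_mul_add_iff hG).1 hT.right).1

theorem TapeEnc.write (hG : ∀ a, code a + 1 < G) {T : WorkTape A}
    (hT : TapeEnc G code T l (G * r + code a)) (a' : A) :
    TapeEnc G code (T.act (a', .stay)) l (G * r + code a') where
  left_eq := by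
    rw [hT.left_eq]
    exact leftCode_congr fun i hi => (Function.update_of_ne hi.ne _ _).symm
  right := by
    rw [rightCode_mul_add_iff hG]
    refine ⟨by simp [WorkTape.act, Dir.moveWork], RightCode.congr
      ((rightCode_mul_add_iff hG).1 hT.right).2 fun i hi => ?_⟩
    exact (Function.update_of_ne (Nat.lt_of_succ_le hi).ne' _ _).symm

/-- Moving the head to the right transfers the scanned digit from one number to the other. -/
theorem tapeEnc_succ_iff (hG : ∀ a, code a + 1 < G) :
    TapeEnc G code ⟨cells, h + 1⟩ (G * l + (code a + 1)) r ↔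
      TapeEnc G code ⟨cells, h⟩ l (G * r + code a) := by
  have hleft : G * l + (code a + 1) = leftCode G code cells (h + 1) ↔
      l = leftCode G code cells h ∧ code a = code (cells h) := by
    rw [← mul_add_code_inj hG, leftCode, ← add_assoc, ← add_assoc, Nat.succ_inj]
  constructor
  · rintro ⟨hl, hr⟩
    obtain ⟨hl, ha⟩ := hleft.1 hl
    exact ⟨hl, (rightCode_mul_add_iff hG).2 ⟨ha, hr⟩⟩
  · rintro ⟨hl, hr⟩
    obtain ⟨ha, hr⟩ := (rightCode_mul_add_iff hG).1 hr
    exact ⟨hleft.2 ⟨hl, ha⟩, hr⟩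

end TapeCode

/-! ### Tape operations as counter programs -/

section TapeProgram

variable {α V A : Type} {b : ℕ → V → ℕ} {H : Set V}

theorem PushDigit.pop {bound : V → ℕ} {u v : V} {G d m : ℕ} {s : V → ℕ} (huv : u ≠ v)
    (hu : s u = 0) (hv : s v = G * m + d) (hlt : s v < bound v) :
    PushDigit bound u G v d (assign s v m) s :=
  ⟨by simp [huv, hu], by simpa [← hv] using hlt, by simp [← hv]⟩

/-- The symbol `a` at the beginning of the right part of a tape is replaced by `a'`. -/
def Rewrite (bound : V → ℕ) (u r : V) (G : ℕ) (code : A → ℕ) (a a' : A) (s s₁ : V → ℕ) : Prop :=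
  ∃ t, PushDigit bound u G r (code a) t s ∧ PushDigit bound u G r (code a') t s₁

/-- The first symbol of the right part of a tape is transferred to the left part. -/
def Shift (bound : V → ℕ) (u l r : V) (G : ℕ) (code : A → ℕ) (s s₁ : V → ℕ) : Prop :=
  ∃ a t, PushDigit bound u G r (code a) t s ∧ PushDigit bound u G l (code a + 1) t s₁

/-- The head moves in the direction `d`, where `z` tells whether it stands on cell `0`. -/
def MoveHead (bound : V → ℕ) (u l r : V) (G : ℕ) (code : A → ℕ) (s s₁ : V → ℕ) :
    Dir → Bool → Prop
  | .right, _ => Shift bound u l r G code s s₁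
  | .left, false => Shift bound u l r G code s₁ s
  | _, _ => s₁ = s

/-- One step on a tape given by the variables `l` and `r`: the symbol `a` is read, `z` tells
whether the head is on cell `0`, and the action is `w`. The variable `u` is auxiliary. -/
def TapeStep (bound : V → ℕ) (u l r : V) (G : ℕ) (code : A → ℕ) (a : A) (z : Bool) (w : A × Dir)
    (s s' : V → ℕ) : Prop :=
  (s l < bound l ∧ (s l = 0 ↔ z)) ∧
    ∃ t, Rewrite bound u r G code a w.1 s t ∧ MoveHead bound u l r G code t s' w.2 z

namespace CounterDefinable

theorem pos (v : V) : CounterDefinable (α := α) b H fun x s s' =>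
    (s v < b x.length v ∧ 0 < s v) ∧ s' = s := by
  refine ((Definable.prim (.dec v)).comp (.prim (.inc v))).congr fun x s s' => ?_
  simp only [CounterOp.sem_dec_iff]
  constructor
  · rintro ⟨⟨hlt, hpos⟩, rfl⟩
    obtain ⟨k, hk⟩ := Nat.exists_eq_succ_of_ne_zero hpos.ne'
    rw [Nat.succ_eq_add_one] at hk
    exact ⟨_, ⟨k, hk, by rwa [hk] at hlt, rfl⟩, by simpa [← hk] using hlt, by simp [← hk]⟩
  · rintro ⟨_, ⟨k, hk, hlt, rfl⟩, -, rfl⟩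
    exact ⟨⟨hk ▸ hlt, by lia⟩, by simp [← hk]⟩

theorem eq_zero_iff {v : V} (hb : ∀ n, 0 < b n v) (z : Bool) :
    CounterDefinable (α := α) b H fun x s s' =>
      (s v < b x.length v ∧ (s v = 0 ↔ z)) ∧ s' = s := by
  cases z
  · refine (pos v).congr fun x s s' => ?_
    simp [Nat.pos_iff_ne_zero]
  · refine (isZero v).congr fun x s s' => and_congr_left fun _ => ?_
    have := hb x.length
    simp only [iff_true]
    lia

theorem lt {v : V} (hb : ∀ n, 0 < b n v) : CounterDefinable (α := α) b H fun x s s' =>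
    s v < b x.length v ∧ s' = s :=
  (Definable.iUnion (eq_zero_iff hb)).congr fun x s s' =>
    ⟨fun ⟨hlt, hs⟩ => ⟨decide (s v = 0), ⟨hlt, by simp⟩, hs⟩, fun ⟨_, ⟨hlt, _⟩, hs⟩ => ⟨hlt, hs⟩⟩

section Tape

variable [Finite A] {u l r : V} {G : ℕ} (code : A → ℕ)

theorem shift (hul : u ≠ l) (hur : u ≠ r) (hG : G ≠ 0) (hl : ∀ n, b n u = b n l)
    (hr : ∀ n, b n u = b n r) (hpos : ∀ n, 0 < b n u) :
    CounterDefinable (α := α) b H fun x => Shift (b x.length) u l r G code :=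
  .iUnion fun a => (pushDigit hur hG (code a) hr fun n => hr n ▸ hpos n).converse.comp
    (pushDigit hul hG (code a + 1) hl fun n => hl n ▸ hpos n)

theorem tapeStep (hul : u ≠ l) (hur : u ≠ r) (hG : G ≠ 0) (hl : ∀ n, b n u = b n l)
    (hr : ∀ n, b n u = b n r) (hpos : ∀ n, 0 < b n u) (a : A) (z : Bool) (w : A × Dir) :
    CounterDefinable (α := α) b H fun x => TapeStep (b x.length) u l r G code a z w := by
  have push (d : ℕ) : CounterDefinable (α := α) b H fun x => PushDigit (b x.length) u G r d :=
    pushDigit hur hG d hr fun n => hr n ▸ hpos n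
  have move (d : Dir) : CounterDefinable (α := α) b H fun x s s' =>
      MoveHead (b x.length) u l r G code s s' d z := by
    have hshift := shift (α := α) (H := H) code hul hur hG hl hr hpos
    rcases d with _ | _ | _
    · cases z
      · exact hshift.converse
      · exact .id
    · exact .id
    · exact hshift
  refine ((eq_zero_iff (fun n => hl n ▸ hpos n) z).comp
    (((push (code a)).converse.comp (push (code w.1))).comp (move w.2))).congr fun x s s' => ?_
  constructor
  · rintro ⟨hz, htape⟩
    exact ⟨s, ⟨hz, rfl⟩, htape⟩
  · rintro ⟨_, ⟨hz, rfl⟩, htape⟩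
    exact ⟨hz, htape⟩

end Tape

end CounterDefinable

section TapeSimulation

variable {bound : V → ℕ} {G : ℕ} {code : A → ℕ} {u l r : V} {s s' : V → ℕ} {T : WorkTape A}
  {cells : ℕ → A} {a a' : A} {z : Bool} {w : A × Dir} {h m : ℕ}

theorem Rewrite.eq_of_ne (hs : Rewrite bound u r G code a a' s s') {v : V} (hv : v ≠ r) :
    s' v = s v := by
  obtain ⟨t, ⟨-, -, rfl⟩, -, -, rfl⟩ := hs
  simp [hv]

theorem Shift.eq_of_ne (hs : Shift bound u l r G code s s') {v : V} (hl : v ≠ l) (hr : v ≠ r) :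
    s' v = s v := by
  obtain ⟨a, t, ⟨-, -, rfl⟩, -, -, rfl⟩ := hs
  simp [hl, hr]

theorem TapeStep.eq_of_ne (hs : TapeStep bound u l r G code a z w s s') {v : V} (hl : v ≠ l)
    (hr : v ≠ r) : s' v = s v := by
  obtain ⟨-, t, hwrite, hmove⟩ := hs
  rw [← hwrite.eq_of_ne hr]
  generalize w.2 = d at hmove
  rcases d with _ | _ | _
  · cases z
    · exact (Shift.eq_of_ne hmove hl hr).symm
    · exact congrFun hmove v
  · exact congrFun hmove v
  · exact Shift.eq_of_ne hmove hl hr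

theorem Rewrite.tapeEnc (hG : ∀ a, code a + 1 < G) (hlr : l ≠ r)
    (hs : Rewrite bound u r G code a a' s s') (hT : TapeEnc G code T (s l) (s r)) :
    code a = code T.read ∧ TapeEnc G code (T.act (a', .stay)) (s' l) (s' r) := by
  obtain ⟨t, ⟨-, -, rfl⟩, -, -, rfl⟩ := hs
  rw [assign_of_ne _ _ hlr, assign_self] at hT ⊢
  exact ⟨hT.code_read hG, hT.write hG a'⟩

theorem Shift.tapeEnc_iff (hG : ∀ a, code a + 1 < G) (hlr : l ≠ r)
    (hs : Shift bound u l r G code s s') :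
    TapeEnc G code ⟨cells, h + 1⟩ (s' l) (s' r) ↔ TapeEnc G code ⟨cells, h⟩ (s l) (s r) := by
  obtain ⟨a, t, ⟨-, -, rfl⟩, -, -, rfl⟩ := hs
  simp only [assign_self, assign_of_ne _ _ hlr, assign_of_ne _ _ hlr.symm]
  exact tapeEnc_succ_iff hG

theorem MoveHead.tapeEnc (hG : ∀ a, code a + 1 < G) (hlr : l ≠ r) {d : Dir}
    (hs : MoveHead bound u l r G code s s' d z) (hz : h = 0 ↔ z)
    (hT : TapeEnc G code ⟨cells, h⟩ (s l) (s r)) :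
    TapeEnc G code ⟨cells, d.moveWork h⟩ (s' l) (s' r) := by
  rcases d with _ | _ | _
  · cases z
    · obtain ⟨m, rfl⟩ := Nat.exists_eq_succ_of_ne_zero (n := h) (by simpa using hz)
      exact (Shift.tapeEnc_iff hG hlr hs).1 hT
    · obtain rfl : h = 0 := by simpa using hz
      obtain rfl : s' = s := hs
      exact hT
  · obtain rfl : s' = s := hs
    exact hT
  · exact (Shift.tapeEnc_iff hG hlr hs).2 hT

theorem TapeStep.tapeEnc (hG : ∀ a, code a + 1 < G) (hlr : l ≠ r) (hcode : Function.Injective code)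
    (hs : TapeStep bound u l r G code a z w s s') (hT : TapeEnc G code T (s l) (s r)) :
    (a, z) = (T.read, decide (T.head = 0)) ∧ TapeEnc G code (T.act w) (s' l) (s' r) := by
  obtain ⟨⟨-, hz⟩, t, hwrite, hmove⟩ := hs
  obtain ⟨ha, hT'⟩ := hwrite.tapeEnc hG hlr hT
  rw [hT.left_eq, leftCode_eq_zero] at hz
  exact ⟨Prod.ext (hcode ha) (by simp [hz]), hmove.tapeEnc hG hlr hz hT'⟩

theorem TapeEnc.exists_rewrite (hG : ∀ a, code a + 1 < G) (hur : u ≠ r)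
    (hT : TapeEnc G code T (s l) (s r)) (hu : s u = 0) (hbr : G ^ m ≤ bound r)
    (hblank : ∀ i, m ≤ i → code (T.cells i) = 0) (hm : T.head < m) (a' : A) :
    ∃ s', Rewrite bound u r G code T.read a' s s' := by
  obtain ⟨k, hk⟩ := hT.exists_right_eq
  have hblank' (i : ℕ) (hi : m ≤ i) : code ((T.act (a', .stay)).cells i) = 0 :=
    (congrArg code (Function.update_of_ne (by lia) _ _)).trans (hblank i hi)
  refine ⟨_, assign s r k, .pop hur hu hk ((hT.right.lt hG hblank).trans_le hbr), ?_, ?_, rfl⟩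
  · simp [hur, hu]
  · rw [assign_self]
    exact ((TapeEnc.write hG (hk ▸ hT) a').right.lt hG hblank').trans_le hbr

theorem TapeEnc.exists_shift (hG : ∀ a, code a + 1 < G) (hur : u ≠ r) (hlr : l ≠ r)
    (hT : TapeEnc G code ⟨cells, h⟩ (s l) (s r)) (hu : s u = 0) (hbl : G ^ m ≤ bound l)
    (hbr : G ^ m ≤ bound r) (hblank : ∀ i, m ≤ i → code (cells i) = 0) (hm : h + 1 < m) :
    ∃ s', Shift bound u l r G code s s' := by
  obtain ⟨k, hk⟩ := hT.exists_right_eq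
  refine ⟨_, _, assign s r k, .pop hur hu hk ((hT.right.lt hG hblank).trans_le hbr), ?_, ?_, rfl⟩
  · simp [hur, hu]
  · rw [assign_of_ne _ _ hlr]
    exact (((tapeEnc_succ_iff hG).2 (hk ▸ hT)).left_lt hG hm.le).trans_le hbl

theorem TapeEnc.exists_shift_eq (hG : ∀ a, code a + 1 < G) (hul : u ≠ l) (hlr : l ≠ r)
    (hT : TapeEnc G code ⟨cells, h + 1⟩ (s l) (s r)) (hu : s u = 0) (hbl : G ^ m ≤ bound l)
    (hbr : G ^ m ≤ bound r) (hblank : ∀ i, m ≤ i → code (cells i) = 0) (hm : h + 1 < m) :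
    ∃ s', Shift bound u l r G code s' s := by
  have hk : s l = G * leftCode G code cells h + (code (cells h) + 1) := hT.left_eq
  refine ⟨_, _, assign s l (leftCode G code cells h), ⟨?_, ?_, rfl⟩,
    .pop hul hu hk ((hT.left_lt hG hm.le).trans_le hbl)⟩
  · simp [hul, hu]
  · rw [assign_of_ne _ _ hlr.symm]
    exact (((tapeEnc_succ_iff hG).1 (hk ▸ hT)).right.lt hG hblank).trans_le hbr

theorem TapeEnc.exists_tapeStep (hG : ∀ a, code a + 1 < G) (hul : u ≠ l) (hur : u ≠ r) (hlr : l ≠ r)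
    (hT : TapeEnc G code T (s l) (s r)) (hu : s u = 0) (hbl : G ^ m ≤ bound l)
    (hbr : G ^ m ≤ bound r) (hblank : ∀ i, m ≤ i → code (T.cells i) = 0) (hm : T.head < m)
    (hm' : (T.act w).head < m) :
    ∃ s', TapeStep bound u l r G code T.read (decide (T.head = 0)) w s s' := by
  obtain ⟨t, ht⟩ := hT.exists_rewrite hG hur hu hbr hblank hm w.1
  have hT' := (ht.tapeEnc hG hlr hT).2
  have hu' : t u = 0 := by rw [ht.eq_of_ne hur, hu]
  have hblank' (i : ℕ) (hi : m ≤ i) : code ((T.act (w.1, .stay)).cells i) = 0 :=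
    (congrArg code (Function.update_of_ne (by lia) _ _)).trans (hblank i hi)
  suffices ∃ s', MoveHead bound u l r G code t s' w.2 (decide (T.head = 0)) by
    obtain ⟨s', hs'⟩ := this
    refine ⟨s', ⟨(hT.left_lt hG hm.le).trans_le hbl, ?_⟩, t, ht, hs'⟩
    rw [hT.left_eq, leftCode_eq_zero, decide_eq_true_eq]
  obtain ⟨w, _ | _ | _⟩ := w
  · obtain ⟨cells, _ | h⟩ := T
    · exact ⟨t, rfl⟩
    · exact hT'.exists_shift_eq hG hul hlr hu' hbl hbr hblank' hm
  · exact ⟨t, rfl⟩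
  · exact hT'.exists_shift hG hur hlr hu' hbl hbr hblank' hm'

end TapeSimulation

end TapeProgram

/-! ### Machines with several input heads -/

instance : Finite Dir :=
  Finite.of_injective (β := Fin 3) (fun | .left => 0 | .stay => 1 | .right => 2)
    (by rintro (_ | _ | _) (_ | _ | _) <;> simp)

theorem moveInput_lt {n p : ℕ} (hp : p < n + 2) (d : Dir) : d.moveInput n p < n + 2 := by
  cases d <;> simp only [Dir.moveInput] <;> lia

/-- A nondeterministic machine with several two-way input heads and several work tapes. It can
detect whether a work tape head scans cell `0`. -/
structure MTM (α : Type) where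
  State : Type
  Sym : Type
  Head : Type
  Tape : Type
  [finState : Finite State]
  [finSym : Finite Sym]
  [finHead : Finite Head]
  [finTape : Finite Tape]
  blank : Sym
  start : State
  accept : State
  next : State → (Head → InSym α) × (Tape → Sym × Bool) →
    Set (State × (Head → Dir) × (Tape → Sym × Dir))

namespace MTM

attribute [instance] finState finSym finHead finTape

variable {α : Type} (M : MTM α)

/-- What a machine reads in a configuration. -/
abbrev Scan : Type := (M.Head → InSym α) × (M.Tape → M.Sym × Bool)

/-- What a move does, apart from the change of state. -/
abbrev Action : Type := (M.Head → Dir) × (M.Tape → M.Sym × Dir)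

/-- Configurations. -/
structure Cfg where
  state : M.State
  heads : M.Head → ℕ
  tapes : M.Tape → WorkTape M.Sym

/-- The initial configuration. -/
def startCfg : M.Cfg := ⟨M.start, fun _ => 0, fun _ => WorkTape.empty M.blank⟩

variable {M} in
/-- The symbols under the heads, and the tape heads that are on cell `0`. -/
def Cfg.scan (c : M.Cfg) (x : List α) : M.Scan :=
  (fun h => inputSym x (c.heads h), fun t => ((c.tapes t).read, decide ((c.tapes t).head = 0)))

variable {M} in
/-- The configuration after a move to the state `q`. -/
def Cfg.move (c : M.Cfg) (x : List α) (q : M.State) (a : M.Action) : M.Cfg :=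
  ⟨q, fun h => (a.1 h).moveInput x.length (c.heads h), fun t => (c.tapes t).act (a.2 t)⟩

/-- The step relation on the input `x`. -/
def Step (x : List α) (c c' : M.Cfg) : Prop :=
  ∃ a ∈ M.next c.state (c.scan x), c' = c.move x a.1 a.2

/-- Reachability from the initial configuration. -/
def Reachable (x : List α) (c : M.Cfg) : Prop := ReflTransGen (M.Step x) M.startCfg c

/-- Acceptance by a reachable accepting configuration. -/
def Accepts (x : List α) : Prop := ∃ c, M.Reachable x c ∧ c.state = M.accept

/-- Every computation stays within the space bound on each work tape. -/
def SpaceBounded (s : ℕ → ℕ) : Prop :=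
  ∀ x c, M.Reachable x c → ∀ t, (c.tapes t).Within (s x.length)

end MTM

/-- Languages of machines with several input heads and logarithmic space. -/
def MNL (α : Type) : Set (Language α) :=
  {L | ∃ s, IsLogBound s ∧ ∃ M : MTM α, M.SpaceBounded s ∧ ∀ x, x ∈ L ↔ M.Accepts x}

theorem nl_subset_mnl (α : Type) : NL α ⊆ MNL α := by
  rintro L ⟨s, hs, M, hM, hL⟩
  have := M.finState
  have := M.finSym
  have := M.finTape
  let N : MTM α :=
    { State := M.State, Sym := M.Sym, Head := Unit, Tape := M.Tape, blank := M.blank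
      start := M.start, accept := M.accept
      next := fun q r => {b | (b.1, b.2.1 (), b.2.2) ∈ M.next q (r.1 ()) fun t => (r.2 t).1} }
  let f (c : N.Cfg) : M.Cfg := ⟨c.state, c.heads (), c.tapes⟩
  let g (c : M.Cfg) : N.Cfg := ⟨c.state, fun _ => c.inHead, c.tapes⟩
  have hf {x c} (hc : N.Reachable x c) : M.Reachable x (f c) :=
    ReflTransGen.lift f (fun _ _ ⟨a, ha, h⟩ => ⟨(a.1, a.2.1 (), a.2.2), ha, by rw [h]; rfl⟩) _ _ hc
  have hg {x c} (hc : M.Reachable x c) : N.Reachable x (g c) :=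
    ReflTransGen.lift g (fun _ _ ⟨a, ha, h⟩ => ⟨(a.1, fun _ => a.2.1, a.2.2), ha, by rw [h]; rfl⟩)
      _ _ hc
  refine ⟨s, hs, N, fun x c hc => hM x _ (hf hc), fun x => (hL x).trans ⟨?_, ?_⟩⟩
  · rintro ⟨c, hc, hacc⟩
    exact ⟨g c, hg hc, hacc⟩
  · rintro ⟨c, hc, hacc⟩
    exact ⟨f c, hf hc, hacc⟩

/-! ### Multi-head machines as counter programs -/

section SeqRel

variable {I T : Type} {R : I → T → T → Prop} {pre post : I → T → Prop} {l : List I} {t t' : T}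

theorem seqRel_exists (hl : l.Nodup) (hstep : ∀ i t, pre i t → ∃ t', R i t t')
    (hpre : ∀ {i j t t'}, i ≠ j → R i t t' → pre j t → pre j t') (h : ∀ i ∈ l, pre i t) :
    ∃ t', seqRel R l t t' := by
  induction l generalizing t with
  | nil => exact ⟨t, rfl⟩
  | cons i l ih =>
    rw [List.nodup_cons] at hl
    obtain ⟨u, hu⟩ := hstep i t (h i List.mem_cons_self)
    obtain ⟨t', ht'⟩ := ih hl.2 fun j hj =>
      hpre (ne_of_mem_of_not_mem hj hl.1).symm hu (h j (List.mem_cons_of_mem i hj))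
    exact ⟨t', u, hu, ht'⟩

theorem seqRel_preserves {p : T → Prop} (hp : ∀ i ∈ l, ∀ t t', R i t t' → p t → p t')
    (hseq : seqRel R l t t') (ht : p t) : p t' := by
  induction l generalizing t with
  | nil => exact hseq ▸ ht
  | cons i l ih =>
    rw [List.forall_mem_cons] at hp
    obtain ⟨u, hu, hseq⟩ := hseq
    exact ih hp.2 hseq (hp.1 t u hu ht)

theorem seqRel_post (hl : l.Nodup) (hstep : ∀ {i t t'}, R i t t' → pre i t → post i t')
    (hpre : ∀ {i j t t'}, i ≠ j → R i t t' → pre j t → pre j t')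
    (hpost : ∀ {i j t t'}, i ≠ j → R i t t' → post j t → post j t')
    (hseq : seqRel R l t t') (h : ∀ i ∈ l, pre i t) : ∀ i ∈ l, post i t' := by
  induction l generalizing t with
  | nil => simp
  | cons i l ih =>
    rw [List.nodup_cons] at hl
    rw [List.forall_mem_cons] at h
    obtain ⟨u, hu, hseq⟩ := hseq
    rw [List.forall_mem_cons]
    exact ⟨seqRel_preserves (fun j hj _ _ => hpost (ne_of_mem_of_not_mem hj hl.1)) hseq
      (hstep hu h.1), ih hl.2 hseq fun j hj =>
        hpre (ne_of_mem_of_not_mem hj hl.1).symm hu (h.2 j hj)⟩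

end SeqRel

section Heads

variable {α V : Type} {b : ℕ → V → ℕ} {H : Set V} {v : V}

/-- The symbol `a` is read at the position `v`, which then moves in the direction `d`. -/
def HeadStep (v : V) (a : InSym α) (d : Dir) (x : List α) (s s' : V → ℕ) : Prop :=
  (s v < x.length + 2 ∧ inputSym x (s v) = a) ∧
    s' = assign s v (d.moveInput x.length (s v))

theorem CounterDefinable.moveInput (hv : v ∈ H) (hb : ∀ n, b n v = n + 2) (d : Dir) :
    CounterDefinable (α := α) b H fun x s s' =>
      s v < x.length + 2 ∧ s' = assign s v (d.moveInput x.length (s v)) := by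
  rcases d with _ | _ | _
  · refine ((isZero v).union (.prim (.dec v))).congr fun x s s' => ?_
    simp only [CounterOp.sem_dec_iff, hb, Dir.moveInput]
    constructor
    · rintro ⟨hlt, rfl⟩
      rcases hs : s v with _ | k
      · exact .inl ⟨rfl, assign_eq_self_of_eq (by lia)⟩
      · exact .inr ⟨k, rfl, hs ▸ hlt, rfl⟩
    · rintro (⟨hs, rfl⟩ | ⟨k, hs, hlt, rfl⟩)
      · exact ⟨by lia, (assign_eq_self_of_eq (by lia)).symm⟩
      · exact ⟨by lia, by rw [hs]; rfl⟩
  · refine (CounterDefinable.lt (v := v) fun n => by rw [hb]; lia).congr fun x s s' => ?_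
    simp [hb, Dir.moveInput]
  · have hlast : CounterDefinable (α := α) b H fun x s s' => s v = x.length + 1 ∧ s' = s := by
      refine (Definable.comp (CounterDefinable.lt (v := v) fun n => by rw [hb]; lia)
        (.prim (.test v {.rightEnd}))).congr fun x s s' => ?_
      simp only [hb, CounterOp.sem, hv, true_or, true_and, Set.mem_singleton_iff,
        inputSym_eq_rightEnd]
      constructor
      · rintro ⟨hs, rfl⟩
        exact ⟨s', ⟨by lia, rfl⟩, by lia, rfl⟩
      · rintro ⟨_, ⟨hlt, rfl⟩, hle, rfl⟩
        exact ⟨by lia, rfl⟩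
    refine (hlast.union (.prim (.inc v))).congr fun x s s' => ?_
    simp only [CounterOp.sem, hb, Dir.moveInput]
    constructor
    · rintro ⟨hlt, rfl⟩
      by_cases hs : s v = x.length + 1
      · exact .inl ⟨hs, assign_eq_self_of_eq (by lia)⟩
      · exact .inr ⟨by lia, by rw [min_eq_left (by lia)]⟩
    · rintro (⟨hs, rfl⟩ | ⟨hlt, rfl⟩)
      · exact ⟨by lia, (assign_eq_self_of_eq (by lia)).symm⟩
      · exact ⟨by lia, by rw [min_eq_left (by lia)]⟩

theorem CounterDefinable.headStep (hv : v ∈ H) (hb : ∀ n, b n v = n + 2) (a : InSym α)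
    (d : Dir) : CounterDefinable b H (HeadStep v a d) := by
  refine (Definable.comp (.prim (.test v {a})) (moveInput hv hb d)).congr fun x s s' => ?_
  constructor
  · rintro ⟨⟨hlt, ha⟩, hs'⟩
    exact ⟨s, ⟨.inl hv, ha, rfl⟩, hlt, hs'⟩
  · rintro ⟨_, ⟨-, ha, rfl⟩, hlt, hs'⟩
    exact ⟨⟨hlt, ha⟩, hs'⟩

end Heads

theorem IsLogBound.exists_le {s : ℕ → ℕ} (hs : IsLogBound s) :
    ∃ K, ∀ n, s n ≤ K * Nat.log 2 (n + 2) := by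
  have hlog (n : ℕ) : Real.log n ≤ 2 * Nat.log 2 (n + 2) := by
    have hone : 1 ≤ Nat.log 2 (n + 2) := Nat.log_pos one_lt_two (by lia)
    rcases n.eq_zero_or_pos with rfl | hn
    · simp
    calc Real.log n ≤ Real.log (2 ^ (Nat.log 2 (n + 2) + 1) : ℕ) :=
          Real.log_le_log (by exact_mod_cast hn)
            (by exact_mod_cast
              (Nat.le_add_right n 2).trans (Nat.lt_pow_succ_log_self one_lt_two _).le)
      _ = (Nat.log 2 (n + 2) + 1) * Real.log 2 := by push_cast; rw [Real.log_pow]; push_cast; rfl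
      _ ≤ (Nat.log 2 (n + 2) + 1) * 1 := by gcongr; linarith [Real.log_two_lt_d9]
      _ ≤ 2 * Nat.log 2 (n + 2) := by
        have : (1 : ℝ) ≤ Nat.log 2 (n + 2) := by exact_mod_cast hone
        linarith
  have hO : (fun n => (s n : ℝ)) =O[Filter.atTop] fun n : ℕ => (Nat.log 2 (n + 2) : ℝ) :=
    Asymptotics.IsBigO.trans hs (.of_bound 2 (.of_forall fun n => by
      simpa [abs_of_nonneg (Real.log_natCast_nonneg n)] using hlog n))
  obtain ⟨C, -, hC⟩ := Asymptotics.bound_of_isBigO_nat_atTop hO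
  obtain ⟨K, hK⟩ := exists_nat_ge C
  refine ⟨K, fun n => ?_⟩
  have hpos : Nat.log 2 (n + 2) ≠ 0 := (Nat.log_pos one_lt_two (by lia)).ne'
  have hle := hC (x := n) (by exact_mod_cast hpos)
  simp only [RCLike.norm_natCast] at hle
  exact_mod_cast hle.trans (mul_le_mul_of_nonneg_right hK (Nat.cast_nonneg _))

theorem IsLogBound.exists_pow_le {s : ℕ → ℕ} (hs : IsLogBound s) (G : ℕ) :
    ∃ k, ∀ n, G ^ max 1 (s n) ≤ (n + 2) ^ k := by
  obtain ⟨K, hK⟩ := hs.exists_le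
  refine ⟨(K + 1) * G, fun n => ?_⟩
  have hone : 1 ≤ Nat.log 2 (n + 2) := Nat.log_pos one_lt_two (by lia)
  calc G ^ max 1 (s n) ≤ (2 ^ G) ^ max 1 (s n) := Nat.pow_le_pow_left Nat.lt_two_pow_self.le _
    _ ≤ (2 ^ G) ^ (Nat.log 2 (n + 2) * (K + 1)) := by
      refine Nat.pow_le_pow_right (Nat.two_pow_pos G) ?_
      have := hK n
      grind
    _ = (2 ^ Nat.log 2 (n + 2)) ^ ((K + 1) * G) := by rw [← pow_mul, ← pow_mul]; ring_nf
    _ ≤ (n + 2) ^ ((K + 1) * G) := Nat.pow_le_pow_left (Nat.pow_log_le_self 2 (by lia)) _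

theorem exists_code {A : Type} [Finite A] (a₀ : A) : ∃ (G : ℕ) (code : A → ℕ),
    (∀ a, code a + 1 < G) ∧ Function.Injective code ∧ code a₀ = 0 := by
  obtain ⟨n, ⟨e⟩⟩ := Finite.exists_equiv_fin A
  have : NeZero n := ⟨by rintro rfl; exact (e a₀).elim0⟩
  let e' := e.trans (Equiv.swap (e a₀) 0)
  exact ⟨n + 1, fun a => e' a, fun a => Nat.succ_lt_succ (e' a).2,
    Fin.val_injective.comp e'.injective, by simp [e']⟩

namespace MTM

variable {α : Type} (M : MTM α)

theorem blank_of_reachable {s : ℕ → ℕ} (hM : M.SpaceBounded s) {x : List α} {c : M.Cfg}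
    (hc : M.Reachable x c) (t : M.Tape) (i : ℕ) (hi : max 1 (s x.length) ≤ i) :
    (c.tapes t).cells i = M.blank := by
  induction hc with
  | refl => rfl
  | tail hreach hstep ih =>
    obtain ⟨a, -, rfl⟩ := hstep
    exact (Function.update_of_ne ((hM x _ hreach t).trans_le hi).ne' _ _).trans ih

/-- The counters storing the left and right parts of the work tapes, and an auxiliary one. -/
abbrev Counter : Type := Option (M.Tape × Bool)

/-- The effect on one head or tape of a move that reads `r` and performs `a`. -/
def UnitStep (k G : ℕ) (code : M.Sym → ℕ) (r : M.Scan) (a : M.Action) :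
    M.Head ⊕ M.Tape → List α → (M.Head ⊕ M.Counter → ℕ) → (M.Head ⊕ M.Counter → ℕ) → Prop
  | .inl h, x => HeadStep (.inl h) (r.1 h) (a.1 h) x
  | .inr t, x => TapeStep (polyBound M.Head M.Counter k x.length) (.inr none)
      (.inr (some (t, false))) (.inr (some (t, true))) G code (r.2 t).1 (r.2 t).2 (a.2 t)

/-- The effect of a move that reads `r` and performs `a`, one head or tape after the other. -/
def StoreStep (k G : ℕ) (code : M.Sym → ℕ) (l : List (M.Head ⊕ M.Tape)) (e : M.Scan × M.Action)
    (x : List α) : (M.Head ⊕ M.Counter → ℕ) → (M.Head ⊕ M.Counter → ℕ) → Prop :=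
  seqRel (M.UnitStep k G code e.1 e.2 · x) l

/-- The edges of the counter program for `M`. -/
def ProgramEdge (q : M.State) (e : M.Scan × M.Action) (q' : M.State) : Prop :=
  (q', e.2) ∈ M.next q e.1

theorem counterDefinable_storeStep {k G : ℕ} (hG : G ≠ 0) (code : M.Sym → ℕ)
    (l : List (M.Head ⊕ M.Tape)) (e : M.Scan × M.Action) :
    CounterDefinable (polyBound M.Head M.Counter k) (Set.range Sum.inl)
      (M.StoreStep k G code l e) := by
  refine Definable.seq (R := M.UnitStep k G code e.1 e.2) ?_ l
  rintro (h | t)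
  · exact CounterDefinable.headStep (Set.mem_range_self h) (fun _ => rfl) _ _
  · exact CounterDefinable.tapeStep (V := M.Head ⊕ M.Counter) (u := .inr none)
      (l := .inr (some (t, false))) (r := .inr (some (t, true))) code (by simp) (by simp) hG
      (fun _ => rfl) (fun _ => rfl) (fun n => by simp [polyBound]) _ _ _

variable {M}

/-- The part of the configuration `c` that concerns one head or tape is represented by the
store `s`. -/
def UnitEnc (G : ℕ) (code : M.Sym → ℕ) (x : List α) (c : M.Cfg) :
    M.Head ⊕ M.Tape → (M.Head ⊕ M.Counter → ℕ) → Prop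
  | .inl h, s => s (.inl h) = c.heads h ∧ c.heads h < x.length + 2
  | .inr t, s => s (.inr none) = 0 ∧
      TapeEnc G code (c.tapes t) (s (.inr (some (t, false)))) (s (.inr (some (t, true))))

/-- The scans `r` and `r'` agree on one head or tape. -/
def Scan.AgreeAt (r r' : M.Scan) : M.Head ⊕ M.Tape → Prop
  | .inl h => r.1 h = r'.1 h
  | .inr t => r.2 t = r'.2 t

variable {k G : ℕ} {code : M.Sym → ℕ} {x : List α} {c : M.Cfg} {r : M.Scan} {a : M.Action}
  {e : M.Scan × M.Action} {i j : M.Head ⊕ M.Tape} {l : List (M.Head ⊕ M.Tape)}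
  {s s' : M.Head ⊕ M.Counter → ℕ}

theorem UnitEnc.of_unitStep_ne (hij : i ≠ j) (hs : M.UnitStep k G code r a i x s s')
    (hc : UnitEnc G code x c j s) : UnitEnc G code x c j s' := by
  have heq : ∀ v : M.Head ⊕ M.Counter, (∀ h, i = .inl h → v ≠ .inl h) →
      (∀ t b, i = .inr t → v ≠ .inr (some (t, b))) → s' v = s v := by
    intro v hhead htape
    rcases i with h | t
    · obtain ⟨-, rfl⟩ := hs
      exact assign_of_ne _ _ (hhead h rfl)
    · exact TapeStep.eq_of_ne hs (htape t _ rfl) (htape t _ rfl)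
  rcases j with h | t
  · exact ⟨(heq _ (by rintro h rfl; simpa [eq_comm] using hij) (by simp)).trans hc.1, hc.2⟩
  · have htape (b : Bool) : s' (.inr (some (t, b))) = s (.inr (some (t, b))) := by
      refine heq _ (by simp) ?_
      rintro t b rfl
      simp_all [eq_comm]
    refine ⟨(heq _ (by simp) (by simp)).trans hc.1, ?_⟩
    rw [htape, htape]
    exact hc.2

theorem UnitEnc.of_unitStep (hG : ∀ a, code a + 1 < G) (hcode : Function.Injective code)
    (q : M.State) (hs : M.UnitStep k G code r a i x s s') (hc : UnitEnc G code x c i s) :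
    r.AgreeAt (c.scan x) i ∧ UnitEnc G code x (c.move x q a) i s' := by
  rcases i with h | t
  · obtain ⟨⟨-, hread⟩, rfl⟩ := hs
    obtain ⟨hs, hlt⟩ := hc
    rw [hs] at hread ⊢
    exact ⟨hread.symm, assign_self _ _, moveInput_lt hlt _⟩
  · obtain ⟨hread, htape⟩ := TapeStep.tapeEnc hG (by simp) hcode hs hc.2
    exact ⟨hread, (TapeStep.eq_of_ne hs (by simp) (by simp)).trans hc.1, htape⟩

theorem UnitEnc.exists_unitStep (hG : ∀ a, code a + 1 < G) {m : ℕ}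
    (hm : G ^ m ≤ (x.length + 2) ^ k) (hblank : ∀ t i, m ≤ i → code ((c.tapes t).cells i) = 0)
    (hlt : ∀ t, (c.tapes t).head < m) (hlt' : ∀ t, ((c.tapes t).act (a.2 t)).head < m)
    (hc : UnitEnc G code x c i s) : ∃ s', M.UnitStep k G code (c.scan x) a i x s s' := by
  rcases i with h | t
  · obtain ⟨hs, hlt⟩ := hc
    exact ⟨_, ⟨hs ▸ hlt, congrArg _ hs⟩, rfl⟩
  · exact hc.2.exists_tapeStep hG (by simp) (by simp) (by simp) hc.1 hm hm (hblank t) (hlt t)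
      (hlt' t)

theorem unitEnc_startCfg (hblank : code M.blank = 0) :
    ∀ i, UnitEnc G code x M.startCfg i fun _ => 0
  | .inl _ => ⟨rfl, Nat.succ_pos _⟩
  | .inr _ => ⟨rfl, rfl, fun i => by simp [startCfg, WorkTape.empty, hblank]⟩

theorem UnitEnc.of_storeStep (hG : ∀ a, code a + 1 < G) (hcode : Function.Injective code)
    (hl : l.Nodup) (hmem : ∀ i, i ∈ l) (q : M.State) (hs : M.StoreStep k G code l e x s s')
    (hc : ∀ i, UnitEnc G code x c i s) :
    e.1 = c.scan x ∧ ∀ i, UnitEnc G code x (c.move x q e.2) i s' := by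
  have hpost (i) := seqRel_post (pre := UnitEnc G code x c)
    (post := fun i s' => e.1.AgreeAt (c.scan x) i ∧ UnitEnc G code x (c.move x q e.2) i s')
    hl (UnitEnc.of_unitStep hG hcode q) UnitEnc.of_unitStep_ne
    (fun hij hstep => .imp_right (UnitEnc.of_unitStep_ne hij hstep)) hs (fun i _ => hc i)
    i (hmem i)
  exact ⟨Prod.ext (funext fun h => (hpost (.inl h)).1) (funext fun t => (hpost (.inr t)).1),
    fun i => (hpost i).2⟩

theorem exists_path_of_reachable {sp : ℕ → ℕ} (hM : M.SpaceBounded sp)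
    (hG : ∀ a, code a + 1 < G)
    (hcode : Function.Injective code) (hblank : code M.blank = 0) (hl : l.Nodup)
    (hmem : ∀ i, i ∈ l) (hk : G ^ max 1 (sp x.length) ≤ (x.length + 2) ^ k)
    (hc : M.Reachable x c) :
    ∃ s, ReflTransGen (GraphStep M.ProgramEdge (M.StoreStep k G code l · x))
        (M.start, fun _ => 0) (c.state, s) ∧ ∀ i, UnitEnc G code x c i s := by
  induction hc with
  | refl => exact ⟨_, .refl, unitEnc_startCfg hblank⟩
  | tail hreach hstep ih =>
    have hreach' := hreach.tail hstep
    obtain ⟨a, ha, rfl⟩ := hstep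
    obtain ⟨s, hpath, henc⟩ := ih
    obtain ⟨s', hs'⟩ := seqRel_exists (pre := UnitEnc G code x _) hl
      (fun i s => UnitEnc.exists_unitStep hG hk (fun t i hi => by
        rw [M.blank_of_reachable hM hreach t i hi, hblank]) (hM x _ hreach) (hM x _ hreach'))
      UnitEnc.of_unitStep_ne fun i _ => henc i
    exact ⟨s', hpath.tail ⟨(_, a.2), ha, hs'⟩, (UnitEnc.of_storeStep (e := (_, a.2)) hG hcode hl
      hmem a.1 hs' henc).2⟩

theorem exists_reachable_of_path (hG : ∀ a, code a + 1 < G)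
    (hcode : Function.Injective code) (hblank : code M.blank = 0) (hl : l.Nodup)
    (hmem : ∀ i, i ∈ l) {q : M.State}
    (hpath : ReflTransGen (GraphStep M.ProgramEdge (M.StoreStep k G code l · x))
      (M.start, fun _ => 0) (q, s)) :
    ∃ c, M.Reachable x c ∧ c.state = q ∧ ∀ i, UnitEnc G code x c i s := by
  refine graphPath_induction hpath
    (motive := fun q s => ∃ c, M.Reachable x c ∧ c.state = q ∧ ∀ i, UnitEnc G code x c i s)
    ⟨M.startCfg, .refl, rfl, unitEnc_startCfg hblank⟩ ?_
  rintro _ s e q' s' hedge hs ⟨c, hreach, rfl, henc⟩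
  obtain ⟨hscan, henc'⟩ := UnitEnc.of_storeStep hG hcode hl hmem q' hs henc
  rw [ProgramEdge, hscan] at hedge
  exact ⟨_, hreach.tail ⟨_, hedge, rfl⟩, rfl, henc'⟩

end MTM

theorem mnl_subset_counterNL (α : Type) [Finite α] : MNL α ⊆ CounterNL α := by
  rintro L ⟨sp, hsp, M, hM, hL⟩
  obtain ⟨G, code, hG, hcode, hblank⟩ := exists_code M.blank
  obtain ⟨k, hk⟩ := hsp.exists_pow_le G
  obtain ⟨l, hl, hmem⟩ : ∃ l : List (M.Head ⊕ M.Tape), l.Nodup ∧ ∀ i, i ∈ l := by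
    have := Fintype.ofFinite (M.Head ⊕ M.Tape)
    exact ⟨Finset.univ.toList, Finset.nodup_toList _, by simp⟩
  refine mem_counterNL_of_polyBound (k := k) (Definable.graph M.ProgramEdge
    (M.counterDefinable_storeStep (Nat.ne_zero_of_lt (hG M.blank)) code l) M.start M.accept)
    fun x => (hL x).trans ⟨?_, ?_⟩
  · rintro ⟨c, hc, hacc⟩
    obtain ⟨s, hpath, -⟩ := MTM.exists_path_of_reachable hM hG hcode hblank hl hmem (hk _) hc
    exact ⟨s, hacc ▸ hpath⟩
  · rintro ⟨s, hpath⟩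
    obtain ⟨c, hreach, hstate, -⟩ := MTM.exists_reachable_of_path hG hcode hblank hl hmem hpath
    exact ⟨c, hreach, hstate⟩

/-! ### Blind machines for counter programs -/

namespace PATM

variable {α : Type} {M : PATM α} {x : List α} {σ σ' : M.Strategy} {h : List M.Event} {c : M.Cfg}

theorem observe_of_eq {c' : M.Cfg} (hv : c'.view = c.view) : observe h c c' = h := if_pos hv

theorem observe_of_ne {c' : M.Cfg} (hv : c'.view ≠ c.view) :
    observe h c c' = h ++ [.inr c'.view] := if_neg hv

theorem length_le_observe (c' : M.Cfg) : h.length ≤ (observe h c c').length := by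
  by_cases hv : c'.view = c.view
  · rw [observe_of_eq hv]
  · simp [observe_of_ne hv]

theorem Wins.existential_inv (hk : c.kind = .existential) (hw : Wins x σ h c) :
    Wins x σ (h ++ [.inl (σ h)]) (c.stepE x (σ h)) := by
  cases hw <;> first | assumption | simp_all

theorem Wins.universal_inv (hk : c.kind = .universal) (hw : Wins x σ h c) (u : M.UChoice) :
    Wins x σ (observe h c (c.stepU x u)) (c.stepU x u) := by
  cases hw with
  | universal _ hw => exact hw u
  | _ => simp_all

theorem Wins.deterministic_inv (hk : c.kind = .deterministic) (hw : Wins x σ h c) :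
    Wins x σ (observe h c (c.stepD x)) (c.stepD x) := by
  cases hw <;> first | assumption | simp_all

theorem Wins.kind_ne_reject (hw : Wins x σ h c) : c.kind ≠ .reject := by
  cases hw <;> simp_all

theorem Wins.congr {n : ℕ} (hσ : ∀ h' : List M.Event, n ≤ h'.length → σ h' = σ' h')
    (hw : Wins x σ h c) (hn : n ≤ h.length) : Wins x σ' h c := by
  induction hw with
  | accept hk => exact .accept hk
  | existential hk _ ih =>
    refine .existential hk ?_
    rw [← hσ _ hn]
    exact ih (by simp; lia)
  | universal hk _ ih => exact .universal hk fun u => ih u (hn.trans (length_le_observe _))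
  | deterministic hk _ ih => exact .deterministic hk (ih (hn.trans (length_le_observe _)))

end PATM

theorem eq_assign_iff {V : Type} {s s' : V → ℕ} {w : V} {m : ℕ} :
    s' = assign s w m ↔ s' w = m ∧ ∀ v ≠ w, s' v = s v := by
  classical
  exact Function.eq_update_iff

namespace Blind

section Track

variable {α V : Type} {x : List α} {s s' : V → ℕ}

/-- The effect of an operation in the branch that follows the variable `v`, at a position with
input symbol `a`: the movement of the head, or `none` if the operation is not admissible. The
branch `none` follows no variable. -/
noncomputable def track (a : InSym α) : Option (CounterOp α V) → Option V → Option Dir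
  | some (.inc w), some v =>
    open Classical in if v = w then if a = .rightEnd then none else some .right else some .stay
  | some (.dec w), some v =>
    open Classical in if v = w then if a = .leftEnd then none else some .left else some .stay
  | some (.test w A), some v => open Classical in if v = w ∧ a ∉ A then none else some .stay
  | _, _ => some .stay

/-- The head position of the branch that follows `v`. -/
def position (s : V → ℕ) : Option V → ℕ
  | none => 0
  | some v => s v

/-- The semantics of operations on positions of the input tape. -/
abbrev PosStep (x : List α) (o : Option (CounterOp α V)) (s s' : V → ℕ) : Prop :=
  idleOr (CounterOp.sem posBound Set.univ · x) o s s'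

theorem track_none (a : InSym α) (o : Option (CounterOp α V)) : track a o none = some .stay := by
  rcases o with _ | _ | _ | _ <;> rfl

theorem posStep_iff_forall_track (hs : ∀ v, s v < x.length + 2) (o : Option (CounterOp α V)) :
    PosStep x o s s' ↔ ∀ v, ∃ d ∈ track (inputSym x (position s v)) o v,
      position s' v = d.moveInput x.length (position s v) := by
  rw [Option.forall]
  simp only [track_none, position, Option.mem_some_iff, exists_eq_left', Dir.moveInput, true_and]
  rcases o with _ | w | w | ⟨w, A⟩
  · simp [idleOr, track, funext_iff]
  · rw [← and_forall_ne w]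
    simp only [idleOr, CounterOp.sem, posBound, eq_assign_iff, ← and_assoc]
    refine and_congr ?_ (forall₂_congr fun v hv => by simp [track, hv])
    simp only [track, if_true, inputSym_eq_rightEnd]
    split_ifs with hlast
    · simp; lia
    · simp; lia
  · rw [← and_forall_ne w]
    simp only [idleOr, CounterOp.sem, posBound, eq_assign_iff, ← and_assoc]
    refine and_congr ?_ (forall₂_congr fun v hv => by simp [track, hv, eq_comm])
    have := hs w
    simp only [track, if_true, inputSym_eq_leftEnd]
    split_ifs with hzero
    · simp; lia
    · simp; lia
  · rw [← and_forall_ne w]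
    have heq : s' = s ↔ s' w = s w ∧ ∀ v ≠ w, s' v = s v :=
      funext_iff.trans (and_forall_ne (p := fun v => s' v = s v) w).symm
    simp only [idleOr, CounterOp.sem, heq, ← and_assoc]
    refine and_congr ?_ (forall₂_congr fun v hv => by simp [track, hv])
    by_cases hA : inputSym x (s w) ∈ A <;> simp [track, hA]

theorem PosStep.lt {o : Option (CounterOp α V)} (h : PosStep x o s s')
    (hs : ∀ v, s v < x.length + 2) (v : V) : s' v < x.length + 2 := by
  obtain ⟨d, -, hd⟩ := (posStep_iff_forall_track hs o).1 h (some v)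
  exact hd.trans_lt (moveInput_lt (hs v) d)

end Track

/-- The private control of the blind machine: the universal player has yet to choose a variable,
or follows a variable and stores the parity of the number of operations carried out, or has
objected to an operation. -/
inductive Control (V : Type) : Type
  | choosing
  | following (v : Option V) (parity : Bool)
  | objecting

instance {V : Type} [Finite V] : Finite (Control V) :=
  Finite.of_injective (β := Option (Option (Option V × Bool)))
    (fun | .choosing => none | .objecting => some none | .following v b => some (some (v, b)))
    (by rintro (_ | _ | _) (_ | _ | _) <;> simp)

variable {α V : Type} (p : Program (CounterOp α V))

open Classical in
/-- The node and the operation that are published in the node `q` when the existential player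
chooses `e`: choices that are not edges from `q` have no effect. -/
noncomputable def publish (q : p.Node) (e : p.Node × Option (CounterOp α V) × p.Node) :
    p.Node × Option (CounterOp α V) :=
  if e.1 = q ∧ p.edge q e.2.1 e.2.2 then (e.2.2, e.2.1) else (q, none)

theorem publish_cases (q : p.Node) (e : p.Node × Option (CounterOp α V) × p.Node) :
    p.edge q (publish p q e).2 (publish p q e).1 ∨ publish p q e = (q, none) := by
  unfold publish
  split_ifs with he
  · exact .inl he.2
  · exact .inr rfl

theorem publish_of_edge {q q' : p.Node} {o : Option (CounterOp α V)} (h : p.edge q o q') :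
    publish p q (q, o, q') = (q', o) := if_pos ⟨rfl, h⟩

/-- The existential player publishes a path in the program. The universal player privately selects
a variable, whose value is then followed by the private input head. Since this player's moves do
not change the public part, a published operation is pending as long as the public parity differs
from the private one. -/
noncomputable def machine [Finite α] [Finite V] : PATM α where
  Pub := p.Node × Option (CounterOp α V) × Bool
  Priv := Control V
  Sym := Unit
  PubTape := Empty
  PrivTape := Empty
  EChoice := p.Node × Option (CounterOp α V) × p.Node
  UChoice := Option V
  neEChoice := ⟨(p.entry, none, p.entry)⟩
  headPrivate := true
  blank := ()
  startPub := (p.entry, none, false)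
  startPriv := .choosing
  kind := fun
    | _, .choosing => .universal
    | _, .objecting => .reject
    | (q, _, b), .following _ b' =>
      open Classical in if b ≠ b' then .deterministic else if q = p.exit then .accept
        else .existential
  nextE := fun (q, _, b) _ _ e =>
    (((publish p q e).1, (publish p q e).2, !b), .stay, Empty.elim)
  nextU r _ _ _ _ v := (r, .following v false, .stay, Empty.elim, Empty.elim)
  nextD := fun
    | (q, o, b), .following v _, a, _, _ => match track a o v with
      | some d => ((q, o, b), .following v b, d, Empty.elim, Empty.elim)
      | none => ((q, o, b), .objecting, .stay, Empty.elim, Empty.elim)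
    | r, c, _, _, _ => (r, c, .stay, Empty.elim, Empty.elim)

theorem graphPath_of_publish {x : List α} {q : p.Node} {s s' : V → ℕ}
    {e : p.Node × Option (CounterOp α V) × p.Node} {t : p.Node × (V → ℕ)}
    (hstep : PosStep x (publish p q e).2 s s')
    (hpath : ReflTransGen (GraphStep p.edge (PosStep x)) ((publish p q e).1, s') t) :
    ReflTransGen (GraphStep p.edge (PosStep x)) (q, s) t := by
  rcases publish_cases p q e with hedge | hidle
  · exact hpath.head ⟨_, hedge, hstep⟩
  · rw [hidle] at hstep hpath
    obtain rfl : s' = s := hstep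
    exact hpath

section Configurations

variable [Finite α] [Finite V]

/-- A configuration of the machine: it is determined by the control and the head position. -/
noncomputable def config (r : p.Node × Option (CounterOp α V) × Bool) (k : Control V) (m : ℕ) :
    (machine p).Cfg :=
  ⟨r, k, m, nofun, nofun⟩

variable {p} {x : List α} {q : p.Node} {o : Option (CounterOp α V)} {b b' : Bool}
  {r : p.Node × Option (CounterOp α V) × Bool} {v : Option V} {k : Control V} {m : ℕ}

theorem config_ext {c c' : (machine p).Cfg} (hpub : c.pub = c'.pub) (hpriv : c.priv = c'.priv)
    (hhead : c.inHead = c'.inHead) : c = c' := by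
  cases c
  cases c'
  congr 1 <;> exact funext nofun

theorem config_surjective (c : (machine p).Cfg) : ∃ q o b k m, c = config p (q, o, b) k m :=
  ⟨_, _, _, _, _, config_ext rfl rfl rfl⟩

theorem config_kind_eq_deterministic :
    (config p (q, o, b) (.following v b') m).kind = .deterministic ↔ b ≠ b' := by
  simp only [PATM.Cfg.kind, config, machine]
  split_ifs <;> simp_all

theorem config_kind_eq_accept :
    (config p (q, o, b) (.following v b) m).kind = .accept ↔ q = p.exit := by
  simp [PATM.Cfg.kind, config, machine]

theorem config_kind_eq_existential :
    (config p (q, o, b) (.following v b) m).kind = .existential ↔ q ≠ p.exit := by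
  simp [PATM.Cfg.kind, config, machine]

theorem config_kind_ne_universal : (config p (q, o, b) (.following v b') m).kind ≠ .universal := by
  simp only [PATM.Cfg.kind, config, machine]
  split_ifs <;> simp

theorem config_stepE (x : List α) (e : (machine p).EChoice) :
    (config p (q, o, b) k m).stepE x e =
      config p ((publish p q e).1, (publish p q e).2, !b) k m :=
  config_ext rfl rfl rfl

theorem config_stepU (x : List α) (u : (machine p).UChoice) :
    (config p r k m).stepU x u = config p r (.following u false) m :=
  config_ext rfl rfl rfl

theorem config_stepD_of_track_eq_some {d : Dir} (hd : track (inputSym x m) o v = some d) :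
    (config p (q, o, b) (.following v b') m).stepD x =
      config p (q, o, b) (.following v b) (d.moveInput x.length m) := by
  apply config_ext <;> simp [PATM.Cfg.stepD, PATM.Cfg.act, config, machine, hd]

theorem config_stepD_of_track_eq_none (hd : track (inputSym x m) o v = none) :
    (config p (q, o, b) (.following v b') m).stepD x = config p (q, o, b) .objecting m := by
  apply config_ext <;> simp [PATM.Cfg.stepD, PATM.Cfg.act, config, machine, hd, Dir.moveInput]

theorem machine_isBlind : (machine p).IsBlind := by
  intro x c
  obtain ⟨q, o, b, k, m, rfl⟩ := config_surjective c
  refine ⟨fun _ u => by rw [config_stepU]; rfl, fun hk => ?_⟩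
  rcases k with _ | ⟨v, b'⟩ | _
  · cases hk
  · rcases hd : track (inputSym x m) o v with _ | d
    · rw [config_stepD_of_track_eq_none hd]
      rfl
    · rw [config_stepD_of_track_eq_some hd]
      rfl
  · cases hk

theorem machine_spaceBounded (s : ℕ → ℕ) : (machine p).SpaceBounded s :=
  fun _ _ _ _ => ⟨nofun, nofun⟩

theorem machine_universalMovesAtMost : (machine p).UniversalMovesAtMost 1 := by
  intro x k c hc
  suffices hinv : (c.priv = .choosing → k = 0) ∧ k ≤ 1 from hinv.2
  induction hc with
  | start => simp
  | existential _ _ _ ih => exact ih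
  | @universal k c u _ hk ih =>
    obtain ⟨q, o, b, _ | _ | _, m, rfl⟩ := config_surjective c
    · exact ⟨nofun, by rw [ih.1 rfl]⟩
    · exact absurd hk config_kind_ne_universal
    · cases hk
  | @deterministic k c _ hk ih =>
    obtain ⟨q, o, b, _ | ⟨v, b'⟩ | _, m, rfl⟩ := config_surjective c
    · cases hk
    · refine ⟨fun hc => ?_, ih.2⟩
      rcases hd : track (inputSym x m) o v with _ | d
      · rw [config_stepD_of_track_eq_none hd] at hc
        cases hc
      · rw [config_stepD_of_track_eq_some hd] at hc
        cases hc
    · cases hk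

theorem observe_stepD (h : List (machine p).Event) {c : (machine p).Cfg}
    (hk : c.kind = .deterministic) : PATM.observe h c (c.stepD x) = h :=
  PATM.observe_of_eq ((machine_isBlind x c).2 hk)

end Configurations

section Correctness

variable [Finite α] [Finite V] {p} {x : List α} {σ : (machine p).Strategy}
  {h : List (machine p).Event} {q : p.Node} {o : Option (CounterOp α V)} {b b' : Bool}
  {s s' : V → ℕ}

theorem wins_pending_iff {v : Option V} {m : ℕ} (hb : b ≠ b') :
    PATM.Wins x σ h (config p (q, o, b) (.following v b') m) ↔ ∃ d ∈ track (inputSym x m) o v,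
      PATM.Wins x σ h (config p (q, o, b) (.following v b) (d.moveInput x.length m)) := by
  have hk : (config p (q, o, b) (.following v b') m).kind = .deterministic :=
    config_kind_eq_deterministic.2 hb
  constructor
  · intro hw
    have hw' := hw.deterministic_inv hk
    rw [observe_stepD h hk] at hw'
    rcases hd : track (inputSym x m) o v with _ | d
    · rw [config_stepD_of_track_eq_none hd] at hw'
      exact absurd rfl hw'.kind_ne_reject
    · rw [config_stepD_of_track_eq_some hd] at hw'
      exact ⟨d, rfl, hw'⟩
  · rintro ⟨d, hd, hw⟩
    refine .deterministic hk ?_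
    rwa [observe_stepD h hk, config_stepD_of_track_eq_some hd]

theorem exists_posStep_of_wins (hs : ∀ v, s v < x.length + 2) (hb : b ≠ b')
    (hw : ∀ v, PATM.Wins x σ h (config p (q, o, b) (.following v b') (position s v))) :
    ∃ s', PosStep x o s s' ∧
      ∀ v, PATM.Wins x σ h (config p (q, o, b) (.following v b) (position s' v)) := by
  choose d hd hwins using fun v => (wins_pending_iff hb).1 (hw v)
  have hpos : ∀ v, position (fun w => (d (some w)).moveInput x.length (s w)) v =
      (d v).moveInput x.length (position s v) := by
    rintro (_ | v)
    · have := hd none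
      rw [track_none, Option.mem_some_iff] at this
      rw [← this]
      rfl
    · rfl
  exact ⟨_, (posStep_iff_forall_track hs o).2 fun v => ⟨d v, hd v, hpos v⟩,
    fun v => hpos v ▸ hwins v⟩

theorem wins_of_posStep (hs : ∀ v, s v < x.length + 2) (hb : b ≠ b') (hstep : PosStep x o s s')
    (hw : ∀ v, PATM.Wins x σ h (config p (q, o, b) (.following v b) (position s' v)))
    (v : Option V) : PATM.Wins x σ h (config p (q, o, b) (.following v b') (position s v)) := by
  obtain ⟨d, hd, hpos⟩ := (posStep_iff_forall_track hs o).1 hstep v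
  exact (wins_pending_iff hb).2 ⟨d, hd, hpos ▸ hw v⟩

/-- In the branch that follows no variable every published operation is admissible, so that the
induction runs over the moves of this branch, while the other branches share its history. -/
theorem exists_path_of_wins {c : (machine p).Cfg} (hw : PATM.Wins x σ h c)
    (hc : c = config p (q, o, b) (.following none b') 0) (hs : ∀ v, s v < x.length + 2)
    (hall : ∀ v, PATM.Wins x σ h (config p (q, o, b) (.following v b') (position s v))) :
    ∃ s' s'', PosStep x (if b = b' then none else o) s s' ∧
      ReflTransGen (GraphStep p.edge (PosStep x)) (q, s') (p.exit, s'') := by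
  have pending_iff : c.kind = .deterministic ↔ b ≠ b' := hc ▸ config_kind_eq_deterministic
  induction hw generalizing q o b b' s with
  | @accept h c hk =>
    obtain rfl : b = b' := by simpa [hk] using pending_iff
    obtain rfl : q = p.exit := config_kind_eq_accept.1 (hc ▸ hk)
    exact ⟨s, s, by simp [PosStep, idleOr], .refl⟩
  | @existential h c hk _ ih =>
    obtain rfl : b = b' := by simpa [hk] using pending_iff
    have hq : q ≠ p.exit := config_kind_eq_existential.1 (hc ▸ hk)
    have hall' := fun v => (hall v).existential_inv (config_kind_eq_existential.2 hq)
    simp only [config_stepE] at hall'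
    subst hc
    rw [config_stepE] at ih
    obtain ⟨s', s'', hstep, hpath⟩ := ih rfl hs hall' config_kind_eq_deterministic
    rw [if_neg (by simp)] at hstep
    exact ⟨s, s'', by simp [PosStep, idleOr], graphPath_of_publish p hstep hpath⟩
  | universal hk => exact absurd (hc ▸ hk) config_kind_ne_universal
  | @deterministic h c hk _ ih =>
    have hb := pending_iff.1 hk
    obtain ⟨s', hstep, hall'⟩ := exists_posStep_of_wins hs hb hall
    subst hc
    rw [observe_stepD h hk, config_stepD_of_track_eq_some (track_none _ o)] at ih
    obtain ⟨t, s'', ht, hpath⟩ := ih rfl (hstep.lt hs) hall' config_kind_eq_deterministic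
    rw [if_pos rfl] at ht
    obtain rfl : t = s' := ht
    exact ⟨t, s'', by rwa [if_neg hb], hpath⟩

theorem exists_strategy_of_path {t t' : p.Node × (V → ℕ)}
    (hpath : ReflTransGen (GraphStep p.edge (PosStep x)) t t') (ht' : t'.1 = p.exit)
    (hs : ∀ v, t.2 v < x.length + 2) (n : ℕ) :
    ∃ σ : (machine p).Strategy, ∀ h : List (machine p).Event, h.length = n → ∀ o b v,
      PATM.Wins x σ h (config p (t.1, o, b) (.following v b) (position t.2 v)) := by
  classical
  induction hpath using ReflTransGen.head_induction_on generalizing n with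
  | refl =>
    exact ⟨fun _ => (p.entry, none, p.entry), fun _ _ _ _ _ =>
      .accept (config_kind_eq_accept.2 ht')⟩
  | @head t u hstep _ ih =>
    obtain ⟨o', hedge, hstep⟩ := hstep
    obtain ⟨σ, hσ⟩ := ih (hstep.lt hs) (n + 1)
    obtain ⟨e, he⟩ : ∃ e : (machine p).EChoice, publish p t.1 e = (u.1, o') :=
      ⟨_, publish_of_edge p hedge⟩
    let τ : (machine p).Strategy := fun h => if h.length = n then e else σ h
    have hτ : ∀ h, n + 1 ≤ h.length → σ h = τ h := fun h hn => (if_neg (by lia)).symm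
    refine ⟨τ, fun h hn o b v => ?_⟩
    by_cases hexit : t.1 = p.exit
    · exact .accept (config_kind_eq_accept.2 hexit)
    refine .existential (config_kind_eq_existential.2 hexit) ?_
    rw [show τ h = e from if_pos hn, config_stepE, he]
    refine wins_of_posStep hs (by simp) hstep (fun v => ?_) v
    exact (hσ _ (by simp [hn]) _ _ _).congr hτ (by simp [hn])

theorem machine_accepts_iff :
    (machine p).Accepts x ↔ ∃ s, p.Runs (CounterOp.sem posBound Set.univ · x) (fun _ => 0) s := by
  have hstart : (machine p).startCfg = config p (p.entry, none, false) .choosing 0 :=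
    config_ext rfl rfl rfl
  have hobserve (u) : PATM.observe [] (machine p).startCfg ((machine p).startCfg.stepU x u) = [] :=
    PATM.observe_of_eq ((machine_isBlind x _).1 rfl u)
  have hstep (u) : (machine p).startCfg.stepU x u =
      config p (p.entry, none, false) (.following u false) (position (fun _ => 0) u) := by
    rw [hstart, config_stepU]
    cases u <;> rfl
  constructor
  · rintro ⟨σ, hσ⟩
    have hall (u) := hstep u ▸ hobserve u ▸ hσ.universal_inv rfl u
    obtain ⟨s, s', hs, hpath⟩ := exists_path_of_wins (hall none) rfl (by simp) hall
    rw [if_pos rfl] at hs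
    obtain rfl : s = _ := hs
    exact ⟨s', hpath⟩
  · rintro ⟨s, hpath⟩
    obtain ⟨σ, hσ⟩ := exists_strategy_of_path hpath rfl (by simp) 0
    refine ⟨σ, .universal rfl fun u => ?_⟩
    rw [hobserve, hstep]
    exact hσ [] rfl _ _ _

end Correctness

end Blind

theorem counterNL_subset_baspaceConst (α : Type) [Finite α] (s : ℕ → ℕ) :
    CounterNL α ⊆ BASPACEConst α s := by
  rintro L ⟨V, _, R, ⟨p, hp⟩, hL⟩
  refine ⟨Blind.machine p, Blind.machine_isBlind, Blind.machine_spaceBounded s,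
    ⟨1, Blind.machine_universalMovesAtMost⟩, fun x => ?_⟩
  rw [hL, Blind.machine_accepts_iff]
  simp only [hp]

/-! ### Counter programs on machines with binary work tapes -/

/-- The variable on which an operation acts. -/
def CounterOp.var {α V : Type} : CounterOp α V → V
  | inc v => v
  | dec v => v
  | test v _ => v

namespace WorkTape

theorem act_read {A : Type} (T : WorkTape A) (d : Dir) :
    T.act (T.read, d) = ⟨T.cells, d.moveWork T.head⟩ := by
  simp [act, read]

theorem act_read_stay {A : Type} (T : WorkTape A) : T.act (T.read, .stay) = T :=
  act_read T .stay

end WorkTape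

namespace Binary

/-- Work tape symbols: `none` marks cell `0`, `some none` is the blank, and `some (some b)` is a
binary digit. -/
abbrev Cell : Type := Option (Option Bool)

/-- The contents of a tape with the digits `ds` in the cells `1, …, ds.length`. -/
def numeral (ds : List Bool) : ℕ → Cell
  | 0 => none
  | i + 1 => some ds[i]?

/-- The number with binary digits `ds`, least significant digit first. -/
def value (ds : List Bool) : ℕ := Nat.ofDigits 2 (ds.map Bool.toNat)

theorem value_nil : value [] = 0 := rfl

theorem value_cons (b : Bool) (ds : List Bool) : value (b :: ds) = b.toNat + 2 * value ds := by
  simp [value, Nat.ofDigits_cons]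

theorem value_append (l r : List Bool) : value (l ++ r) = value l + 2 ^ l.length * value r := by
  simp [value, Nat.ofDigits_append]

theorem value_replicate_false (j : ℕ) : value (.replicate j false) = 0 := by
  induction j with
  | zero => rfl
  | succ j ih => simp [List.replicate_succ, value_cons, ih]

theorem value_replicate_true (j : ℕ) : value (.replicate j true) + 1 = 2 ^ j := by
  induction j with
  | zero => rfl
  | succ j ih =>
    rw [List.replicate_succ, value_cons, pow_succ, ← ih, Bool.toNat_true]
    ring

theorem read_digit {l : List Bool} {j : ℕ} (hj : l.length = j) (r : List Bool) :
    WorkTape.read ⟨numeral (l ++ r), j + 1⟩ = some r.head? := by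
  simp [← hj, WorkTape.read, numeral, List.head?_eq_getElem?, List.getElem?_append_right]

theorem act_digit {l r : List Bool} {j : ℕ} (hj : l.length = j) {z : Option Bool}
    (hz : z = none → r = []) (d : Dir) :
    WorkTape.act ⟨numeral (l ++ r), j + 1⟩ (some z, d) =
      ⟨numeral (l ++ (z.toList ++ r.tail)), d.moveWork (j + 1)⟩ := by
  subst hj
  simp only [WorkTape.act, WorkTape.mk.injEq, and_true]
  ext1 i
  rcases i with _ | i
  · rfl
  · simp only [Function.update_apply, numeral, Nat.add_right_cancel_iff]
    split_ifs with hi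
    · subst hi
      cases z <;> simp [hz]
    · congr 1
      rcases lt_or_gt_of_ne hi with hi | hi
      · simp [List.getElem?_append_left hi]
      · obtain ⟨k, rfl⟩ := Nat.exists_eq_add_of_lt hi
        cases z <;> simp [hz, List.getElem?_append, add_assoc]

/-- Sweeps over a number, from the least significant digit on: decrement, test for zero, and
increment. -/
inductive Sweep
  | dec
  | zero
  | inc

namespace Sweep

instance : Finite Sweep :=
  Finite.of_injective (β := Fin 3) (fun | .dec => 0 | .zero => 1 | .inc => 2)
    (by rintro (_ | _ | _) (_ | _ | _) <;> simp)

/-- The digit over which the sweep passes. -/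
def before : Sweep → Bool
  | dec => false
  | zero => false
  | inc => true

/-- The digit which the sweep leaves behind. -/
def after : Sweep → Bool
  | dec => true
  | zero => false
  | inc => false

/-- The contents of the cell at which the sweep turns round, and its new contents. -/
inductive Turn : Sweep → Option Bool → Option Bool → Prop
  | dec : Turn dec (some true) (some false)
  | zero : Turn zero none none
  | inc {y : Option Bool} : y ≠ some true → Turn inc y (some true)

/-- The effect of a sweep on the number. -/
def Changes : Sweep → ℕ → ℕ → Prop
  | dec, a, a' => a = a' + 1
  | zero, a, a' => a = 0 ∧ a' = 0
  | inc, a, a' => a' = a + 1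

variable {k : Sweep} {r : List Bool} {z : Option Bool}

theorem Turn.eq_nil (h : k.Turn r.head? z) (hz : z = none) : r = [] := by
  subst hz
  generalize hy : r.head? = y at h
  cases h
  exact List.head?_eq_none_iff.1 hy

theorem Turn.changes (h : k.Turn r.head? z) (j : ℕ) :
    k.Changes (value (.replicate j k.before ++ r))
      (value (.replicate j k.after ++ (z.toList ++ r.tail))) := by
  have hpow := value_replicate_true j
  simp only [value_append, List.length_replicate]
  cases k <;> rcases r with _ | ⟨_ | _, r⟩ <;> cases h <;>
    simp [Changes, before, after, value_replicate_false, value_cons, value_nil] at * <;> lia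

theorem Changes.exists_turn {ds : List Bool} {a : ℕ} (h : k.Changes (value ds) a) :
    ∃ j r z, ds = .replicate j k.before ++ r ∧ k.Turn r.head? z := by
  induction ds generalizing a with
  | nil =>
    cases k with
    | dec => simp [Changes, value_nil] at h
    | zero => exact ⟨0, [], none, rfl, .zero⟩
    | inc => exact ⟨0, [], some true, rfl, .inc nofun⟩
  | cons b ds ih =>
    by_cases hb : b = k.before
    · subst hb
      have ⟨a', h'⟩ : ∃ a', k.Changes (value ds) a' := by
        rw [value_cons] at h
        cases k with
        | dec => exact ⟨value ds - 1, by simp [Changes, before] at h ⊢; lia⟩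
        | zero => exact ⟨0, by simp [Changes, before] at h ⊢; lia⟩
        | inc => exact ⟨_, rfl⟩
      obtain ⟨j, r, z, rfl, hturn⟩ := ih h'
      exact ⟨j + 1, r, z, rfl, hturn⟩
    · refine ⟨0, b :: ds, ?_⟩
      cases k with
      | dec =>
        obtain rfl : b = true := by simpa [before] using hb
        exact ⟨some false, rfl, .dec⟩
      | zero => simp_all [Changes, value_cons, before]
      | inc => exact ⟨some true, rfl, .inc (by simpa [before] using hb)⟩

end Sweep

theorem sem_iff_track {α V : Type} {o : CounterOp α V} {x : List α} {s s' : V → ℕ}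
    (hs : ∀ v, s v < x.length + 2) :
    o.sem posBound Set.univ x s s' ↔
      ∃ d ∈ Blind.track (inputSym x (s o.var)) (some o) (some o.var),
        s' = assign s o.var (d.moveInput x.length (s o.var)) := by
  have track_of_ne {w : V} (hw : w ≠ o.var) (a : InSym α) :
      Blind.track a (some o) (some w) = some .stay := by
    cases o <;> simp_all [Blind.track, CounterOp.var]
  refine (Blind.posStep_iff_forall_track hs (some o)).trans ?_
  rw [Option.forall, ← and_forall_ne o.var]
  have moveInput_stay (p : ℕ) : Dir.stay.moveInput x.length p = p := rfl
  simp +contextual [Blind.track_none, Blind.position, eq_assign_iff, track_of_ne, moveInput_stay,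
    ← exists_and_right, and_assoc]

/-- The phases in the simulation of an operation: the value of the variable is moved to the input
head (`load`), the input head carries out the operation (`exec`), and its position is moved back
to the tape (`save`). A sweep over the tape consists of the phases `go` and `ret`. -/
inductive Phase
  | load
  | exec
  | save
  | go (k : Sweep)
  | ret (k : Sweep)

instance : Finite Phase :=
  Finite.of_injective (β := Fin 3 ⊕ Sweep ⊕ Sweep)
    (fun | .load => .inl 0 | .exec => .inl 1 | .save => .inl 2 | .go k => .inr (.inl k)
         | .ret k => .inr (.inr k))
    (by rintro (_ | _ | _ | _ | _) (_ | _ | _ | _ | _) <;> simp)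

/-- The phase that follows a sweep. -/
def Sweep.next : Sweep → Phase
  | dec => .load
  | zero => .exec
  | inc => .save

/-- The movement of the input head at the end of a sweep. -/
def Sweep.headMove : Sweep → Dir
  | dec => .right
  | zero => .stay
  | inc => .stay

section Local

variable {α V : Type}

/-- The moves within the simulation of the operation `o`, which concern the input head, scanning
`a`, and the tape of the variable, scanning `y`. -/
inductive LocalMove (o : CounterOp α V) (a : InSym α) (y : Cell) :
    Phase → Phase → Dir → Cell × Dir → Prop
  | load {k : Sweep} : k ≠ .inc → LocalMove o a y .load (.go k) .stay (y, .right)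
  | exec {d : Dir} : d ∈ Blind.track a (some o) (some o.var) →
      LocalMove o a y .exec .save d (y, .stay)
  | save : a ≠ .leftEnd → LocalMove o a y .save (.go .inc) .left (y, .right)
  | goOn {k : Sweep} : y = some (some k.before) →
      LocalMove o a y (.go k) (.go k) .stay (some (some k.after), .right)
  | turn {k : Sweep} {b z : Option Bool} : y = some b → k.Turn b z →
      LocalMove o a y (.go k) (.ret k) .stay (some z, .left)
  | retOn {k : Sweep} : y ≠ none → LocalMove o a y (.ret k) (.ret k) .stay (y, .left)
  | retStop {k : Sweep} : y = none → LocalMove o a y (.ret k) k.next k.headMove (y, .stay)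

/-- A step within the simulation of the operation `o`; the state consists of the phase, the
position of the input head, and the tape of the variable. -/
def LocalStep (o : CounterOp α V) (x : List α) (s s' : Phase × ℕ × WorkTape Cell) : Prop :=
  ∃ d w, LocalMove o (inputSym x s.2.1) s.2.2.read s.1 s'.1 d w ∧
    s'.2 = (d.moveInput x.length s.2.1, s.2.2.act w)

/-- The amount by which the head has already moved when an `inc` sweep is under way. -/
def Sweep.offset : Sweep → ℕ
  | inc => 1
  | _ => 0

/-- The invariant of the simulation of an operation: the number on the tape `T` and the position
`u` of the input head add up to `P`, and there are at most `W` digits. -/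
def PhaseInv (W P : ℕ) : Phase → ℕ → WorkTape Cell → Prop
  | .load, u, T => ∃ ds, T = ⟨numeral ds, 0⟩ ∧ ds.length ≤ W ∧ value ds + u = P
  | .exec, u, T => ∃ ds, T = ⟨numeral ds, 0⟩ ∧ ds.length ≤ W ∧ value ds = 0 ∧ u = P
  | .save, u, T => ∃ ds, T = ⟨numeral ds, 0⟩ ∧ ds.length ≤ W ∧ value ds + u = P
  | .go k, u, T => ∃ j r, T = ⟨numeral (.replicate j k.after ++ r), j + 1⟩ ∧ j + r.length ≤ W ∧
      value (.replicate j k.before ++ r) + k.offset + u = P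
  | .ret k, u, T => ∃ ds m a, T = ⟨numeral ds, m⟩ ∧ m ≤ W ∧ ds.length ≤ W ∧
      k.Changes a (value ds) ∧ a + k.offset + u = P

variable {o : CounterOp α V} {x : List α} {W P u : ℕ} {T : WorkTape Cell}

theorem PhaseInv.head_lt {φ : Phase} (h : PhaseInv W P φ u T) : T.head < W + 2 := by
  cases φ with
  | go k =>
    obtain ⟨j, r, rfl, hlen, -⟩ := h
    simp only
    lia
  | ret k =>
    obtain ⟨ds, m, a, rfl, hm, -⟩ := h
    simp only
    lia
  | _ =>
    obtain ⟨ds, rfl, -⟩ := h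
    simp

theorem phaseInv_go_start {k : Sweep} {ds : List Bool} (hds : ds.length ≤ W)
    (hP : value ds + k.offset + u = P) : PhaseInv W P (.go k) u ⟨numeral ds, 1⟩ :=
  ⟨0, ds, rfl, by simpa, hP⟩

theorem act_goOn (j : ℕ) (b b' : Bool) (r : List Bool) :
    WorkTape.act ⟨numeral (.replicate j b' ++ b :: r), j + 1⟩ (some (some b'), .right) =
      ⟨numeral (.replicate (j + 1) b' ++ r), j + 2⟩ := by
  rw [act_digit (z := some b') (by simp) nofun, List.replicate_succ']
  simp [Dir.moveWork]

theorem phaseInv_goOn {k : Sweep} (h : PhaseInv W P (.go k) u T)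
    (hread : T.read = some (some k.before)) :
    PhaseInv W P (.go k) u (T.act (some (some k.after), .right)) := by
  obtain ⟨j, r, rfl, hlen, hsum⟩ := h
  rw [read_digit (by simp), Option.some_inj, List.head?_eq_some_iff] at hread
  obtain ⟨r, rfl⟩ := hread
  rw [act_goOn]
  refine ⟨j + 1, r, rfl, by simp at hlen; lia, ?_⟩
  rwa [List.replicate_succ', List.append_assoc]

theorem Sweep.Turn.length_le {k : Sweep} {r : List Bool} {z : Option Bool}
    (h : k.Turn r.head? z) {j : ℕ} (hlen : j + r.length ≤ W)
    (hW : value (.replicate j k.before ++ r) + k.offset < 2 ^ W) :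
    j + (z.toList.length + r.tail.length) ≤ W := by
  rcases r with _ | ⟨b, r⟩
  · cases h with
    | zero => simpa using hlen
    | inc =>
      simp only [before, offset, List.append_nil, value_replicate_true] at hW
      exact (Nat.pow_lt_pow_iff_right one_lt_two).1 hW
  · have : z.toList.length ≤ 1 := by cases z <;> simp
    simp at hlen ⊢
    lia

theorem phaseInv_turn {k : Sweep} {b z : Option Bool} (h : PhaseInv W P (.go k) u T)
    (hPW : P < 2 ^ W) (hread : T.read = some b) (hturn : k.Turn b z) :
    PhaseInv W P (.ret k) u (T.act (some z, .left)) := by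
  obtain ⟨j, r, rfl, hlen, hsum⟩ := h
  rw [read_digit (by simp), Option.some_inj] at hread
  subst hread
  rw [act_digit (by simp) hturn.eq_nil]
  refine ⟨_, j, _, rfl, by lia, ?_, hturn.changes j, hsum⟩
  simpa using hturn.length_le hlen (by lia)

theorem phaseInv_retStop {k : Sweep} (h : PhaseInv W P (.ret k) u T) (hP : P ≤ x.length + 1)
    (hread : T.read = none) : PhaseInv W P k.next (k.headMove.moveInput x.length u) T := by
  obtain ⟨ds, m, a, rfl, -, hlen, hch, hsum⟩ := h
  obtain rfl : m = 0 := by cases m <;> simp_all [WorkTape.read, numeral]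
  cases k
  · obtain rfl : a = value ds + 1 := hch
    exact ⟨ds, rfl, hlen, by simp [Sweep.offset, Sweep.headMove, Dir.moveInput] at *; lia⟩
  · obtain ⟨rfl, hds⟩ := hch
    exact ⟨ds, rfl, hlen, hds, by simpa [Sweep.offset, Sweep.headMove, Dir.moveInput] using hsum⟩
  · exact ⟨ds, rfl, hlen, hch ▸ hsum⟩

theorem PhaseInv.step {φ φ' : Phase} {d : Dir} {w : Cell × Dir} (h : PhaseInv W P φ u T)
    (hP : P ≤ x.length + 1) (hPW : P < 2 ^ W) (hφ : φ ≠ .exec)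
    (hmove : LocalMove o (inputSym x u) T.read φ φ' d w) :
    PhaseInv W P φ' (d.moveInput x.length u) (T.act w) := by
  cases hmove with
  | load hk =>
    obtain ⟨ds, rfl, hlen, hsum⟩ := h
    rw [WorkTape.act_read]
    exact phaseInv_go_start hlen (by cases ‹Sweep› <;> simp_all [Sweep.offset, Dir.moveInput])
  | exec => exact absurd rfl hφ
  | save ha =>
    obtain ⟨ds, rfl, hlen, hsum⟩ := h
    rw [Ne, inputSym_eq_leftEnd] at ha
    rw [WorkTape.act_read]
    exact phaseInv_go_start hlen (by simp [Sweep.offset, Dir.moveInput]; lia)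
  | goOn hread => exact phaseInv_goOn h hread
  | turn hread hturn => exact phaseInv_turn h hPW hread hturn
  | retOn =>
    obtain ⟨ds, m, a, rfl, hm, hlen, hch, hsum⟩ := h
    rw [WorkTape.act_read]
    exact ⟨ds, m - 1, a, rfl, by lia, hlen, hch, hsum⟩
  | retStop hread =>
    rw [WorkTape.act_read]
    exact phaseInv_retStop h hP hread

theorem goOn_path (k : Sweep) (j : ℕ) (r : List Bool) :
    ReflTransGen (LocalStep o x) (.go k, u, ⟨numeral (.replicate j k.before ++ r), 1⟩)
      (.go k, u, ⟨numeral (.replicate j k.after ++ r), j + 1⟩) := by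
  induction j generalizing r with
  | zero => exact .refl
  | succ j ih =>
    rw [List.replicate_succ', List.append_assoc]
    exact (ih _).tail ⟨_, _, .goOn (read_digit (by simp) _), by
      rw [List.singleton_append, act_goOn]
      rfl⟩

theorem ret_path (k : Sweep) (ds : List Bool) (m : ℕ) :
    ReflTransGen (LocalStep o x) (.ret k, u, ⟨numeral ds, m⟩)
      (k.next, k.headMove.moveInput x.length u, ⟨numeral ds, 0⟩) := by
  induction m with
  | zero => exact .single ⟨_, _, .retStop rfl, by rw [WorkTape.act_read]; rfl⟩
  | succ m ih => exact ih.head ⟨.stay, (WorkTape.read ⟨numeral ds, m + 1⟩, .left),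
    .retOn (Option.some_ne_none _), by rw [WorkTape.act_read]; rfl⟩

theorem sweep_path {k : Sweep} {ds : List Bool} {a : ℕ} (h : k.Changes (value ds) a) :
    ∃ ds', k.Changes (value ds) (value ds') ∧
      ReflTransGen (LocalStep o x) (.go k, u, ⟨numeral ds, 1⟩)
        (k.next, k.headMove.moveInput x.length u, ⟨numeral ds', 0⟩) := by
  obtain ⟨j, r, z, rfl, hturn⟩ := h.exists_turn
  refine ⟨_, hturn.changes j, (goOn_path k j r).trans (.head ?_ (ret_path k _ j))⟩
  exact ⟨_, _, .turn (read_digit (by simp) _) hturn, by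
    rw [act_digit (by simp) hturn.eq_nil]
    rfl⟩

theorem load_path {ds : List Bool} (hu : value ds + u ≤ x.length + 1) :
    ∃ ds', value ds' = 0 ∧ ReflTransGen (LocalStep o x) (.load, u, ⟨numeral ds, 0⟩)
      (.exec, value ds + u, ⟨numeral ds', 0⟩) := by
  have start {k : Sweep} (hk : k ≠ .inc) (ds : List Bool) (u : ℕ) :
      LocalStep o x (.load, u, ⟨numeral ds, 0⟩) (.go k, u, ⟨numeral ds, 1⟩) :=
    ⟨_, _, .load hk, by rw [WorkTape.act_read]; rfl⟩
  induction hm : value ds generalizing ds u with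
  | zero =>
    obtain ⟨ds', ⟨-, hzero⟩, hpath⟩ := sweep_path (k := .zero) (o := o) (x := x) (u := u) ⟨hm, rfl⟩
    rw [zero_add]
    exact ⟨ds', hzero, hpath.head (start (k := .zero) nofun ds u)⟩
  | succ m ih =>
    obtain ⟨ds', hds', hpath⟩ := sweep_path (k := .dec) (o := o) (x := x) (u := u) hm
    obtain rfl : value ds' = m := by simpa [hm] using hds'.symm
    have hmove : Dir.right.moveInput x.length u = u + 1 := by simp [Dir.moveInput]; lia
    obtain ⟨ds'', hzero, hpath'⟩ := ih (u := u + 1) (by lia) rfl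
    refine ⟨ds'', hzero, (hpath.head (start (k := .dec) nofun ds u)).trans ?_⟩
    rwa [Sweep.headMove, hmove, Nat.add_right_comm]

theorem save_path (ds : List Bool) (u : ℕ) :
    ∃ ds', value ds' = value ds + u ∧
      ReflTransGen (LocalStep o x) (.save, u, ⟨numeral ds, 0⟩) (.save, 0, ⟨numeral ds', 0⟩) := by
  induction u generalizing ds with
  | zero => exact ⟨ds, rfl, .refl⟩
  | succ u ih =>
    obtain ⟨ds', hds', hpath⟩ := sweep_path (k := .inc) (o := o) (x := x) (u := u) (ds := ds) rfl
    obtain ⟨ds'', hds'', hpath'⟩ := ih ds'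
    have start : LocalStep o x (.save, u + 1, ⟨numeral ds, 0⟩) (.go .inc, u, ⟨numeral ds, 1⟩) :=
      ⟨_, _, .save (by simp [inputSym_eq_leftEnd]), by rw [WorkTape.act_read]; rfl⟩
    refine ⟨ds'', ?_, (hpath.head start).trans hpath'⟩
    rw [hds'', hds']
    lia

theorem operation_path {ds : List Bool} (hds : value ds ≤ x.length + 1) {d : Dir}
    (hd : d ∈ Blind.track (inputSym x (value ds)) (some o) (some o.var)) :
    ∃ ds', value ds' = d.moveInput x.length (value ds) ∧
      ReflTransGen (LocalStep o x) (.load, 0, ⟨numeral ds, 0⟩) (.save, 0, ⟨numeral ds', 0⟩) := by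
  obtain ⟨ds', hzero, hload⟩ := load_path (o := o) (x := x) (u := 0) hds
  obtain ⟨ds'', hvalue, hsave⟩ := save_path (o := o) (x := x) ds' (d.moveInput x.length (value ds))
  refine ⟨ds'', by rw [hvalue, hzero, zero_add], hload.trans (.head ?_ hsave)⟩
  exact ⟨_, _, .exec hd, by rw [WorkTape.act_read]; rfl⟩

end Local

/-- The control states of the machine for a program with nodes `N`: before the markers have been
written, at a node of the program, and within an operation that leads to a node. -/
inductive Control (α V N : Type) : Type
  | start
  | node (q : N)
  | during (φ : Phase) (o : CounterOp α V) (q : N)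

instance {α V N : Type} [Finite α] [Finite V] [Finite N] : Finite (Control α V N) :=
  Finite.of_injective (β := Option (N ⊕ Phase × CounterOp α V × N))
    (fun | .start => none | .node q => some (.inl q) | .during φ o q => some (.inr (φ, o, q)))
    (by rintro (_ | _ | _) (_ | _ | _) <;> simp)

/-- The action that leaves the work tapes with contents `y` alone. -/
def keep {V : Type} (y : V → Cell) (v : V) : Cell × Dir := (y v, .stay)

variable {α V : Type} (p : Program (CounterOp α V))

open Classical in
/-- The moves of the machine for the program `p`. -/
inductive Move (a : InSym α) (y : V → Cell) :
    Control α V p.Node → Control α V p.Node → Dir → (V → Cell × Dir) → Prop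
  | mark : Move a y .start (.node p.entry) .stay fun _ => (none, .stay)
  | idle {q q' : p.Node} : p.edge q none q' → Move a y (.node q) (.node q') .stay (keep y)
  | begin {q q' : p.Node} {o : CounterOp α V} : p.edge q (some o) q' →
      Move a y (.node q) (.during .load o q') .stay (keep y)
  | work {φ φ' : Phase} {o : CounterOp α V} {q : p.Node} {d : Dir} {w : Cell × Dir} :
      LocalMove o a (y o.var) φ φ' d w →
      Move a y (.during φ o q) (.during φ' o q) d (Function.update (keep y) o.var w)
  | finish {o : CounterOp α V} {q : p.Node} : a = .leftEnd →
      Move a y (.during .save o q) (.node q) .stay (keep y)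

/-- The machine for the program `p`, with a work tape for each variable. -/
abbrev machine [Finite α] [Finite V] : NTM α where
  State := Control α V p.Node
  Sym := Cell
  Tape := V
  blank := some none
  start := .start
  accept := .node p.exit
  next γ a y := {m | Move p a y γ m.1 m.2.1 m.2.2}

/-- The tape `T` holds the number `m`, written with at most `W` digits. -/
def Holds (W : ℕ) (T : WorkTape Cell) (m : ℕ) : Prop :=
  ∃ ds, T = ⟨numeral ds, 0⟩ ∧ ds.length ≤ W ∧ value ds = m

/-- The operation has been carried out in these phases, but its result is not on the tape yet. -/
def Phase.executed : Phase → Bool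
  | save | go .inc | ret .inc => true
  | _ => false

/-- The program reaches the node `q` with values `s`, from zero. -/
abbrev Reached (x : List α) (q : p.Node) (s : V → ℕ) : Prop :=
  ReflTransGen (GraphStep p.edge (idleOr (CounterOp.sem posBound Set.univ · x)))
    (p.entry, fun _ => 0) (q, s)

/-- The invariant of the computations of the machine. -/
def Inv (W : ℕ) (x : List α) :
    Control α V p.Node → ℕ → (V → WorkTape Cell) → Prop
  | .start, u, T => u = 0 ∧ T = fun _ => WorkTape.empty (some none)
  | .node q, u, T => u = 0 ∧ ∃ s, Reached p x q s ∧ ∀ v, Holds W (T v) (s v)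
  | .during φ o q, u, T => ∃ s, (∀ v ≠ o.var, Holds W (T v) (s v)) ∧
      PhaseInv W (s o.var) φ u (T o.var) ∧
      if φ.executed then Reached p x q s else ∃ q₀, Reached p x q₀ s ∧ p.edge q₀ (some o) q

variable {p}

theorem Reached.lt {x : List α} {q : p.Node} {s : V → ℕ} (h : Reached p x q s) (v : V) :
    s v < x.length + 2 := by
  revert v
  exact graphPath_induction h (motive := fun _ s => ∀ v, s v < x.length + 2) (by simp)
    fun _ hstep ih => Blind.PosStep.lt hstep ih

theorem LocalMove.executed_eq {o : CounterOp α V} {a : InSym α} {y : Cell} {φ φ' : Phase} {d : Dir}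
    {w : Cell × Dir} (h : LocalMove o a y φ φ' d w) (hφ : φ ≠ .exec) :
    φ'.executed = φ.executed := by
  cases h with
  | exec => exact absurd rfl hφ
  | load hk => cases ‹Sweep› <;> simp_all [Phase.executed]
  | @retStop k => cases k <;> rfl
  | @turn k => cases k <;> rfl
  | _ => rfl

section Soundness

variable {x : List α} {W u : ℕ} {T : V → WorkTape Cell}

theorem act_keep : (fun v => (T v).act (keep (fun v => (T v).read) v)) = T := by
  ext1 v
  exact WorkTape.act_read_stay (T v)

open Classical in
theorem act_update_keep (v : V) (w : Cell × Dir) :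
    (fun v' => (T v').act (Function.update (keep fun v => (T v).read) v w v')) =
      Function.update T v ((T v).act w) := by
  ext1 v'
  by_cases hv : v' = v
  · subst hv
    simp
  · simp only [Function.update_of_ne hv]
    exact WorkTape.act_read_stay (T v')

theorem act_mark : (WorkTape.empty (some none)).act (none, .stay) = ⟨numeral [], 0⟩ := by
  simp only [WorkTape.act, WorkTape.empty, WorkTape.mk.injEq]
  refine ⟨?_, rfl⟩
  ext1 i
  cases i <;> simp [numeral]

theorem inv_mark : Inv p W x (.node p.entry) 0 fun _ => (WorkTape.empty (some none)).act
    (none, .stay) :=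
  ⟨rfl, fun _ => 0, .refl, fun _ => ⟨[], act_mark, by simp, rfl⟩⟩

theorem inv_begin {q q' : p.Node} {o : CounterOp α V} (h : Inv p W x (.node q) u T)
    (he : p.edge q (some o) q') : Inv p W x (.during .load o q') u T := by
  obtain ⟨rfl, s, hs, hT⟩ := h
  obtain ⟨ds, hds, hlen, hvalue⟩ := hT o.var
  exact ⟨s, fun v _ => hT v, ⟨ds, hds, hlen, hvalue⟩, q, hs, he⟩

open Classical in
theorem inv_exec {q : p.Node} {o : CounterOp α V} {d : Dir}
    (h : Inv p W x (.during .exec o q) u T)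
    (hd : d ∈ Blind.track (inputSym x u) (some o) (some o.var)) :
    Inv p W x (.during .save o q) (d.moveInput x.length u) T := by
  obtain ⟨s, hT, ⟨ds, hds, hlen, hzero, rfl⟩, q₀, hs, he⟩ := h
  refine ⟨assign s o.var (d.moveInput x.length (s o.var)), fun v hv => ?_,
    ⟨ds, hds, hlen, by simp [hzero]⟩, hs.tail ⟨some o, he, (sem_iff_track hs.lt).2 ⟨d, hd, rfl⟩⟩⟩
  rw [assign_of_ne _ _ hv]
  exact hT v hv

open Classical in
theorem inv_work {q : p.Node} {o : CounterOp α V} {φ φ' : Phase} {d : Dir} {w : Cell × Dir}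
    (hW : x.length + 1 < 2 ^ W) (h : Inv p W x (.during φ o q) u T)
    (hmove : LocalMove o (inputSym x u) (T o.var).read φ φ' d w) :
    Inv p W x (.during φ' o q) (d.moveInput x.length u)
      (Function.update T o.var ((T o.var).act w)) := by
  by_cases hφ : φ = .exec
  · subst hφ
    cases hmove with
    | exec hd =>
      rw [WorkTape.act_read_stay, Function.update_eq_self]
      exact inv_exec h hd
  · obtain ⟨s, hT, hphase, hreach⟩ := h
    rw [← hmove.executed_eq hφ] at hreach
    have hbound : s o.var ≤ x.length + 1 := by
      split_ifs at hreach
      · exact Nat.lt_succ_iff.1 (hreach.lt _)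
      · obtain ⟨q₀, hs, -⟩ := hreach
        exact Nat.lt_succ_iff.1 (hs.lt _)
    refine ⟨s, fun v hv => ?_, ?_, hreach⟩
    · rw [Function.update_of_ne hv]
      exact hT v hv
    · rw [Function.update_self]
      exact hphase.step hbound (by lia) hφ hmove

theorem inv_finish {q : p.Node} {o : CounterOp α V} (h : Inv p W x (.during .save o q) u T)
    (hu : inputSym x u = .leftEnd) : Inv p W x (.node q) u T := by
  obtain rfl := inputSym_eq_leftEnd.1 hu
  obtain ⟨s, hT, hsave, hs⟩ := h
  refine ⟨rfl, s, hs, fun v => ?_⟩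
  by_cases hv : v = o.var
  · exact hv ▸ hsave
  · exact hT v hv

theorem Move.inv {γ γ' : Control α V p.Node} {d : Dir} {w : V → Cell × Dir}
    (hW : x.length + 1 < 2 ^ W) (h : Inv p W x γ u T)
    (hmove : Move p (inputSym x u) (fun v => (T v).read) γ γ' d w) :
    Inv p W x γ' (d.moveInput x.length u) fun v => (T v).act (w v) := by
  cases hmove with
  | mark =>
    obtain ⟨rfl, rfl⟩ := h
    exact inv_mark
  | idle he =>
    rw [act_keep]
    obtain ⟨hu, s, hs, hT⟩ := h
    exact ⟨hu, s, hs.tail ⟨none, he, rfl⟩, hT⟩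
  | begin he =>
    rw [act_keep]
    exact inv_begin h he
  | work hlocal =>
    rw [act_update_keep]
    exact inv_work hW h hlocal
  | finish hu =>
    rw [act_keep]
    exact inv_finish h hu

theorem Inv.head_lt {γ : Control α V p.Node} (h : Inv p W x γ u T) (v : V) :
    (T v).head < W + 2 := by
  have holds {m : ℕ} (h : Holds W (T v) m) : (T v).head < W + 2 := by
    obtain ⟨ds, hds, -⟩ := h
    simp [hds]
  cases γ with
  | start => simp [h.2, WorkTape.empty]
  | node q =>
    obtain ⟨-, s, -, hT⟩ := h
    exact holds (hT v)
  | during φ o q =>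
    obtain ⟨s, hT, hphase, -⟩ := h
    by_cases hv : v = o.var
    · exact hv ▸ hphase.head_lt
    · exact holds (hT v hv)

end Soundness

variable [Finite α] [Finite V] {x : List α}

theorem machine_inv {W : ℕ} (hW : x.length + 1 < 2 ^ W) {c : (machine p).Cfg}
    (hc : (machine p).Reachable x c) : Inv p W x c.state c.inHead c.tapes := by
  induction hc with
  | refl => exact ⟨rfl, rfl⟩
  | tail _ hstep ih =>
    obtain ⟨m, hm, rfl⟩ := hstep
    exact Move.inv hW ih hm

/-- The configuration at the node `q` with the numbers `ds` on the tapes. -/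
def nodeCfg (q : p.Node) (ds : V → List Bool) : (machine p).Cfg :=
  ⟨.node q, 0, fun v => ⟨numeral (ds v), 0⟩⟩

theorem step_of_move {γ γ' : Control α V p.Node} {u : ℕ} {T T' : V → WorkTape Cell} {d : Dir}
    {w : V → Cell × Dir} (h : Move p (inputSym x u) (fun v => (T v).read) γ γ' d w)
    (hT : (fun v => (T v).act (w v)) = T') :
    (machine p).Step x ⟨γ, u, T⟩ ⟨γ', d.moveInput x.length u, T'⟩ := by
  subst hT
  exact ⟨(_, _, _), h, rfl⟩

theorem step_start : (machine p).Step x (machine p).startCfg (nodeCfg p.entry fun _ => []) :=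
  step_of_move .mark (funext fun _ => act_mark)

theorem step_idle {q q' : p.Node} (h : p.edge q none q') (ds : V → List Bool) :
    (machine p).Step x (nodeCfg q ds) (nodeCfg q' ds) :=
  step_of_move (.idle h) act_keep

open Classical in
/-- The configuration within the operation `o` in which `s` describes the phase, the input head
and the tape of the variable. -/
noncomputable def duringCfg (o : CounterOp α V) (q : p.Node) (T : V → WorkTape Cell)
    (s : Phase × ℕ × WorkTape Cell) : (machine p).Cfg :=
  ⟨.during s.1 o q, s.2.1, Function.update T o.var s.2.2⟩

theorem step_work {o : CounterOp α V} {s s' : Phase × ℕ × WorkTape Cell}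
    (h : LocalStep o x s s') (q : p.Node) (T : V → WorkTape Cell) :
    (machine p).Step x (duringCfg o q T s) (duringCfg o q T s') := by
  obtain ⟨φ, u, t⟩ := s
  obtain ⟨φ', u', t'⟩ := s'
  obtain ⟨d, w, hmove, ⟨⟩⟩ := h
  refine step_of_move (.work (w := w) (by simpa using hmove)) ?_
  rw [act_update_keep]
  simp

theorem step_begin {q q' : p.Node} {o : CounterOp α V} (h : p.edge q (some o) q')
    (ds : V → List Bool) :
    (machine p).Step x (nodeCfg q ds)
      (duringCfg o q' (nodeCfg q ds).tapes (.load, 0, ⟨numeral (ds o.var), 0⟩)) := by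
  refine step_of_move (.begin h) (act_keep.trans ?_)
  simp [nodeCfg]

open Classical in
theorem step_finish (q q₀ : p.Node) (o : CounterOp α V) (ds : V → List Bool) (ds' : List Bool) :
    (machine p).Step x (duringCfg o q (nodeCfg q₀ ds).tapes (.save, 0, ⟨numeral ds', 0⟩))
      (nodeCfg q (Function.update ds o.var ds')) := by
  refine step_of_move (.finish rfl) (act_keep.trans ?_)
  ext1 v
  by_cases hv : v = o.var
  · subst hv
    simp
  · simp [nodeCfg, hv]

theorem operation_reachable {q q' : p.Node} {o : CounterOp α V} {s s' : V → ℕ}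
    {ds : V → List Bool} (hlt : ∀ v, s v < x.length + 2) (hds : ∀ v, value (ds v) = s v)
    (he : p.edge q (some o) q') (ho : o.sem posBound Set.univ x s s') :
    ∃ ds' : V → List Bool, (∀ v, value (ds' v) = s' v) ∧
      ReflTransGen ((machine p).Step x) (nodeCfg q ds) (nodeCfg q' ds') := by
  classical
  obtain ⟨d, hd, rfl⟩ := (sem_iff_track hlt).1 ho
  rw [← hds] at hd ⊢
  obtain ⟨l, hl, hpath⟩ := operation_path (by rw [hds]; exact Nat.lt_succ_iff.1 (hlt _)) hd
  refine ⟨Function.update ds o.var l, fun v => ?_, .head (step_begin he ds)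
    (.tail (ReflTransGen.lift _ (fun _ _ h => step_work h q' _) _ _ hpath)
      (step_finish q' q o ds l))⟩
  by_cases hv : v = o.var
  · subst hv
    simpa using hl
  · simp [hv, hds]

theorem exists_reachable_of_reached {q : p.Node} {s : V → ℕ} (h : Reached p x q s) :
    ∃ ds : V → List Bool, (∀ v, value (ds v) = s v) ∧ (machine p).Reachable x (nodeCfg q ds) := by
  suffices (∀ v, s v < x.length + 2) ∧ ∃ ds : V → List Bool, (∀ v, value (ds v) = s v) ∧
      (machine p).Reachable x (nodeCfg q ds) from this.2
  refine graphPath_induction h (motive := fun q s => (∀ v, s v < x.length + 2) ∧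
    ∃ ds : V → List Bool, (∀ v, value (ds v) = s v) ∧ (machine p).Reachable x (nodeCfg q ds))
    ⟨by simp, fun _ => [], fun _ => rfl, .single step_start⟩ ?_
  rintro q s o q' s' he ho ⟨hlt, ds, hds, hreach⟩
  refine ⟨Blind.PosStep.lt ho hlt, ?_⟩
  cases o with
  | none =>
    cases ho
    exact ⟨ds, hds, hreach.tail (step_idle he ds)⟩
  | some o =>
    obtain ⟨ds', hds', hpath⟩ := operation_reachable hlt hds he ho
    exact ⟨ds', hds', hreach.trans hpath⟩

variable (p) in
theorem machine_accepts_iff : (machine p).Accepts x ↔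
    ∃ s, p.Runs (CounterOp.sem posBound Set.univ · x) (fun _ => 0) s := by
  constructor
  · rintro ⟨⟨_, u, T⟩, hc, rfl⟩
    obtain ⟨-, s, hs, -⟩ := machine_inv (Nat.lt_pow_succ_log_self one_lt_two _) hc
    exact ⟨s, hs⟩
  · rintro ⟨s, hs⟩
    obtain ⟨ds, -, hreach⟩ := exists_reachable_of_reached hs
    exact ⟨_, hreach, rfl⟩

/-- The number of binary digits that suffices for positions on inputs of length `n`. -/
def width (n : ℕ) : ℕ := Nat.log 2 (n + 1) + 1

variable (p) in
theorem machine_spaceBounded : (machine p).SpaceBounded fun n => width n + 2 := fun _ _ hc _ =>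
  ((machine_inv (Nat.lt_pow_succ_log_self one_lt_two _) hc).head_lt _).trans_le (le_max_right _ _)

theorem log_succ_isBigO :
    (fun n : ℕ => Real.log (n + 1)) =O[Filter.atTop] fun n : ℕ => Real.log n := by
  refine Asymptotics.IsBigO.of_bound 2 ?_
  filter_upwards [Filter.eventually_ge_atTop 2] with n hn
  have hn' : (2 : ℝ) ≤ n := by exact_mod_cast hn
  rw [Real.norm_of_nonneg (Real.log_nonneg (by linarith)),
    Real.norm_of_nonneg (Real.log_nonneg (by linarith)), ← Nat.cast_ofNat, ← Real.log_pow]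
  exact Real.log_le_log (by positivity) (by nlinarith)

theorem isLogBound_width : IsLogBound fun n => width n + 2 := by
  have hlog : (fun n : ℕ => (Nat.log 2 (n + 1) : ℝ)) =O[Filter.atTop] fun n => Real.log n := by
    refine .trans (.of_bound (Real.log 2)⁻¹ (.of_forall fun n => ?_)) log_succ_isBigO
    rw [Real.norm_of_nonneg (by positivity), Real.norm_of_nonneg (Real.log_nonneg (by simp)),
      inv_mul_eq_div]
    exact_mod_cast Real.natLog_le_logb (n + 1) 2
  have hconst : (fun _ : ℕ => (3 : ℝ)) =O[Filter.atTop] fun n : ℕ => Real.log n :=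
    ((Real.isLittleO_const_log_atTop (c := 3)).comp_tendsto
      tendsto_natCast_atTop_atTop).isBigO
  refine (hlog.add hconst).congr_left fun n => ?_
  simp only [width]
  push_cast
  ring

end Binary

theorem counterNL_subset_nl (α : Type) [Finite α] : CounterNL α ⊆ NL α := by
  rintro L ⟨V, hV, R, ⟨p, hp⟩, hL⟩
  refine ⟨_, Binary.isLogBound_width, Binary.machine p, Binary.machine_spaceBounded p,
    fun x => ?_⟩
  simp only [hL, hp, Binary.machine_accepts_iff]

/-! ### Plays with fixed universal choices -/

namespace PATM

attribute [instance] finPub finPriv finSym finPubTape finPrivTape finEChoice finUChoice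
  neEChoice neUChoice

section FixedChoices

variable {α : Type} {M : PATM α} {x : List α} {r : ℕ}

/-- The play from the configuration `c` with history `h` in which the existential player follows
`σ` and the universal choices are `w k, w (k + 1), …` accepts after `n` moves. -/
inductive AcceptsAlong (x : List α) (σ : M.Strategy) (w : Fin (r + 1) → M.UChoice) :
    ℕ → Fin (r + 1) → List M.Event → M.Cfg → Prop
  | accept {k : Fin (r + 1)} {h : List M.Event} {c : M.Cfg} : c.kind = .accept →
      AcceptsAlong x σ w 0 k h c
  | existential {n : ℕ} {k : Fin (r + 1)} {h : List M.Event} {c : M.Cfg} : c.kind = .existential →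
      AcceptsAlong x σ w n k (h ++ [.inl (σ h)]) (c.stepE x (σ h)) →
      AcceptsAlong x σ w (n + 1) k h c
  | universal {n : ℕ} {k k' : Fin (r + 1)} {h : List M.Event} {c : M.Cfg} : c.kind = .universal →
      k'.val = k.val + 1 →
      AcceptsAlong x σ w n k' (observe h c (c.stepU x (w k))) (c.stepU x (w k)) →
      AcceptsAlong x σ w (n + 1) k h c
  | deterministic {n : ℕ} {k : Fin (r + 1)} {h : List M.Event} {c : M.Cfg} :
      c.kind = .deterministic →
      AcceptsAlong x σ w n k (observe h c (c.stepD x)) (c.stepD x) →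
      AcceptsAlong x σ w (n + 1) k h c

variable {σ σ' : M.Strategy} {w : Fin (r + 1) → M.UChoice} {n : ℕ} {k : Fin (r + 1)}
  {h : List M.Event} {c : M.Cfg}

namespace AcceptsAlong

theorem congr {m : ℕ} (hσ : ∀ h' : List M.Event, m ≤ h'.length → σ h' = σ' h')
    (ha : AcceptsAlong x σ w n k h c) (hm : m ≤ h.length) : AcceptsAlong x σ' w n k h c := by
  induction ha with
  | accept hk => exact .accept hk
  | existential hk _ ih =>
    refine .existential hk ?_
    rw [← hσ _ hm]
    exact ih (by simp; lia)
  | universal hk hk' _ ih => exact .universal hk hk' (ih (hm.trans (length_le_observe _)))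
  | deterministic hk _ ih => exact .deterministic hk (ih (hm.trans (length_le_observe _)))

theorem kind_ne_reject (ha : AcceptsAlong x σ w n k h c) : c.kind ≠ .reject := by
  cases ha <;> simp_all

theorem existential_inv (ha : AcceptsAlong x σ w n k h c) (hk : c.kind = .existential) :
    ∃ m, n = m + 1 ∧ AcceptsAlong x σ w m k (h ++ [.inl (σ h)]) (c.stepE x (σ h)) := by
  cases ha with
  | existential _ ha => exact ⟨_, rfl, ha⟩
  | _ => simp_all

theorem universal_inv (ha : AcceptsAlong x σ w n k h c) (hk : c.kind = .universal) :
    ∃ m k', n = m + 1 ∧ k'.val = k.val + 1 ∧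
      AcceptsAlong x σ w m k' (observe h c (c.stepU x (w k))) (c.stepU x (w k)) := by
  cases ha with
  | universal _ hk' ha => exact ⟨_, _, rfl, hk', ha⟩
  | _ => simp_all

theorem deterministic_inv (ha : AcceptsAlong x σ w n k h c) (hk : c.kind = .deterministic) :
    ∃ m, n = m + 1 ∧ AcceptsAlong x σ w m k (observe h c (c.stepD x)) (c.stepD x) := by
  cases ha with
  | deterministic _ ha => exact ⟨_, rfl, ha⟩
  | _ => simp_all

end AcceptsAlong

theorem Wins.exists_acceptsAlong (hr : M.UniversalMovesAtMost r) (hw : Wins x σ h c)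
    (w : Fin (r + 1) → M.UChoice) (hc : M.ReachesWith x k c) :
    ∃ n, AcceptsAlong x σ w n k h c := by
  induction hw generalizing k with
  | accept hk => exact ⟨0, .accept hk⟩
  | existential hk _ ih =>
    obtain ⟨n, hn⟩ := ih (.existential _ hc hk)
    exact ⟨_, .existential hk hn⟩
  | universal hk _ ih =>
    have hc' := ReachesWith.universal (w k) hc hk
    have hlt := hr _ _ _ hc'
    obtain ⟨n, hn⟩ := ih (w k) (k := ⟨k + 1, by lia⟩) hc'
    exact ⟨_, .universal hk rfl hn⟩
  | deterministic hk _ ih =>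
    obtain ⟨n, hn⟩ := ih (.deterministic hc hk)
    exact ⟨_, .deterministic hk hn⟩

/-- The universal choices made so far are recorded in `w₀`. -/
theorem wins_of_acceptsAlong {N : ℕ} (w₀ : Fin (r + 1) → M.UChoice)
    (H : ∀ w, (∀ i < k, w i = w₀ i) → ∃ n ≤ N, AcceptsAlong x σ w n k h c) : Wins x σ h c := by
  induction N generalizing k h c w₀ with
  | zero =>
    obtain ⟨n, hn, ha⟩ := H w₀ fun _ _ => rfl
    cases ha with
    | accept hk => exact .accept hk
    | _ => lia
  | succ N ih =>
    rcases hk : c.kind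
    · refine .existential hk (ih (k := k) w₀ fun w hw => ?_)
      obtain ⟨n, hn, ha⟩ := H w hw
      obtain ⟨m, rfl, ha'⟩ := ha.existential_inv hk
      exact ⟨m, by lia, ha'⟩
    · refine .universal hk fun u => ?_
      obtain ⟨_, -, ha⟩ := H w₀ fun _ _ => rfl
      obtain ⟨-, k', -, hk', -⟩ := ha.universal_inv hk
      refine ih (k := k') (Function.update w₀ k u) fun w hw => ?_
      obtain ⟨n, hn, ha⟩ := H w fun i hi => by
        rw [hw i (by rw [Fin.lt_def] at hi ⊢; lia), Function.update_of_ne hi.ne]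
      obtain ⟨m, k'', rfl, hk'', ha⟩ := ha.universal_inv hk
      obtain rfl : k'' = k' := Fin.ext (by lia)
      rw [hw k (by rw [Fin.lt_def]; lia), Function.update_self] at ha
      exact ⟨m, by lia, ha⟩
    · refine .deterministic hk (ih (k := k) w₀ fun w hw => ?_)
      obtain ⟨n, hn, ha⟩ := H w hw
      obtain ⟨m, rfl, ha'⟩ := ha.deterministic_inv hk
      exact ⟨m, by lia, ha'⟩
    · exact .accept hk
    · obtain ⟨_, -, ha⟩ := H w₀ fun _ _ => rfl
      exact absurd hk ha.kind_ne_reject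

end FixedChoices

/-! ### Comparing changes of the public part -/

/-- The movement of the input head that `d` amounts to on a cell with symbol `a`. -/
def clipInput {α : Type} : InSym α → Dir → Dir
  | .leftEnd, .left => .stay
  | .rightEnd, .right => .stay
  | _, d => d

/-- The movement of a work head that `d` amounts to, given whether the head is on cell `0`. -/
def clipWork : Bool → Dir → Dir
  | true, .left => .stay
  | _, d => d

theorem moveInput_eq_iff {α : Type} {x : List α} {p : ℕ} (hp : p < x.length + 2) (d d' : Dir) :
    d.moveInput x.length p = d'.moveInput x.length p ↔
      clipInput (inputSym x p) d = clipInput (inputSym x p) d' := by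
  have hleft := inputSym_eq_leftEnd (x := x) (p := p)
  have hright := inputSym_eq_rightEnd (x := x) (p := p)
  generalize inputSym x p = a at hleft hright ⊢
  rcases a with _ | _ | _ <;>
    simp only [reduceCtorEq, true_iff, false_iff] at hleft hright <;> cases d <;> cases d' <;>
    simp only [clipInput, Dir.moveInput, reduceCtorEq, iff_true, iff_false] <;> lia

theorem moveWork_eq_iff (p : ℕ) (d d' : Dir) :
    d.moveWork p = d'.moveWork p ↔
      clipWork (decide (p = 0)) d = clipWork (decide (p = 0)) d' := by
  rcases p with _ | p <;> cases d <;> cases d' <;> simp [clipWork, Dir.moveWork] <;> lia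

theorem act_eq_act_iff {A : Type} (T : WorkTape A) (a a' : A × Dir) :
    T.act a = T.act a' ↔ (a.1, clipWork (decide (T.head = 0)) a.2) =
      (a'.1, clipWork (decide (T.head = 0)) a'.2) := by
  rw [Prod.mk.injEq, ← moveWork_eq_iff]
  simp only [WorkTape.act, WorkTape.mk.injEq]
  rw [(Function.update_injective T.cells T.head).eq_iff]

section Effects

variable {α : Type} (M : PATM α)

/-- What a move does, apart from the changes of the control components. -/
abbrev Motion : Type := Dir × (M.PubTape → M.Sym × Dir) × (M.PrivTape → M.Sym × Dir)

/-- Actions on the whole memory. -/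
abbrev Action : Type := M.Pub × M.Priv × M.Motion

/-- Effects of moves on the public part; a private input head counts as immobile. -/
abbrev Effect : Type := M.Pub × Dir × (M.PubTape → M.Sym × Dir)

/-- What a move depends on, and the tape heads that are on cell `0`. -/
structure Scan where
  pub : M.Pub
  priv : M.Priv
  input : InSym α
  pubTapes : M.PubTape → M.Sym × Bool
  privTapes : M.PrivTape → M.Sym × Bool

variable {M} {x : List α} {c c' : M.Cfg}

/-- What a machine reads in a configuration. -/
def Cfg.scan (c : M.Cfg) (x : List α) : M.Scan where
  pub := c.pub
  priv := c.priv
  input := inputSym x c.inHead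
  pubTapes t := ((c.pubTapes t).read, decide ((c.pubTapes t).head = 0))
  privTapes t := ((c.privTapes t).read, decide ((c.privTapes t).head = 0))

namespace Scan

variable (s : M.Scan)

/-- The motion without effect. -/
def idle : M.Motion :=
  (.stay, fun t => ((s.pubTapes t).1, .stay), fun t => ((s.privTapes t).1, .stay))

/-- The effect of an action on the public part. -/
def effect (a : M.Action) : M.Effect :=
  (a.1, if M.headPrivate then .stay else clipInput s.input a.2.2.1,
    fun t => ((a.2.2.2.1 t).1, clipWork (s.pubTapes t).2 (a.2.2.2.1 t).2))

/-- The action of the existential choice `e`. -/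
def existential (e : M.EChoice) : M.Action :=
  let a := M.nextE s.pub (if M.headPrivate then none else some s.input)
    (fun t => (s.pubTapes t).1) e
  (a.1, s.priv, if M.headPrivate then .stay else a.2.1, a.2.2, s.idle.2.2)

/-- The action of the universal choice `u`. -/
def universal (u : M.UChoice) : M.Action :=
  M.nextU s.pub s.priv s.input (fun t => (s.pubTapes t).1) (fun t => (s.privTapes t).1) u

/-- The action of the deterministic move. -/
def deterministic : M.Action :=
  M.nextD s.pub s.priv s.input (fun t => (s.pubTapes t).1) fun t => (s.privTapes t).1

end Scan

theorem act_idle : c.act x (c.pub, c.priv, (c.scan x).idle) = c := by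
  simp only [Cfg.act, Scan.idle, Cfg.scan, WorkTape.act_read_stay, Dir.moveInput]

theorem act_existential (e : M.EChoice) :
    c.act x ((c.scan x).existential e) = c.stepE x e := by
  simp only [Cfg.act, Cfg.stepE, Scan.existential, Scan.idle, Cfg.scan, WorkTape.act_read_stay]
  cases M.headPrivate <;> rfl

theorem view_act_eq_iff (hv : c.view = c'.view) (hc : c.inHead < x.length + 2)
    (a a' : M.Action) :
    (c.act x a).view = (c'.act x a').view ↔ (c.scan x).effect a = (c'.scan x).effect a' := by
  simp only [Cfg.view, View.mk.injEq] at hv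
  obtain ⟨-, hhead, htapes⟩ := hv
  simp only [Cfg.view, View.mk.injEq, Cfg.act, Cfg.scan, Scan.effect, Prod.mk.injEq, htapes,
    funext_iff, act_eq_act_iff]
  refine and_congr_right fun _ => and_congr_left fun _ => ?_
  cases hp : M.headPrivate
  · simp only [hp, Bool.false_eq_true, if_false, Option.some.injEq] at hhead ⊢
    rw [← hhead, moveInput_eq_iff hc]
  · simp

theorem view_act_eq_self_iff (hc : c.inHead < x.length + 2) (a : M.Action) :
    (c.act x a).view = c.view ↔
      (c.scan x).effect a = (c.scan x).effect (c.pub, c.priv, (c.scan x).idle) := by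
  rw [← view_act_eq_iff rfl hc, act_idle]

theorem ReachesWith.inHead_lt {k : ℕ} (hc : M.ReachesWith x k c) : c.inHead < x.length + 2 := by
  induction hc with
  | start => simp [startCfg]
  | existential e _ _ ih =>
    simp only [Cfg.stepE]
    split
    · exact ih
    · exact moveInput_lt ih _
  | universal u _ _ ih => exact moveInput_lt ih _
  | deterministic _ _ ih => exact moveInput_lt ih _

/-- The effect of an existential choice on the visible part. -/
def View.stepE (x : List α) (v : M.View) (e : M.EChoice) : M.View :=
  let a := M.nextE v.pub (v.inHead.map (inputSym x)) (fun t => (v.pubTapes t).read) e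
  ⟨a.1, v.inHead.map (a.2.1.moveInput x.length), fun t => (v.pubTapes t).act (a.2.2 t)⟩

theorem view_stepE (e : M.EChoice) : (c.stepE x e).view = c.view.stepE x e := by
  simp only [Cfg.view, Cfg.stepE, View.stepE]
  cases hp : M.headPrivate <;> simp

/-- The visible part of the memory after the events `h`. -/
def viewAfter (x : List α) (h : List M.Event) : M.View :=
  h.foldl (fun v => Sum.elim (v.stepE x) id) M.startCfg.view

theorem viewAfter_concat (h : List M.Event) (ev : M.Event) :
    viewAfter x (h ++ [ev]) = Sum.elim ((viewAfter x h).stepE x) id ev :=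
  List.foldl_concat ..

end Effects

end PATM

/-! ### Following all branches of a private alternating machine -/

namespace PATM

section Team

variable {α : Type} (M : PATM α) (r : ℕ)

/-- The universal choices that determine a branch. -/
abbrev Choices : Type := Fin (r + 1) → M.UChoice

/-- A branch of the game: a configuration, the number of universal moves so far, a change of the
public part that is still to be reported, and the history without that change. -/
structure Branch where
  cfg : M.Cfg
  count : Fin (r + 1)
  pending : Option M.Effect
  past : List M.Event

/-- All branches, followed in parallel. -/
abbrev Team : Type := M.Choices r → M.Branch r

/-- The initial team. -/
def startTeam : M.Team r := fun _ => ⟨M.startCfg, 0, none, []⟩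

variable {M r} {x : List α}

/-- The moves that need no decision of the existential player, with the number of universal moves
before and after them. -/
inductive Scan.Moves (s : M.Scan) (w : M.Choices r) :
    Fin (r + 1) → M.Action → Fin (r + 1) → Prop
  | deterministic {k : Fin (r + 1)} : M.kind s.pub s.priv = .deterministic →
      Moves s w k s.deterministic k
  | universal {k k' : Fin (r + 1)} : M.kind s.pub s.priv = .universal → k'.val = k.val + 1 →
      Moves s w k (s.universal (w k)) k'

namespace Branch

variable (b : M.Branch r)

/-- The history with a pending change. -/
def history : List M.Event :=
  match b.pending with
  | none => b.past
  | some _ => b.past ++ [.inr b.cfg.view]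

/-- Readiness for a joint step. -/
def Ready : Prop :=
  b.pending ≠ none ∨ b.cfg.kind = .existential ∨ b.cfg.kind = .accept

open Classical in
/-- The branch after the action `a`. -/
noncomputable def move (x : List α) (a : M.Action) (k : Fin (r + 1)) : M.Branch r where
  cfg := b.cfg.act x a
  count := k
  pending := if (b.cfg.act x a).view = b.cfg.view then none else some ((b.cfg.scan x).effect a)
  past := b.past

open Classical in
/-- The branch after a joint step: it reports a pending change, or makes the choice `e`. A branch
that has accepted records `e`, too, so that all histories keep the same length. -/
noncomputable def joint (x : List α) (e : M.EChoice) : M.Branch r :=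
  match b.pending with
  | none => ⟨if b.cfg.kind = .existential then b.cfg.stepE x e else b.cfg, b.count, none,
      b.past ++ [.inl e]⟩
  | some _ => ⟨b.cfg, b.count, none, b.past ++ [.inr b.cfg.view]⟩

end Branch

open Classical in
/-- A branch whose public part has changed waits until every other branch has changed it, too, or
is about to make an existential choice; then all of them proceed together. -/
inductive TeamStep (x : List α) (T : M.Team r) : M.Team r → Prop
  | single {w : M.Choices r} {a : M.Action} {k : Fin (r + 1)} : (T w).pending = none →
      ((T w).cfg.scan x).Moves w (T w).count a k →
      TeamStep x T (Function.update T w ((T w).move x a k))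
  | joint (σ : M.Strategy) : (∀ w, (T w).Ready) →
      TeamStep x T fun w => (T w).joint x (σ (T w).past)

/-- Every branch has reached an accepting state. -/
def Team.AllAccept (T : M.Team r) : Prop := ∀ w, (T w).cfg.kind = .accept

namespace Branch

variable {b : M.Branch r} {w : M.Choices r} {σ σ' : M.Strategy} {m n : ℕ}

theorem history_of_pending_eq_none (hb : b.pending = none) : b.history = b.past := by
  simp only [history, hb]

theorem history_move (hb : b.pending = none) (a : M.Action) (k : Fin (r + 1)) :
    (b.move x a k).history = observe b.history b.cfg (b.cfg.act x a) := by
  rw [history_of_pending_eq_none hb]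
  by_cases hv : (b.cfg.act x a).view = b.cfg.view
  · simp [observe_of_eq hv, history, move, hv]
  · simp [observe_of_ne hv, history, move, hv]

theorem history_joint (e : M.EChoice) : (b.joint x e).history = (b.joint x e).past := by
  unfold joint
  split <;> rfl

theorem length_past_joint (e : M.EChoice) : (b.joint x e).past.length = b.past.length + 1 := by
  unfold joint
  split <;> simp

theorem ready_iff_of_pending_eq_none (hb : b.pending = none) :
    b.Ready ↔ b.cfg.kind = .existential ∨ b.cfg.kind = .accept := by
  simp [Ready, hb]

/-- Under the strategy `σ` the branch accepts. Its potential `m` decreases in steps of the branch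
and in joint steps that report a pending change. -/
def Follows (x : List α) (σ : M.Strategy) (w : M.Choices r) (m : ℕ) (b : M.Branch r) : Prop :=
  ∃ n, AcceptsAlong x σ w n b.count b.history b.cfg ∧
    m = 2 * n + if b.pending.isSome then 1 else 0

theorem Follows.exists_move (h : b.Follows x σ w m) (hb : ¬b.Ready) :
    ∃ a k m', (b.cfg.scan x).Moves w b.count a k ∧ m' < m ∧ (b.move x a k).Follows x σ w m' := by
  have hle (a : M.Action) (k : Fin (r + 1)) :
      (if (b.move x a k).pending.isSome then 1 else 0) ≤ 1 := by split <;> simp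
  obtain ⟨n, ha, rfl⟩ := h
  simp only [Ready, not_or, not_not] at hb
  obtain ⟨hpending, hexistential, haccept⟩ := hb
  rcases hk : b.cfg.kind
  · exact absurd hk hexistential
  · obtain ⟨n, k, rfl, hk', ha⟩ := ha.universal_inv hk
    refine ⟨_, k, _, .universal hk hk', ?_, n, by rwa [history_move hpending], rfl⟩
    have := hle ((b.cfg.scan x).universal (w b.count)) k
    lia
  · obtain ⟨n, rfl, ha⟩ := ha.deterministic_inv hk
    refine ⟨_, b.count, _, .deterministic hk, ?_, n, by rwa [history_move hpending], rfl⟩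
    have := hle (b.cfg.scan x).deterministic b.count
    lia
  · exact absurd hk haccept
  · exact absurd hk ha.kind_ne_reject

theorem Follows.joint (h : b.Follows x σ w m) (hb : b.Ready) :
    ∃ m' ≤ m, (b.cfg.kind ≠ .accept → m' < m) ∧
      (b.joint x (σ b.past)).Follows x σ w m' := by
  obtain ⟨n, ha, rfl⟩ := h
  rcases b with ⟨c, k, _ | g, past⟩
  · rcases (ready_iff_of_pending_eq_none rfl).1 hb with hk | hk <;> dsimp only at hk
    · obtain ⟨n, rfl, ha'⟩ := ha.existential_inv hk
      exact ⟨2 * n, by lia, fun _ => by lia, n, by simpa [Branch.joint, hk, history] using ha', rfl⟩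
    · exact ⟨0, by lia, fun h => absurd hk h, 0, .accept (by simp [Branch.joint, hk]), rfl⟩
  · exact ⟨2 * n, by simp, fun _ => by simp, n, ha, rfl⟩

theorem acceptsAlong_of_move {a : M.Action} {k : Fin (r + 1)} (hb : b.pending = none)
    (hmove : (b.cfg.scan x).Moves w b.count a k)
    (ha : AcceptsAlong x σ w n (b.move x a k).count (b.move x a k).history (b.move x a k).cfg) :
    AcceptsAlong x σ w (n + 1) b.count b.history b.cfg := by
  rw [history_move hb] at ha
  cases hmove with
  | deterministic hk => exact .deterministic hk ha
  | universal hk hk' => exact .universal hk hk' ha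

theorem exists_acceptsAlong_of_joint (hb : b.Ready)
    (ha : AcceptsAlong x σ w n (b.joint x (σ b.past)).count (b.joint x (σ b.past)).history
      (b.joint x (σ b.past)).cfg) :
    ∃ m, AcceptsAlong x σ w m b.count b.history b.cfg := by
  rcases b with ⟨c, k, _ | g, past⟩
  · rcases (ready_iff_of_pending_eq_none rfl).1 hb with hk | hk
    · exact ⟨n + 1, .existential hk (by simpa [joint, history, show c.kind = _ from hk] using ha)⟩
    · exact ⟨0, .accept hk⟩
  · exact ⟨n, ha⟩

end Branch

variable {T T' : M.Team r}

theorem exists_allAccept {σ : M.Strategy} {m : M.Choices r → ℕ}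
    (h : ∀ w, (T w).Follows x σ w (m w)) :
    ∃ T', ReflTransGen (TeamStep x) T T' ∧ T'.AllAccept := by
  classical
  induction m using WellFoundedLT.induction generalizing T with
  | ind m ih =>
  by_cases hacc : T.AllAccept
  · exact ⟨T, .refl, hacc⟩
  by_cases hready : ∀ w, (T w).Ready
  · choose m' hle hlt hm' using fun w => (h w).joint (hready w)
    obtain ⟨w, hw⟩ := not_forall.1 hacc
    obtain ⟨T', hpath, hT'⟩ := ih m' (Pi.lt_def.2 ⟨hle, w, hlt w hw⟩) hm'
    exact ⟨T', hpath.head (.joint σ hready), hT'⟩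
  · obtain ⟨w, hw⟩ := not_forall.1 hready
    obtain ⟨a, k, n, hmove, hlt, hn⟩ := (h w).exists_move hw
    have hpending : (T w).pending = none := by
      by_contra hpending
      exact hw (.inl hpending)
    obtain ⟨T', hpath, hT'⟩ := ih (Function.update m w n) (update_lt_self_iff.2 hlt)
      (T := Function.update T w ((T w).move x a k)) fun v => by
        rcases eq_or_ne v w with rfl | hv
        · simpa only [Function.update_self] using hn
        · simpa only [Function.update_of_ne hv] using h v
    exact ⟨T', hpath.head (by convert TeamStep.single hpending hmove), hT'⟩

theorem exists_strategy (hpath : ReflTransGen (TeamStep x) T T') (hT' : T'.AllAccept) {m : ℕ}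
    (hlength : ∀ w, (T w).past.length = m) : ∃ σ : M.Strategy,
      ∀ w, ∃ n, AcceptsAlong x σ w n (T w).count (T w).history (T w).cfg := by
  classical
  induction hpath using ReflTransGen.head_induction_on generalizing m with
  | refl => exact ⟨fun _ => Classical.arbitrary _, fun w => ⟨0, .accept (hT' w)⟩⟩
  | head hstep _ ih =>
    cases hstep with
    | @single w a k hpending hmove =>
      obtain ⟨σ, hσ⟩ := ih (m := m) fun v => by
        rcases eq_or_ne v w with rfl | hv
        · rw [Function.update_self]
          exact hlength v
        · rw [Function.update_of_ne hv]
          exact hlength v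
      refine ⟨σ, fun v => ?_⟩
      obtain ⟨n, hn⟩ := hσ v
      rcases eq_or_ne v w with rfl | hv
      · rw [Function.update_self] at hn
        exact ⟨n + 1, Branch.acceptsAlong_of_move hpending hmove hn⟩
      · rw [Function.update_of_ne hv] at hn
        exact ⟨n, hn⟩
    | joint τ hready =>
      obtain ⟨σ, hσ⟩ := ih (m := m + 1) fun w => by rw [Branch.length_past_joint, hlength]
      let σ' : M.Strategy := fun h => if h.length = m then τ h else σ h
      have hσ' (h : List M.Event) (hh : m + 1 ≤ h.length) : σ h = σ' h :=
        (if_neg (by lia)).symm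
      refine ⟨σ', fun w => ?_⟩
      have hτ : τ _ = σ' (_ : List M.Event) := (if_pos (hlength w)).symm
      obtain ⟨n, hn⟩ := hσ w
      simp only [hτ] at hn
      refine Branch.exists_acceptsAlong_of_joint (hready w) (hn.congr hσ' ?_)
      rw [Branch.history_joint, Branch.length_past_joint, hlength]

theorem accepts_iff_exists_allAccept (hr : M.UniversalMovesAtMost r) : M.Accepts x ↔
    ∃ T, ReflTransGen (TeamStep x) (M.startTeam r) T ∧ T.AllAccept := by
  constructor
  · rintro ⟨σ, hσ⟩
    choose n hn using fun w : M.Choices r => hσ.exists_acceptsAlong (k := 0) hr w .start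
    exact exists_allAccept (σ := σ) fun w => ⟨n w, hn w, rfl⟩
  · rintro ⟨T, hpath, hT⟩
    obtain ⟨σ, hσ⟩ := exists_strategy hpath hT fun _ => List.length_nil
    choose n hn using hσ
    have := Fintype.ofFinite (M.Choices r)
    exact ⟨σ, wins_of_acceptsAlong (N := ∑ w, n w) (k := (0 : Fin (r + 1)))
      (fun _ => Classical.arbitrary _) fun w _ =>
        ⟨n w, Finset.single_le_sum (fun _ _ => Nat.zero_le _) (Finset.mem_univ w), hn w⟩⟩

end Team

end PATM

namespace PATM

section TeamMachine

variable {α : Type} {M : PATM α} {r : ℕ} {x : List α}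

variable (M r) in
/-- The finite part of a branch; the history is represented only by its equality with the
histories of other branches. -/
structure BranchState where
  pub : M.Pub
  priv : M.Priv
  count : Fin (r + 1)
  pending : Option M.Effect

instance : Finite (M.BranchState r) :=
  Finite.of_injective (fun s : M.BranchState r => (s.pub, s.priv, s.count, s.pending))
    (by rintro ⟨⟩ ⟨⟩ h; simpa using h)

variable (M r) in
/-- The part of a branch in a move of the simulating machine. -/
abbrev BranchAction : Type := M.BranchState r × M.Motion

/-- The finite part of a branch. -/
def Branch.state (b : M.Branch r) : M.BranchState r :=
  ⟨b.cfg.pub, b.cfg.priv, b.count, b.pending⟩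

namespace BranchState

variable (q : M.BranchState r) (s : M.Scan)

/-- Readiness for a joint step. -/
def Ready : Prop :=
  q.pending ≠ none ∨ M.kind q.pub q.priv = .existential ∨ M.kind q.pub q.priv = .accept

open Classical in
/-- The counterpart of `Branch.move`. -/
noncomputable def move (a : M.Action) (k : Fin (r + 1)) : M.BranchAction r :=
  (⟨a.1, a.2.1, k,
    if s.effect a = s.effect (q.pub, q.priv, s.idle) then none else some (s.effect a)⟩, a.2.2)

open Classical in
/-- The counterpart of `Branch.joint`. -/
noncomputable def joint (e : M.EChoice) : M.BranchAction r :=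
  if q.pending = none ∧ M.kind q.pub q.priv = .existential then
    (⟨(s.existential e).1, (s.existential e).2.1, q.count, none⟩, (s.existential e).2.2)
  else (⟨q.pub, q.priv, q.count, none⟩, s.idle)

end BranchState

namespace Branch

variable {b b' : M.Branch r}

/-- The action `a` leads from the branch `b` to `b'`, up to the history. -/
def Performs (x : List α) (b : M.Branch r) (a : M.BranchAction r) (b' : M.Branch r) : Prop :=
  b'.cfg = b.cfg.act x (a.1.pub, a.1.priv, a.2) ∧ b'.state = a.1

theorem performs_idle : b.Performs x (b.state, (b.cfg.scan x).idle) b :=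
  ⟨act_idle.symm, rfl⟩

theorem performs_move (hb : b.cfg.inHead < x.length + 2) (a : M.Action) (k : Fin (r + 1)) :
    b.Performs x (b.state.move (b.cfg.scan x) a k) (b.move x a k) := by
  classical
  exact ⟨rfl, congrArg (BranchState.mk _ _ _) (if_congr (view_act_eq_self_iff hb a) rfl rfl)⟩

theorem performs_joint (e : M.EChoice) :
    b.Performs x (b.state.joint (b.cfg.scan x) e) (b.joint x e) := by
  rcases b with ⟨c, k, _ | g, past⟩
  · by_cases hk : c.kind = .existential
    · have hstate : M.kind c.pub c.priv = .existential := hk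
      simp only [Performs, joint, state, BranchState.joint, hk, hstate, and_self, if_true]
      exact ⟨(act_existential e).symm, by rw [← act_existential]; rfl⟩
    · have hstate : M.kind c.pub c.priv ≠ .existential := hk
      simp only [Performs, joint, state, BranchState.joint, hk, hstate, and_false, if_false]
      exact ⟨act_idle.symm, trivial⟩
  · simp only [Performs, joint, state, BranchState.joint, reduceCtorEq, false_and, if_false]
    exact ⟨act_idle.symm, trivial⟩

/-- The past determines what the existential player sees, except for a pending change. -/
structure Inv (x : List α) (b : M.Branch r) : Prop where
  reaches : M.ReachesWith x b.count b.cfg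
  view_eq : b.pending = none → b.cfg.kind ≠ .accept → b.cfg.view = viewAfter x b.past
  change : ∀ g ∈ b.pending, ∃ (c : M.Cfg) (a : M.Action), c.inHead < x.length + 2 ∧
    c.view = viewAfter x b.past ∧ b.cfg = c.act x a ∧ g = (c.scan x).effect a

theorem Inv.move {w : M.Choices r} {a : M.Action} {k : Fin (r + 1)} (hb : b.Inv x)
    (hpending : b.pending = none) (hmove : (b.cfg.scan x).Moves w b.count a k) :
    (b.move x a k).Inv x := by
  have hreaches : M.ReachesWith x k (b.cfg.act x a) ∧ b.cfg.kind ≠ .accept := by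
    cases hmove with
    | deterministic hk =>
      have hk : b.cfg.kind = .deterministic := hk
      exact ⟨.deterministic hb.reaches hk, by simp [hk]⟩
    | universal hk hk' =>
      have hk : b.cfg.kind = .universal := hk
      exact ⟨hk' ▸ .universal _ hb.reaches hk, by simp [hk]⟩
  obtain ⟨hreaches, hk⟩ := hreaches
  have hview := hb.view_eq hpending hk
  refine ⟨hreaches, fun hnone _ => ?_, fun g hg => ?_⟩
  · by_contra hne
    have hne' : (b.cfg.act x a).view ≠ b.cfg.view := fun h => hne (h.trans hview)
    exact absurd hnone (by simp [Branch.move, hne'])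
  · simp only [Branch.move, Option.mem_def, ite_eq_iff, reduceCtorEq, and_false, false_or,
      Option.some.injEq] at hg
    exact ⟨b.cfg, a, hb.reaches.inHead_lt, hview, rfl, hg.2.symm⟩

theorem Inv.joint (hb : b.Inv x) (hready : b.Ready) (e : M.EChoice) : (b.joint x e).Inv x := by
  obtain ⟨hreaches, hview, -⟩ := hb
  rcases b with ⟨c, k, _ | g, past⟩
  · rcases (ready_iff_of_pending_eq_none rfl).1 hready with hk | hk <;> dsimp only at hk
    · refine ⟨?_, fun _ _ => ?_, nofun⟩
      · simpa [Branch.joint, hk] using ReachesWith.existential e hreaches hk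
      · simp [Branch.joint, hk, viewAfter_concat, view_stepE, ← hview rfl (by simp [hk])]
    · refine ⟨?_, fun _ h => ?_, nofun⟩
      · simpa [Branch.joint, hk] using hreaches
      · simp [Branch.joint, hk] at h
  · exact ⟨hreaches, fun _ _ => by simp [Branch.joint, viewAfter_concat], nofun⟩

theorem Inv.past_joint_eq_iff (hb : b.Inv x) (hb' : b'.Inv x) (σ : M.Strategy) :
    (b.joint x (σ b.past)).past = (b'.joint x (σ b'.past)).past ↔
      b.past = b'.past ∧ b.pending = b'.pending := by
  have hchange := hb.change
  have hchange' := hb'.change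
  rcases b with ⟨c, k, _ | g, past⟩ <;> rcases b' with ⟨c', k', _ | g', past'⟩
  · simpa [Branch.joint] using congrArg σ
  · simp [Branch.joint]
  · simp [Branch.joint]
  · obtain ⟨d, a, hd, hview, hact, rfl⟩ := hchange _ rfl
    obtain ⟨d', a', -, hview', hact', rfl⟩ := hchange' _ rfl
    dsimp only at hview hview' hact hact'
    subst hact hact'
    simp only [Branch.joint, List.append_singleton_inj, Sum.inr.injEq, Option.some.injEq]
    refine and_congr_right fun hpast => view_act_eq_iff ?_ hd a a'
    rw [hview, hview', hpast]

end Branch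

/-- The invariant of all branches. -/
def Team.Inv (x : List α) (T : M.Team r) : Prop := ∀ w, (T w).Inv x

variable {T T' : M.Team r}

theorem startTeam_inv : (M.startTeam r).Inv x :=
  fun _ => ⟨.start, fun _ _ => rfl, nofun⟩

theorem TeamStep.inv (h : TeamStep x T T') (hT : T.Inv x) : T'.Inv x := by
  classical
  intro v
  cases h with
  | @single w a k hpending hmove =>
    rcases eq_or_ne v w with rfl | hv
    · rw [Function.update_self]
      exact (hT v).move hpending hmove
    · rw [Function.update_of_ne hv]
      exact hT v
  | joint σ hready => exact (hT v).joint (hready v) _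

open Classical in
/-- The counterpart of `TeamStep`: `R` relates the branches with equal pasts. -/
inductive TeamMove (S : M.Choices r → M.BranchState r) (R : M.Choices r → M.Choices r → Prop)
    (s : M.Choices r → M.Scan) :
    (M.Choices r → M.BranchAction r) → (M.Choices r → M.Choices r → Prop) → Prop
  | single {w : M.Choices r} {a : M.Action} {k : Fin (r + 1)} : (S w).pending = none →
      (s w).Moves w (S w).count a k →
      TeamMove S R s (Function.update (fun v => (S v, (s v).idle)) w ((S w).move (s w) a k)) R
  | joint {e : M.Choices r → M.EChoice} : (∀ w, (S w).Ready) →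
      (∀ w w', R w w' → e w = e w') →
      TeamMove S R s (fun w => (S w).joint (s w) (e w))
        fun w w' => R w w' ∧ (S w).pending = (S w').pending

/-- Branches with equal pasts. -/
def Team.SamePast (T : M.Team r) (w w' : M.Choices r) : Prop := (T w).past = (T w').past

/-- The moves that the simulating machine can make. -/
abbrev Team.Move (x : List α) (T : M.Team r) :
    (M.Choices r → M.BranchAction r) → (M.Choices r → M.Choices r → Prop) → Prop :=
  TeamMove (fun w => (T w).state) T.SamePast fun w => (T w).cfg.scan x

theorem samePast_joint (hT : T.Inv x) (σ : M.Strategy) :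
    Team.SamePast (fun w => (T w).joint x (σ (T w).past)) =
      fun w w' => T.SamePast w w' ∧ (T w).pending = (T w').pending := by
  ext w w'
  exact (hT w).past_joint_eq_iff (hT w') σ

open Classical in
theorem samePast_update_move (w : M.Choices r) (a : M.Action) (k : Fin (r + 1)) :
    Team.SamePast (Function.update T w ((T w).move x a k)) = T.SamePast := by
  have hpast (v : M.Choices r) :
      (Function.update T w ((T w).move x a k) v).past = (T v).past := by
    rcases eq_or_ne v w with rfl | hv
    · rw [Function.update_self]
      rfl
    · rw [Function.update_of_ne hv]
  ext v v'
  simp only [Team.SamePast, hpast]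

open Classical in
theorem performs_update_move (hT : T.Inv x) (w : M.Choices r) (a : M.Action) (k : Fin (r + 1))
    (v : M.Choices r) :
    (T v).Performs x (Function.update (fun v => ((T v).state, ((T v).cfg.scan x).idle)) w
      ((T w).state.move ((T w).cfg.scan x) a k) v) (Function.update T w ((T w).move x a k) v) := by
  rcases eq_or_ne v w with rfl | hv
  · simp only [Function.update_self]
    exact Branch.performs_move (hT v).reaches.inHead_lt a k
  · simp only [Function.update_of_ne hv]
    exact Branch.performs_idle

theorem TeamStep.exists_move (hT : T.Inv x) (h : TeamStep x T T') :
    ∃ A, T.Move x A T'.SamePast ∧ ∀ w, (T w).Performs x (A w) (T' w) := by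
  cases h with
  | single hpending hmove =>
    refine ⟨_, ?_, performs_update_move hT _ _ _⟩
    rw [samePast_update_move]
    exact .single hpending hmove
  | joint σ hready =>
    refine ⟨_, ?_, fun w => Branch.performs_joint _⟩
    rw [samePast_joint hT]
    exact .joint hready fun w w' hww' => congrArg σ hww'

theorem TeamMove.exists_step (hT : T.Inv x) {A : M.Choices r → M.BranchAction r}
    {R : M.Choices r → M.Choices r → Prop} (h : T.Move x A R) :
    ∃ T', TeamStep x T T' ∧ T'.SamePast = R ∧ ∀ w, (T w).Performs x (A w) (T' w) := by
  cases h with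
  | single hpending hmove =>
    exact ⟨_, .single hpending hmove, samePast_update_move .., performs_update_move hT _ _ _⟩
  | @joint e hready he =>
    have hfactors : Function.FactorsThrough e fun w => (T w).past := fun w w' => he w w'
    obtain ⟨σ, rfl⟩ := (Function.factorsThrough_iff e).1 hfactors
    exact ⟨_, .joint σ hready, samePast_joint hT σ, fun w => Branch.performs_joint _⟩

variable (M r) in
/-- The machine that follows all branches; the state `none` is accepting. -/
def teamMachine : MTM α where
  State := Option ((M.Choices r → M.BranchState r) × (M.Choices r → M.Choices r → Prop))
  Sym := M.Sym
  Head := M.Choices r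
  Tape := M.Choices r × (M.PubTape ⊕ M.PrivTape)
  blank := M.blank
  start := some (fun _ => ⟨M.startPub, M.startPriv, 0, none⟩, fun _ _ => True)
  accept := none
  next
    | none, _ => ∅
    | some (S, R), (input, tapes) => {a |
      (∀ w, M.kind (S w).pub (S w).priv = .accept) ∧
        a = (none, fun _ => .stay, fun t => ((tapes t).1, .stay)) ∨
      ∃ A R', TeamMove S R (fun w => ⟨(S w).pub, (S w).priv, input w,
          fun t => tapes (w, .inl t), fun t => tapes (w, .inr t)⟩) A R' ∧
        a = (some (fun w => (A w).1, R'), fun w => (A w).2.1,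
          fun t => Sum.elim (A t.1).2.2.1 (A t.1).2.2.2 t.2)}

/-- The configuration of the simulating machine that corresponds to a team. -/
def teamCfg (T : M.Team r) : (teamMachine M r).Cfg where
  state := some (fun w => (T w).state, T.SamePast)
  heads w := (T w).cfg.inHead
  tapes t := Sum.elim (T t.1).cfg.pubTapes (T t.1).cfg.privTapes t.2

/-- The accepting configuration that is reached from a team. -/
def acceptCfg (T : M.Team r) : (teamMachine M r).Cfg := { teamCfg T with state := none }

theorem startCfg_eq_teamCfg : (teamMachine M r).startCfg = teamCfg (M.startTeam r) := by
  have hsame : (M.startTeam r).SamePast = fun _ _ => True := by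
    ext
    simp [Team.SamePast, startTeam]
  simp only [MTM.startCfg, teamCfg, hsame]
  congr 1
  · funext ⟨w, t⟩
    cases t <;> rfl

theorem move_teamCfg {A : M.Choices r → M.BranchAction r}
    (hA : ∀ w, (T w).Performs x (A w) (T' w)) :
    (teamCfg T).move x (some (fun w => (A w).1, T'.SamePast)) (fun w => (A w).2.1,
      fun t => Sum.elim (A t.1).2.2.1 (A t.1).2.2.2 t.2) = teamCfg T' := by
  have hstate : (fun w => (A w).1) = fun w => (T' w).state := funext fun w => (hA w).2.symm
  simp only [hstate, teamCfg, MTM.Cfg.move]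
  congr 1
  · exact funext fun w => congrArg Cfg.inHead (hA w).1.symm
  · funext ⟨w, t⟩
    rw [(hA w).1]
    cases t <;> rfl

theorem move_teamCfg_accept :
    (teamCfg T).move x none (fun _ => .stay, fun t => (((teamCfg T).tapes t).read, .stay)) =
      acceptCfg T :=
  congrArg (MTM.Cfg.mk _ _) (funext fun _ => WorkTape.act_read_stay _)

theorem step_teamCfg_iff (hT : T.Inv x) {c : (teamMachine M r).Cfg} :
    (teamMachine M r).Step x (teamCfg T) c ↔
      (∃ T', TeamStep x T T' ∧ c = teamCfg T') ∨ (T.AllAccept ∧ c = acceptCfg T) := by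
  constructor
  · rintro ⟨_, ⟨hacc, rfl⟩ | ⟨A, R, hA, rfl⟩, rfl⟩
    · exact .inr ⟨hacc, move_teamCfg_accept⟩
    · obtain ⟨T', hstep, rfl, hperforms⟩ := TeamMove.exists_step hT hA
      exact .inl ⟨T', hstep, move_teamCfg hperforms⟩
  · rintro (⟨T', hstep, rfl⟩ | ⟨hacc, rfl⟩)
    · obtain ⟨A, hA, hperforms⟩ := hstep.exists_move hT
      exact ⟨_, .inr ⟨A, _, hA, rfl⟩, (move_teamCfg hperforms).symm⟩
    · exact ⟨_, .inl ⟨hacc, rfl⟩, move_teamCfg_accept.symm⟩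

theorem inv_of_reachable (h : ReflTransGen (TeamStep x) (M.startTeam r) T) : T.Inv x := by
  induction h with
  | refl => exact startTeam_inv
  | tail _ hstep ih => exact hstep.inv ih

theorem exists_team_of_reachable {c : (teamMachine M r).Cfg}
    (h : (teamMachine M r).Reachable x c) :
    ∃ T, ReflTransGen (TeamStep x) (M.startTeam r) T ∧
      (c = teamCfg T ∨ T.AllAccept ∧ c = acceptCfg T) := by
  induction h with
  | refl => exact ⟨_, .refl, .inl startCfg_eq_teamCfg⟩
  | tail _ hstep ih =>
    obtain ⟨T, hT, rfl | ⟨-, rfl⟩⟩ := ih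
    · rcases (step_teamCfg_iff (inv_of_reachable hT)).1 hstep with ⟨T', hT', rfl⟩ | hacc
      · exact ⟨T', hT.tail hT', .inl rfl⟩
      · exact ⟨T, hT, .inr hacc⟩
    · obtain ⟨a, ha, -⟩ := hstep
      exact absurd ha (Set.notMem_empty a)

theorem reachable_teamCfg (h : ReflTransGen (TeamStep x) (M.startTeam r) T) :
    (teamMachine M r).Reachable x (teamCfg T) := by
  induction h with
  | refl => exact startCfg_eq_teamCfg ▸ .refl
  | tail hpath hstep ih =>
    exact ih.tail ((step_teamCfg_iff (inv_of_reachable hpath)).2 (.inl ⟨_, hstep, rfl⟩))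

theorem teamMachine_accepts_iff : (teamMachine M r).Accepts x ↔
    ∃ T, ReflTransGen (TeamStep x) (M.startTeam r) T ∧ T.AllAccept := by
  constructor
  · rintro ⟨c, hc, haccept⟩
    obtain ⟨T, hT, rfl | ⟨hacc, -⟩⟩ := exists_team_of_reachable hc
    · cases haccept
    · exact ⟨T, hT, hacc⟩
  · rintro ⟨T, hT, hacc⟩
    have hstep := (step_teamCfg_iff (inv_of_reachable hT)).2 (.inr ⟨hacc, rfl⟩)
    exact ⟨acceptCfg T, (reachable_teamCfg hT).tail hstep, rfl⟩

theorem teamMachine_spaceBounded {s : ℕ → ℕ} (hM : M.SpaceBounded s) :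
    (teamMachine M r).SpaceBounded s := by
  rintro x c hc ⟨w, t⟩
  obtain ⟨T, hT, hcfg⟩ := exists_team_of_reachable hc
  have hbound := hM x _ _ (inv_of_reachable hT w).reaches
  rcases hcfg with rfl | ⟨-, rfl⟩ <;> rcases t with t | t
  · exact hbound.1 t
  · exact hbound.2 t
  · exact hbound.1 t
  · exact hbound.2 t

end TeamMachine

end PATM

theorem paspaceConst_subset_mnl {α : Type} {s : ℕ → ℕ} (hs : IsLogBound s) :
    PASPACEConst α s ⊆ MNL α := by
  rintro L ⟨M, hM, ⟨r, hr⟩, hL⟩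
  refine ⟨s, hs, M.teamMachine r, PATM.teamMachine_spaceBounded hM, fun x => ?_⟩
  rw [hL x, PATM.teamMachine_accepts_iff, PATM.accepts_iff_exists_allAccept hr]

theorem baspaceConst_subset_paspaceConst (α : Type) (s : ℕ → ℕ) :
    BASPACEConst α s ⊆ PASPACEConst α s :=
  fun _ ⟨M, _, h⟩ => ⟨M, h⟩

end PrivAlt

theorem mainTheorem2 (α : Type) [Finite α] (s : ℕ → ℕ) (hs : PrivAlt.IsLogBound s) :
    PrivAlt.PASPACEConst α s = PrivAlt.NL α ∧ PrivAlt.BASPACEConst α s = PrivAlt.NL α := by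
  have nl_subset_baspaceConst : PrivAlt.NL α ⊆ PrivAlt.BASPACEConst α s :=
    ((PrivAlt.nl_subset_mnl α).trans (PrivAlt.mnl_subset_counterNL α)).trans
      (PrivAlt.counterNL_subset_baspaceConst α s)
  have baspaceConst_subset_paspaceConst : PrivAlt.BASPACEConst α s ⊆ PrivAlt.PASPACEConst α s :=
    PrivAlt.baspaceConst_subset_paspaceConst α s
  have paspaceConst_subset_nl : PrivAlt.PASPACEConst α s ⊆ PrivAlt.NL α :=
    ((PrivAlt.paspaceConst_subset_mnl hs).trans (PrivAlt.mnl_subset_counterNL α)).trans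
      (PrivAlt.counterNL_subset_nl α)
  exact ⟨paspaceConst_subset_nl.antisymm
      (nl_subset_baspaceConst.trans baspaceConst_subset_paspaceConst),
    (baspaceConst_subset_paspaceConst.trans paspaceConst_subset_nl).antisymm
      nl_subset_baspaceConst⟩
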